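/- Let $G$ be a finite group. All Hilbert spaces are finite-dimensional and complex, inner products are antilinear in the first variable. **2-representations.** An $H^*$-category is a category enriched in finite-dimensional Hilbert spaces with an antilinear involution $f\mapsto f^*$, $\mathrm{Hom}(x,y)\to\mathrm{Hom}(y,x)$, such that $(gf)^*=f^*g^*$, $(gf,h)=(f,g^*h)$ and $(gf,h)=(g,hf^*)$. A *marked 2-Hilbert space* is an $H^*$-category which is Cauchy complete (finite direct sums exist, idempotents split), together with a finite family $(e_i)_{i\in I}$ of simple objects ($\mathrm{End}(e_i)=\mathbb C$) containing exactly one object of each isomorphism class of simple objects; put $k_i=(\mathrm{id}_{e_i},\mathrm{id}_{e_i})>0$. A morphism $f$ is unitary if $f^*=f^{-1}$. A *marked unitary 2-representation* $\alpha$ of $G$ consists of a marked 2-Hilbert space $H_\alpha$, linear $*$-functors $\alpha_g:H_\alpha\to H_\alpha$ that are isometric isomorphisms on hom-spaces, and unitary natural isomorphisms $\mathrm{id}\Rightarrow\alpha_1$ and $\alpha_{g_2}\alpha_{g_1}\Rightarrow\alpha_{g_2g_1}$ satisfying the unit and associativity laws. A morphism $\sigma:\alpha\to\beta$ is a linear $*$-functor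 $\sigma:H_\alpha\to H_\beta$ with unitary natural isomorphisms $\sigma_g:\beta_g\sigma\Rightarrow\sigma\alpha_g$ compatible with these data. $[2\mathrm{Rep}_m(G)]$ is the category of marked unitary 2-representations and isomorphism classes of morphisms (an isomorphism of morphisms is a natural isomorphism compatible with the $\sigma_g$). **Bundles and the 2-character.** $\mathrm{Hilb}_G(G)$ is the category of unitary equivariant Hilbert bundles over $G$ acting on itself by conjugation: Hilbert spaces $E_g$ with unitary maps $E_g\to E_{hgh^{-1}}$ ($h\in G$), functorial in $h$; morphisms are equivariant families of linear maps, and such a morphism is unitary if all its components are. The *2-character* $\chi_\alpha$ has fibres $\chi_\alpha(g)=\mathrm{Nat}(\mathrm{id},\alpha_g)$ with $(\theta,\theta')=\sum_{i}k_i(\theta_{e_i},\theta'_{e_i})$; $h$ sends $\theta$ to the composite $x\to\alpha_1x\to\alpha_h\alpha_{h^{-1}}x\xrightarrow{\alpha_h(\theta)}\alpha_h\alpha_g\alpha_{h^{-1}}x\to\alpha_{hgh^{-1}}x$. For a morphism $\sigma:\alpha\to\beta$ choose a right adjoint $\sigma^*$ which is a linear $*$-functor, with unit $\eta$ and counit $\epsilon$;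 $\chi(\sigma)$ sends $\theta\in\chi_\alpha(g)$ to the transformation with components $$\chi(\sigma)_g(\theta)_y=\beta_g(\epsilon_y)\circ(\sigma_g^{-1})_{\sigma^*y}\circ\sigma(\theta_{\sigma^*y})\circ\Psi(\eta)_y ,\qquad \Psi(\eta)_y=(\varphi^{\dagger}(\mathrm{id}_{\sigma^*y}))^*:y\to\sigma\sigma^*y,$$ where $\varphi^\dagger$ is the Hilbert space adjoint of $\varphi:\mathrm{Hom}(\sigma\sigma^*y,y)\to\mathrm{Hom}(\sigma^*y,\sigma^*y)$, $f\mapsto\sigma^*(f)\circ\eta_{\sigma^*y}$. **Gerbes.** A finite discrete $G$-equivariant gerbe with metric $\mathcal X$ is a central extension by $U(1)$ of the action groupoid of a finite $G$-set $X$ (so its arrows $x\to y$ of degree $g$, where $gx=y$, form a $U(1)$-torsor), with a $G$-invariant function $k:X\to\mathbb R_{>0}$. A morphism $E:\mathcal X\to\mathcal Y$ is a unitary equivariant vector bundle over $\mathcal Y\otimes\overline{\mathcal X}$, that is, Hilbert spaces $\langle y|E|x\rangle$ with functorial unitary maps $E(v\otimes\bar u):\langle y|E|x\rangle\to\langle y'|E|x'\rangle$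 for arrows $v:y\to y'$, $u:x\to x'$ of equal degree, $E(zv\otimes\bar u)=zE(v\otimes\bar u)$ and $E(v\otimes\overline{zu})=\bar zE(v\otimes\bar u)$ for $z\in U(1)$. Composition is convolution $\langle z|F\circ E|x\rangle=\bigoplus_y\tfrac1{k_y}\langle z|F|y\rangle\otimes\langle y|E|x\rangle$, where $kV$ is $V$ with its inner product multiplied by $k$; the identity has $\langle y|\mathrm{id}|x\rangle=\delta_{xy}k_x\mathbb C$, with $v\otimes\bar u$ acting by the phase $v/u$. $[\mathrm{Gerbes}(G)]$ is the category of such gerbes and isomorphism classes of morphisms. The gerbe $\mathcal X_\alpha$ of $\alpha$ has object set $I$, metric $(k_i)$, and as arrows $i\to j$ of degree $g$ the unitary morphisms $u:e_j\to\alpha_g(e_i)$; the composite of $u:i\to j$ and $v:j\to l$ (of degree $h$) is $e_l\xrightarrow{v}\alpha_he_j\xrightarrow{\alpha_h(u)}\alpha_h\alpha_ge_i\to\alpha_{hg}e_i$. A morphism $\sigma:\alpha\to\beta$ gives $\langle\sigma\rangle:\mathcal X_\alpha\to\mathcal X_\beta$ with fibres $\langle m|\sigma|i\rangle=\mathrm{Hom}(e_m,\sigma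 e_i)$, where $v\otimes\bar u$ (degree $g$) sends $\ell$ to $\sigma(u^*)\circ\sigma_g\circ\beta_g(\ell)\circ v$. **Geometric character.** The transgression of $\mathcal X$ is the functor sending a pair $(x,g)$ with $gx=x$ to the $U(1)$-torsor of arrows $u:x\to x$ of degree $g$, on which $h\in G$ acts by $u\mapsto vuv^{-1}$ for any arrow $v$ of degree $h$ out of $x$. It has an associated equivariant hermitian line bundle $P\mapsto P_{\mathbb C}=P\times_{U(1)}\mathbb C$. The geometric character $\mathrm{ch}(\mathcal X)\in\mathrm{Hilb}_G(G)$ is its push-forward to $G$: its fibre over $g$ is the space of sections over the fixed points of $g$, with $(\psi,\psi')=\sum_{gx=x}k_x(\psi(x),\psi'(x))$ and the induced action of $G$. For a loop $u$ of degree $g$ at $x$ let $s_u\in\mathrm{ch}(\mathcal X)_g$ be the section with value $u\otimes k_x^{-1/2}$ at $x$ and $0$ elsewhere. For $E:\mathcal X\to\mathcal Y$ the map $\mathrm{ch}(E)_g$ is determined by $$(s_v,\mathrm{ch}(E)_g\,s_u)=\overline{\mathrm{Tr}\,E(v\otimes\bar u)}$$ for all loops $u$ of degree $g$ at $x\in X$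 and $v$ of degree $g$ at $y\in Y$. **Theorem.** Every morphism $\sigma$ of marked unitary 2-representations has a right adjoint which is a linear $*$-functor, and there are functors $\chi:[2\mathrm{Rep}_m(G)]\to\mathrm{Hilb}_G(G)$, $\mathcal X:[2\mathrm{Rep}_m(G)]\to[\mathrm{Gerbes}(G)]$ and $\mathrm{ch}:[\mathrm{Gerbes}(G)]\to\mathrm{Hilb}_G(G)$ with the values on objects and on morphisms described above (in particular $\chi(\sigma)$ does not depend on the choice of the right adjoint). The 2-character of a marked unitary 2-representation is unitarily naturally isomorphic to the geometric character of its gerbe: there are unitary isomorphisms $$\gamma_\alpha:\chi_\alpha\to\mathrm{ch}(\mathcal X_\alpha)$$ in $\mathrm{Hilb}_G(G)$ which are natural in $\alpha$, so that the triangle formed by $\chi$, $\mathcal X$ and $\mathrm{ch}$ commutes up to the unitary natural isomorphism $\gamma:\chi\cong\mathrm{ch}\circ\mathcal X$. -/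

import Mathlib

open CategoryTheory CategoryTheory.Limits
open scoped TensorProduct ComplexConjugate

universe u v w

set_option linter.unusedVariables false
set_option linter.checkUnivs false

noncomputable section

/-! ## Finite-dimensional Hilbert spaces -/

/-- A finite-dimensional complex Hilbert space: a finite-dimensional complex vector space with a
positive definite hermitian form, antilinear in the first variable. -/
structure Hilb : Type (w + 1) where
  carrier : Type w
  [addCommGroup : AddCommGroup carrier]
  [module : Module ℂ carrier]
  [finite : FiniteDimensional ℂ carrier]
  core : InnerProductSpace.Core ℂ carrier

namespace Hilb

instance : CoeSort Hilb.{w} (Type w) := ⟨carrier⟩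
instance (V : Hilb.{w}) : AddCommGroup V := V.addCommGroup
instance (V : Hilb.{w}) : Module ℂ V := V.module
instance (V : Hilb.{w}) : FiniteDimensional ℂ V := V.finite

/-- The inner product of a Hilbert space. -/
def inner (V : Hilb.{w}) (x y : V) : ℂ := V.core.inner x y

/-- Morphisms of Hilbert spaces are arbitrary linear maps. -/
@[ext] structure Hom (V W : Hilb.{w}) : Type w where
  lin : V →ₗ[ℂ] W

instance : Category Hilb.{w} where
  Hom := Hom
  id V := ⟨LinearMap.id⟩
  comp f g := ⟨g.lin.comp f.lin⟩

@[simp] theorem id_lin (V : Hilb.{w}) : Hom.lin (𝟙 V) = LinearMap.id := rfl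
@[simp] theorem comp_lin {U V W : Hilb.{w}} (f : U ⟶ V) (g : V ⟶ W) :
    (f ≫ g).lin = g.lin.comp f.lin := rfl
@[ext] theorem hom_ext {V W : Hilb.{w}} {f g : V ⟶ W} (h : ∀ x, f.lin x = g.lin x) : f = g :=
  Hom.ext (LinearMap.ext h)

/-- A linear map is unitary when it is bijective and preserves inner products. -/
def IsUnitary {V W : Hilb.{w}} (f : V ⟶ W) : Prop :=
  Function.Bijective f.lin ∧ ∀ x y : V, W.inner (f.lin x) (f.lin y) = V.inner x y

/-- The Hilbert space adjoint of a linear map. -/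
def adjoint {V W : Hilb.{w}} (f : V →ₗ[ℂ] W) : W →ₗ[ℂ] V :=
  let _ := V.core.toNormedAddCommGroup
  let _ := InnerProductSpace.ofCore V.core.toCore
  let _ := W.core.toNormedAddCommGroup
  let _ := InnerProductSpace.ofCore W.core.toCore
  LinearMap.adjoint f

theorem inner_adjoint {V W : Hilb.{w}} (f : V →ₗ[ℂ] W) (x : V) (y : W) :
    V.inner (adjoint f y) x = W.inner y (f x) := by
  let _ := V.core.toNormedAddCommGroup
  let _ := InnerProductSpace.ofCore V.core.toCore
  let _ := W.core.toNormedAddCommGroup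
  let _ := InnerProductSpace.ofCore W.core.toCore
  exact LinearMap.adjoint_inner_left f x y

/-- The tensor product of Hilbert spaces, with `(a ⊗ b, c ⊗ d) = (a, c) (b, d)`. -/
def tensor (V W : Hilb.{w}) : Hilb.{w} where
  carrier := V ⊗[ℂ] W
  core :=
    let _ := V.core.toNormedAddCommGroup
    let _ := InnerProductSpace.ofCore V.core.toCore
    let _ := W.core.toNormedAddCommGroup
    let _ := InnerProductSpace.ofCore W.core.toCore
    (InnerProductSpace.toCore : InnerProductSpace.Core ℂ (V ⊗[ℂ] W))

theorem tensor_inner (V W : Hilb.{w}) (a c : V) (b d : W) :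
    (tensor V W).inner (a ⊗ₜ b : V ⊗[ℂ] W) (c ⊗ₜ d : V ⊗[ℂ] W) = V.inner a c * W.inner b d := by
  let _ := V.core.toNormedAddCommGroup
  let _ := InnerProductSpace.ofCore V.core.toCore
  let _ := W.core.toNormedAddCommGroup
  let _ := InnerProductSpace.ofCore W.core.toCore
  exact TensorProduct.inner_tmul (𝕜 := ℂ) a c b d

section
variable (V : Hilb.{w})
theorem inner_add_left (x y z : V) : V.inner (x + y) z = V.inner x z + V.inner y z :=
  V.core.add_left x y z
theorem inner_smul_left (c : ℂ) (x y : V) : V.inner (c • x) y = conj c * V.inner x y :=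
  V.core.smul_left x y c
theorem inner_conj (x y : V) : conj (V.inner y x) = V.inner x y := V.core.conj_inner_symm x y
theorem inner_add_right (x y z : V) : V.inner x (y + z) = V.inner x y + V.inner x z := by
  rw [← inner_conj, inner_add_left, map_add, inner_conj, inner_conj]
theorem inner_smul_right (c : ℂ) (x y : V) : V.inner x (c • y) = c * V.inner x y := by
  rw [← inner_conj, inner_smul_left, map_mul, inner_conj, Complex.conj_conj]
theorem inner_zero_left (y : V) : V.inner 0 y = 0 := by
  have := inner_smul_left V 0 0 y
  simpa using this
theorem inner_zero_right (y : V) : V.inner y 0 = 0 := by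
  have := inner_smul_right V 0 y 0
  simpa using this
theorem inner_self_nonneg (x : V) : 0 ≤ (V.inner x x).re := V.core.re_inner_nonneg x
theorem inner_definite (x : V) (h : V.inner x x = 0) : x = 0 := V.core.definite x h
theorem inner_self_im (x : V) : (V.inner x x).im = 0 :=
  Complex.conj_eq_iff_im.1 (inner_conj V x x)
end

/-- The weighted direct sum of Hilbert spaces over a finite set, realised as the space of sections,
with inner product `⟨ψ, ψ'⟩ = ∑ i, k i (ψ i, ψ' i)`. -/
def weightedSum {ι : Type w} [Fintype ι] (k : ι → ℝ) (hk : ∀ i, 0 < k i)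
    (V : ι → Hilb.{w}) : Hilb.{w} where
  carrier := ∀ i, V i
  core :=
    { inner := fun x y => ∑ i, (k i : ℂ) * (V i).inner (x i) (y i)
      conj_inner_symm := fun x y => by
        simp only [map_sum, map_mul, Complex.conj_ofReal, inner_conj]
      re_inner_nonneg := fun x => by
        simp only [map_sum, RCLike.re_eq_complex_re, Complex.re_ofReal_mul]
        exact Finset.sum_nonneg fun i _ => mul_nonneg (hk i).le (inner_self_nonneg _ _)
      add_left := fun x y z => by
        simp only [Pi.add_apply, inner_add_left, mul_add, Finset.sum_add_distrib]
      smul_left := fun x y c => by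
        simp only [Pi.smul_apply, inner_smul_left, Finset.mul_sum]
        exact Finset.sum_congr rfl fun i _ => by ring
      definite := fun x h => by
        have h1 : ∑ i, k i * ((V i).inner (x i) (x i)).re = 0 := by
          have := congrArg Complex.re h
          simpa only [Complex.re_sum, Complex.re_ofReal_mul, Complex.zero_re] using this
        have h2 := (Finset.sum_eq_zero_iff_of_nonneg
          (fun i _ => mul_nonneg (hk i).le (inner_self_nonneg (V i) (x i)))).1 h1
        funext i
        have h3 := (mul_eq_zero.1 (h2 i (Finset.mem_univ i))).resolve_left (hk i).ne'
        exact inner_definite _ _ (Complex.ext h3 (inner_self_im _ _)) }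

theorem weightedSum_inner {ι : Type w} [Fintype ι] (k : ι → ℝ) (hk : ∀ i, 0 < k i)
    (V : ι → Hilb.{w}) (x y : ∀ i, V i) :
    (weightedSum k hk V).inner x y = ∑ i, (k i : ℂ) * (V i).inner (x i) (y i) := rfl

/-- A Hilbert space viewed in a larger universe. -/
def lift (V : Hilb.{v}) : Hilb.{max u v} where
  carrier := ULift.{u} V
  core :=
    { inner := fun x y => V.inner x.down y.down
      conj_inner_symm := fun x y => inner_conj V _ _
      re_inner_nonneg := fun x => inner_self_nonneg V _
      add_left := fun x y z => inner_add_left V _ _ _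
      smul_left := fun x y c => inner_smul_left V _ _ _
      definite := fun x h => ULift.ext _ _ (inner_definite V _ h) }

/-- The universe lift as a functor. -/
def liftFunctor : Hilb.{v} ⥤ Hilb.{max u v} where
  obj V := lift.{u} V
  map f := ⟨ULift.moduleEquiv.symm.toLinearMap ∘ₗ f.lin ∘ₗ ULift.moduleEquiv.toLinearMap⟩

theorem isUnitary_liftFunctor {V W : Hilb.{v}} {f : V ⟶ W} (hf : IsUnitary f) :
    IsUnitary (liftFunctor.{u}.map f) := by
  refine ⟨⟨fun x y h => ULift.ext _ _ (hf.1.1 (congrArg ULift.down h)), fun y => ?_⟩,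
    fun x y => hf.2 _ _⟩
  obtain ⟨x, hx⟩ := hf.1.2 y.down
  exact ⟨⟨x⟩, ULift.ext _ _ hx⟩

end Hilb

/-! ## 2-Hilbert spaces -/

/-- An H*-category: the hom-sets are finite-dimensional Hilbert spaces, composition is bilinear,
and there is an antilinear involution `f ↦ f*` on morphisms which is compatible with composition
and adjoint to composition for the inner products on hom-sets. -/
class HStarCategory (H : Type u) [Category.{v} H] [Preadditive H] [Linear ℂ H] where
  finDim : ∀ x y : H, FiniteDimensional ℂ (x ⟶ y)
  homCore : ∀ x y : H, InnerProductSpace.Core ℂ (x ⟶ y)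
  dag : ∀ {x y : H}, (x ⟶ y) → (y ⟶ x)
  dag_dag : ∀ {x y : H} (f : x ⟶ y), dag (dag f) = f
  dag_comp : ∀ {x y z : H} (f : x ⟶ y) (g : y ⟶ z), dag (f ≫ g) = dag g ≫ dag f
  dag_add : ∀ {x y : H} (f g : x ⟶ y), dag (f + g) = dag f + dag g
  dag_smul : ∀ {x y : H} (c : ℂ) (f : x ⟶ y), dag (c • f) = conj c • dag f
  inner_comp_right : ∀ {x y z : H} (f : x ⟶ y) (g : y ⟶ z) (h : x ⟶ z),
    (homCore x z).inner (f ≫ g) h = (homCore x y).inner f (h ≫ dag g)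
  inner_comp_left : ∀ {x y z : H} (f : x ⟶ y) (g : y ⟶ z) (h : x ⟶ z),
    (homCore x z).inner (f ≫ g) h = (homCore y z).inner g (dag f ≫ h)

section HStar
variable {H : Type u} [Category.{v} H] [Preadditive H] [Linear ℂ H] [HStarCategory H]

/-- The Hilbert space of morphisms between two objects of an H*-category. -/
def homHilb (x y : H) : Hilb.{v} :=
  { carrier := x ⟶ y
    finite := HStarCategory.finDim x y
    core := HStarCategory.homCore x y }

/-- The inner product on the morphisms of an H*-category. -/
def homInner {x y : H} (f g : x ⟶ y) : ℂ := (homHilb x y).inner f g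

/-- The involution `f ↦ f*` of an H*-category. -/
def dagger {x y : H} (f : x ⟶ y) : y ⟶ x := HStarCategory.dag f

theorem dagger_dagger {x y : H} (f : x ⟶ y) : dagger (dagger f) = f := HStarCategory.dag_dag f
theorem dagger_comp {x y z : H} (f : x ⟶ y) (g : y ⟶ z) :
    dagger (f ≫ g) = dagger g ≫ dagger f := HStarCategory.dag_comp f g
theorem dagger_id (x : H) : dagger (𝟙 x) = 𝟙 x := by
  have h := dagger_comp (dagger (𝟙 x)) (𝟙 x)
  rw [Category.comp_id, dagger_dagger, Category.comp_id] at h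
  exact h.symm
theorem homInner_comp_right {x y z : H} (f : x ⟶ y) (g : y ⟶ z) (h : x ⟶ z) :
    homInner (f ≫ g) h = homInner f (h ≫ dagger g) := HStarCategory.inner_comp_right f g h
theorem homInner_comp_left {x y z : H} (f : x ⟶ y) (g : y ⟶ z) (h : x ⟶ z) :
    homInner (f ≫ g) h = homInner g (dagger f ≫ h) := HStarCategory.inner_comp_left f g h
theorem homInner_conj {x y : H} (f g : x ⟶ y) : conj (homInner g f) = homInner f g :=
  Hilb.inner_conj (homHilb x y) f g

/-- A morphism is unitary when its `*` is a two-sided inverse. -/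
def IsUnitaryMor {x y : H} (f : x ⟶ y) : Prop := f ≫ dagger f = 𝟙 x ∧ dagger f ≫ f = 𝟙 y

theorem IsUnitaryMor.id (x : H) : IsUnitaryMor (𝟙 x) := by
  simp [IsUnitaryMor, dagger_id]
theorem IsUnitaryMor.comp {x y z : H} {f : x ⟶ y} {g : y ⟶ z} (hf : IsUnitaryMor f)
    (hg : IsUnitaryMor g) : IsUnitaryMor (f ≫ g) := by
  refine ⟨?_, ?_⟩
  · rw [dagger_comp, Category.assoc, ← Category.assoc g, hg.1, Category.id_comp, hf.1]
  · rw [dagger_comp, Category.assoc, ← Category.assoc _ f, hf.2, Category.id_comp, hg.2]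
theorem IsUnitaryMor.dag {x y : H} {f : x ⟶ y} (hf : IsUnitaryMor f) :
    IsUnitaryMor (dagger f) := by
  refine ⟨?_, ?_⟩
  · rw [dagger_dagger, hf.2]
  · rw [dagger_dagger, hf.1]
theorem IsUnitaryMor.homInner_comp_left {x y z : H} {f : x ⟶ y} (hf : IsUnitaryMor f)
    (g h : y ⟶ z) : homInner (f ≫ g) (f ≫ h) = homInner g h := by
  rw [_root_.homInner_comp_left, ← Category.assoc, hf.2, Category.id_comp]
theorem IsUnitaryMor.homInner_comp_right {x y z : H} {f : y ⟶ z} (hf : IsUnitaryMor f)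
    (g h : x ⟶ y) : homInner (g ≫ f) (h ≫ f) = homInner g h := by
  rw [_root_.homInner_comp_right, Category.assoc, hf.1, Category.comp_id]
theorem IsUnitaryMor.homInner_id {x y : H} {f : x ⟶ y} (hf : IsUnitaryMor f) :
    homInner (𝟙 x) (𝟙 x) = homInner (𝟙 y) (𝟙 y) := by
  rw [← hf.homInner_comp_right (𝟙 x) (𝟙 x), Category.id_comp, ← hf.homInner_comp_left (𝟙 y) (𝟙 y),
    Category.comp_id]

end HStar

/-- A (finite-dimensional) marked 2-Hilbert space: an H*-category with finite direct sums in which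
idempotents split (that is, which is Cauchy complete), together with a finite family of simple
objects which contains exactly one object of every isomorphism class of simple objects. An object
is simple when its endomorphisms are the scalars. -/
structure MarkedTwoHilb : Type (max (u + 1) (v + 1)) where
  carrier : Type u
  [category : Category.{v} carrier]
  [preadditive : Preadditive carrier]
  [linear : Linear ℂ carrier]
  [hstar : HStarCategory carrier]
  [biproducts : HasFiniteBiproducts carrier]
  [idempotents : IsIdempotentComplete carrier]
  ι : Type v
  [fintype : Fintype ι]
  e : ι → carrier
  simple_e : ∀ i, Module.finrank ℂ (e i ⟶ e i) = 1
  e_inj : ∀ i j, Nonempty (e i ≅ e j) → i = j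
  e_surj : ∀ x : carrier, Module.finrank ℂ (x ⟶ x) = 1 → ∃ i, Nonempty (e i ≅ x)

namespace MarkedTwoHilb

instance : CoeSort MarkedTwoHilb.{u, v} (Type u) := ⟨carrier⟩

section
variable (M : MarkedTwoHilb.{u, v})
instance : Category.{v} M := M.category
instance : Preadditive M := M.preadditive
instance : Linear ℂ M := M.linear
instance : HStarCategory M := M.hstar
instance : HasFiniteBiproducts M := M.biproducts
instance : IsIdempotentComplete M := M.idempotents
instance : Fintype M.ι := M.fintype

/-- The scale factor `k i = (id, id)` of the `i`-th simple object. -/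
def k (i : M.ι) : ℝ := (homInner (𝟙 (M.e i)) (𝟙 (M.e i))).re

theorem k_pos (i : M.ι) : 0 < M.k i := by
  refine lt_of_le_of_ne (Hilb.inner_self_nonneg (homHilb (M.e i) (M.e i)) (𝟙 _)) fun h => ?_
  have h0 : 𝟙 (M.e i) = 0 := Hilb.inner_definite (homHilb (M.e i) (M.e i)) (𝟙 _)
    (Complex.ext h.symm (Hilb.inner_self_im (homHilb (M.e i) (M.e i)) (𝟙 _)))
  have h1 := M.simple_e i
  have : Subsingleton (M.e i ⟶ M.e i) :=
    ⟨fun a b => by rw [← Category.comp_id a, ← Category.comp_id b, h0]; simp⟩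
  rw [Module.finrank_zero_of_subsingleton] at h1
  exact zero_ne_one h1

theorem k_coe (i : M.ι) : (M.k i : ℂ) = homInner (𝟙 (M.e i)) (𝟙 (M.e i)) :=
  Complex.ext rfl (Hilb.inner_self_im (homHilb (M.e i) (M.e i)) (𝟙 _)).symm

end

section semisimple
variable {M : MarkedTwoHilb.{u, v}}

theorem exists_idempotent (x : M) (h : 2 ≤ Module.finrank ℂ (x ⟶ x)) :
    ∃ p : x ⟶ x, p ≫ p = p ∧ p ≠ 0 ∧ p ≠ 𝟙 x := by
  have hfd : FiniteDimensional ℂ (x ⟶ x) := HStarCategory.finDim x x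
  let _ := (HStarCategory.homCore x x).toNormedAddCommGroup
  let _ : InnerProductSpace ℂ (x ⟶ x) := InnerProductSpace.ofCore (HStarCategory.homCore x x).toCore
  have hinner : ∀ f g : x ⟶ x, inner ℂ f g = homInner f g := fun f g => rfl
  have hnt : Nontrivial (x ⟶ x) := Module.nontrivial_of_finrank_pos (R := ℂ) (by omega)
  obtain ⟨a, ha⟩ : ∃ a : x ⟶ x, a ∉ Submodule.span ℂ {𝟙 x} := by
    by_contra! hc
    have h1 : Submodule.span ℂ {𝟙 x} = ⊤ := Submodule.eq_top_iff'.2 hc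
    have h2 := finrank_span_le_card (R := ℂ) ({𝟙 x} : Set (x ⟶ x))
    rw [h1, finrank_top] at h2
    simp at h2
    omega
  obtain ⟨l, hl⟩ := Module.End.exists_eigenvalue
    (show Module.End ℂ (x ⟶ x) from Linear.leftComp ℂ x a)
  obtain ⟨b, hb, hb0⟩ := hl.exists_hasEigenvector
  have hab : a ≫ b = l • b := Module.End.mem_eigenspace_iff.1 hb
  obtain ⟨c, hc⟩ : ∃ c : x ⟶ x, c = a - l • 𝟙 x := ⟨_, rfl⟩
  have hcb : c ≫ b = 0 := by
    rw [hc, Preadditive.sub_comp, Linear.smul_comp, Category.id_comp, hab, sub_self]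
  have hc0 : c ≠ 0 := by
    intro h0
    rw [h0, eq_comm, sub_eq_zero] at hc
    exact ha (hc ▸ Submodule.smul_mem _ _ (Submodule.subset_span rfl))
  obtain ⟨T, hT⟩ : ∃ T : (x ⟶ x) →ₗ[ℂ] (x ⟶ x), ∀ d, T d = c ≫ d :=
    ⟨Linear.leftComp ℂ x c, fun d => rfl⟩
  obtain ⟨I, hI⟩ : ∃ I : Submodule ℂ (x ⟶ x), I = LinearMap.range T := ⟨_, rfl⟩
  have hcI : c ∈ I := hI ▸ ⟨𝟙 x, by rw [hT, Category.comp_id]⟩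
  have hItop : I ≠ ⊤ := by
    intro h1
    have h2 : Function.Injective T :=
      LinearMap.injective_iff_surjective.2 (LinearMap.range_eq_top.1 (hI ▸ h1))
    exact hb0 (h2 (by rw [hT, hcb, map_zero]))
  have hIr : ∀ d ∈ I, ∀ f : x ⟶ x, d ≫ f ∈ I := by
    intro d hd f
    rw [hI] at hd ⊢
    obtain ⟨d', rfl⟩ := hd
    exact ⟨d' ≫ f, by rw [hT, hT, Category.assoc]⟩
  have hOr : ∀ d ∈ Iᗮ, ∀ f : x ⟶ x, d ≫ f ∈ Iᗮ := by
    intro d hd f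
    rw [Submodule.mem_orthogonal'] at hd ⊢
    intro u hu
    rw [hinner, homInner_comp_right, ← hinner]
    exact hd _ (hIr u hu _)
  obtain ⟨p, hp, q, hq, h1⟩ := I.exists_add_mem_mem_orthogonal (𝟙 x)
  have hqp : q ≫ p = 0 := by
    have h2 : q ≫ p = p - p ≫ p := by
      rw [eq_sub_iff_add_eq, add_comm, ← Preadditive.add_comp, ← h1, Category.id_comp]
    have h3 : q ≫ p ∈ I := h2 ▸ I.sub_mem hp (hIr p hp p)
    have h4 := (Submodule.mem_orthogonal' _ _).1 (hOr q hq p) _ h3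
    exact inner_self_eq_zero.1 h4
  refine ⟨p, ?_, ?_, ?_⟩
  · have h2 : (p + q) ≫ p = p := by rw [← h1, Category.id_comp]
    rwa [Preadditive.add_comp, hqp, add_zero] at h2
  · intro hp0
    rw [hp0, zero_add] at h1
    have h2 : c ∈ Iᗮ := by
      have := hOr q hq c
      rwa [← h1, Category.id_comp] at this
    exact hc0 (inner_self_eq_zero.1 ((Submodule.mem_orthogonal' _ _).1 h2 _ hcI))
  · intro hp1
    refine hItop (Submodule.eq_top_iff'.2 fun f => ?_)
    have := hIr p hp f
    rwa [hp1, Category.id_comp] at this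

/-- The span of the endomorphisms of `x` which factor through one of the simple objects. -/
def simpleSpan (x : M) : Submodule ℂ (x ⟶ x) :=
  Submodule.span ℂ {f | ∃ (i : M.ι) (r : x ⟶ M.e i) (s : M.e i ⟶ x), f = r ≫ s}

theorem simpleSpan_conj {x y : M} (r : x ⟶ y) (s : y ⟶ x) {f : y ⟶ y} (hf : f ∈ simpleSpan y) :
    r ≫ f ≫ s ∈ simpleSpan x := by
  refine Submodule.span_induction (p := fun f _ => r ≫ f ≫ s ∈ simpleSpan x) ?_ ?_ ?_ ?_ hf
  · rintro _ ⟨i, a, b, rfl⟩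
    exact Submodule.subset_span ⟨i, r ≫ a, b ≫ s, by simp⟩
  · simp
  · intro a b _ _ ha hb
    rw [Preadditive.add_comp, Preadditive.comp_add]
    exact Submodule.add_mem _ ha hb
  · intro c a _ ha
    rw [Linear.smul_comp, Linear.comp_smul]
    exact Submodule.smul_mem _ _ ha

theorem finrank_lt_of_split {x y : M} (p : x ⟶ x) (hp : p ≠ 𝟙 x) (s : y ⟶ x) (r : x ⟶ y)
    (hs : s ≫ r = 𝟙 y) (hr : r ≫ s = p) :
    Module.finrank ℂ (y ⟶ y) < Module.finrank ℂ (x ⟶ x) := by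
  have hfx : FiniteDimensional ℂ (x ⟶ x) := HStarCategory.finDim x x
  have hfy : FiniteDimensional ℂ (y ⟶ y) := HStarCategory.finDim y y
  obtain ⟨T, hT⟩ : ∃ T : (y ⟶ y) →ₗ[ℂ] (x ⟶ x), ∀ d, T d = r ≫ d ≫ s :=
    ⟨(Linear.leftComp ℂ x r).comp (Linear.rightComp ℂ y s), fun d => rfl⟩
  have hinj : Function.Injective T := by
    intro d d' h
    rw [hT, hT] at h
    have h2 : s ≫ (r ≫ d ≫ s) ≫ r = s ≫ (r ≫ d' ≫ s) ≫ r := by rw [h]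
    simpa only [Category.assoc, hs, Category.comp_id, reassoc_of% hs] using h2
  rw [← LinearMap.finrank_range_of_inj hinj]
  refine Submodule.finrank_lt fun htop => hp ?_
  obtain ⟨d, hd⟩ := LinearMap.range_eq_top.1 htop (𝟙 x)
  rw [hT] at hd
  have h2 : p ≫ r ≫ d ≫ s = 𝟙 x := by rw [← hd, ← hr, Category.assoc, reassoc_of% hs]
  rwa [hd, Category.comp_id] at h2

/-- The identity of every object of a marked 2-Hilbert space is a linear combination of morphisms
which factor through the simple objects. -/
theorem id_mem_simpleSpan (x : M) : 𝟙 x ∈ simpleSpan x := by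
  obtain ⟨n, hn⟩ : ∃ n, n = Module.finrank ℂ (x ⟶ x) := ⟨_, rfl⟩
  induction n using Nat.strong_induction_on generalizing x with
  | _ n ih =>
    have hfx : FiniteDimensional ℂ (x ⟶ x) := HStarCategory.finDim x x
    rcases lt_or_ge n 2 with h | h
    · interval_cases n
      · have := Module.finrank_zero_iff.1 hn.symm
        rw [Subsingleton.elim (𝟙 x) 0]
        exact Submodule.zero_mem _
      · obtain ⟨i, ⟨φ⟩⟩ := M.e_surj x hn.symm
        exact Submodule.subset_span ⟨i, φ.inv, φ.hom, by simp⟩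
    · obtain ⟨p, hp, hp0, hp1⟩ := exists_idempotent x (hn ▸ h)
      obtain ⟨y, s, r, hs, hr⟩ := IsIdempotentComplete.idempotents_split x p hp
      have hq : (𝟙 x - p) ≫ (𝟙 x - p) = 𝟙 x - p := by
        simp [Preadditive.sub_comp, Preadditive.comp_sub, hp]
      obtain ⟨z, s', r', hs', hr'⟩ := IsIdempotentComplete.idempotents_split x _ hq
      have h1 := simpleSpan_conj r s
        (ih _ (hn ▸ finrank_lt_of_split p hp1 s r hs hr) y rfl)
      have h2 := simpleSpan_conj r' s'
        (ih _ (hn ▸ finrank_lt_of_split _ (by simpa using hp0) s' r' hs' hr') z rfl)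
      rw [Category.id_comp, hr] at h1
      rw [Category.id_comp, hr'] at h2
      have h3 := Submodule.add_mem _ h1 h2
      rwa [add_sub_cancel] at h3

end semisimple
end MarkedTwoHilb

/-- A linear *-functor between H*-categories. -/
structure IsStarFunctor {H : Type*} [Category H] [Preadditive H] [Linear ℂ H] [HStarCategory H]
    {K : Type*} [Category K] [Preadditive K] [Linear ℂ K] [HStarCategory K] (F : H ⥤ K) :
    Prop where
  map_add : ∀ {x y : H} (f g : x ⟶ y), F.map (f + g) = F.map f + F.map g
  map_smul : ∀ {x y : H} (c : ℂ) (f : x ⟶ y), F.map (c • f) = c • F.map f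
  map_dagger : ∀ {x y : H} (f : x ⟶ y), F.map (dagger f) = dagger (F.map f)

namespace IsStarFunctor
variable {H : Type*} [Category H] [Preadditive H] [Linear ℂ H] [HStarCategory H]
  {K : Type*} [Category K] [Preadditive K] [Linear ℂ K] [HStarCategory K]
  {L : Type*} [Category L] [Preadditive L] [Linear ℂ L] [HStarCategory L]

theorem id : IsStarFunctor (𝟭 H) := ⟨fun _ _ => rfl, fun _ _ => rfl, fun _ => rfl⟩

theorem comp {F : H ⥤ K} {F' : K ⥤ L} (hF : IsStarFunctor F) (hF' : IsStarFunctor F') :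
    IsStarFunctor (F ⋙ F') :=
  ⟨fun f g => by simp [hF.map_add, hF'.map_add], fun c f => by simp [hF.map_smul, hF'.map_smul],
    fun f => by simp [hF.map_dagger, hF'.map_dagger]⟩

/-- The action of a linear *-functor on morphisms, as a linear map. -/
def mapLin {F : H ⥤ K} (hF : IsStarFunctor F) (x y : H) : (x ⟶ y) →ₗ[ℂ] (F.obj x ⟶ F.obj y) where
  toFun f := F.map f
  map_add' := hF.map_add
  map_smul' := hF.map_smul

theorem map_isUnitaryMor {F : H ⥤ K} (hF : IsStarFunctor F) {x y : H} {f : x ⟶ y}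
    (hf : IsUnitaryMor f) : IsUnitaryMor (F.map f) := by
  refine ⟨?_, ?_⟩
  · rw [← hF.map_dagger, ← F.map_comp, hf.1, F.map_id]
  · rw [← hF.map_dagger, ← F.map_comp, hf.2, F.map_id]

end IsStarFunctor

section Nat
variable {M : MarkedTwoHilb.{u, v}} {K : Type u} [Category.{v} K] [Preadditive K] [Linear ℂ K]
  [HStarCategory K]

theorem natTrans_ext_simple {F F' : M ⥤ K} (hF : IsStarFunctor F) {θ θ' : F ⟶ F'}
    (h : ∀ i, θ.app (M.e i) = θ'.app (M.e i)) : θ = θ' := by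
  refine NatTrans.ext (funext fun x => ?_)
  obtain ⟨T, hT⟩ : ∃ T : (x ⟶ x) →ₗ[ℂ] (F.obj x ⟶ F'.obj x),
      ∀ f, T f = F.map f ≫ θ.app x - F.map f ≫ θ'.app x :=
    ⟨(Linear.rightComp ℂ _ (θ.app x) - Linear.rightComp ℂ _ (θ'.app x)) ∘ₗ hF.mapLin x x,
      fun f => rfl⟩
  have h0 : T (𝟙 x) = 0 := by
    refine Submodule.span_induction (p := fun f _ => T f = 0) ?_ (map_zero T)
      (fun a b _ _ ha hb => by rw [map_add, ha, hb, add_zero])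
      (fun c a _ ha => by rw [map_smul, ha, smul_zero]) (MarkedTwoHilb.id_mem_simpleSpan x)
    rintro _ ⟨i, r, s, rfl⟩
    rw [hT, F.map_comp, Category.assoc, Category.assoc, θ.naturality, θ'.naturality, h i, sub_self]
  rw [hT, F.map_id, Category.id_comp, Category.id_comp, sub_eq_zero] at h0
  exact h0

/-- The Hilbert space of natural transformations between linear *-functors out of a marked
2-Hilbert space, with inner product `∑ i, k i (θ (e i), θ' (e i))`. -/
def natHilb (F F' : M ⥤ K) (hF : IsStarFunctor F) : Hilb.{max u v} where
  carrier := F ⟶ F'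
  finite := by
    have hfd : ∀ x y : K, FiniteDimensional ℂ (x ⟶ y) := HStarCategory.finDim
    obtain ⟨T, hT⟩ : ∃ T : (F ⟶ F') →ₗ[ℂ] (∀ i : M.ι, (F.obj (M.e i) ⟶ F'.obj (M.e i))),
        ∀ θ i, T θ i = θ.app (M.e i) :=
      ⟨{ toFun := fun θ i => θ.app (M.e i), map_add' := fun _ _ => rfl,
         map_smul' := fun _ _ => rfl }, fun _ _ => rfl⟩
    refine FiniteDimensional.of_injective T fun θ θ' h => natTrans_ext_simple hF fun i => ?_
    rw [← hT, ← hT, h]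
  core :=
    { inner := fun θ θ' => ∑ i, (M.k i : ℂ) * homInner (θ.app (M.e i)) (θ'.app (M.e i))
      conj_inner_symm := fun θ θ' => by
        simp only [map_sum, map_mul, Complex.conj_ofReal, homInner_conj]
      re_inner_nonneg := fun θ => by
        simp only [RCLike.re_eq_complex_re, Complex.re_sum, Complex.re_ofReal_mul]
        exact Finset.sum_nonneg fun i _ =>
          mul_nonneg (M.k_pos i).le (Hilb.inner_self_nonneg (homHilb _ _) _)
      add_left := fun θ θ' θ'' => by
        rw [← Finset.sum_add_distrib]
        refine Finset.sum_congr rfl fun i _ => ?_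
        rw [← mul_add]
        exact congrArg _ (Hilb.inner_add_left (homHilb _ _) _ _ _)
      smul_left := fun θ θ' c => by
        rw [Finset.mul_sum]
        refine Finset.sum_congr rfl fun i _ => ?_
        rw [mul_left_comm]
        exact congrArg _ (Hilb.inner_smul_left (homHilb _ _) _ _ _)
      definite := fun θ h => by
        refine natTrans_ext_simple hF fun i => ?_
        have h1 : ∑ i, M.k i * (homInner (θ.app (M.e i)) (θ.app (M.e i))).re = 0 := by
          have := congrArg Complex.re h
          simpa only [Complex.re_sum, Complex.re_ofReal_mul, Complex.zero_re] using this
        have h2 := (Finset.sum_eq_zero_iff_of_nonneg fun i _ =>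
          mul_nonneg (M.k_pos i).le (Hilb.inner_self_nonneg (homHilb _ _) (θ.app (M.e i)))).1 h1
        have h3 := (mul_eq_zero.1 (h2 i (Finset.mem_univ i))).resolve_left (M.k_pos i).ne'
        exact Hilb.inner_definite (homHilb (F.obj (M.e i)) (F'.obj (M.e i))) _
          (Complex.ext h3 (Hilb.inner_self_im (homHilb _ _) _)) }

end Nat

/-! ## Unitary 2-representations -/

/-- In an H*-category, isomorphic simple objects are unitarily isomorphic. -/
theorem exists_unitaryMor {H : Type u} [Category.{v} H] [Preadditive H] [Linear ℂ H]
    [HStarCategory H] {x y : H} (hx : Module.finrank ℂ (x ⟶ x) = 1)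
    (hy : Module.finrank ℂ (y ⟶ y) = 1) (φ : x ≅ y) : ∃ f : x ⟶ y, IsUnitaryMor f := by
  have hspan : ∀ {z : H}, Module.finrank ℂ (z ⟶ z) = 1 → 𝟙 z ≠ 0 ∧
      ∀ f : z ⟶ z, ∃ c : ℂ, f = c • 𝟙 z := by
    intro z hz
    have h0 : 𝟙 z ≠ 0 := by
      intro h0
      have : Subsingleton (z ⟶ z) :=
        ⟨fun a b => by rw [← Category.comp_id a, ← Category.comp_id b, h0]; simp⟩
      rw [Module.finrank_zero_of_subsingleton] at hz
      exact zero_ne_one hz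
    refine ⟨h0, fun f => ?_⟩
    obtain ⟨c, hc⟩ := (finrank_eq_one_iff_of_nonzero' (𝟙 z) h0).1 hz f
    exact ⟨c, hc.symm⟩
  have hreal : ∀ {z w : H} (f : z ⟶ w), homInner f f = (((homInner f f).re : ℝ) : ℂ) :=
    fun {z w} f => Complex.ext rfl (Hilb.inner_self_im (homHilb z w) f)
  have hpos : ∀ {z w : H} (f : z ⟶ w), f ≠ 0 → 0 < (homInner f f).re := by
    intro z w f hf
    refine lt_of_le_of_ne (Hilb.inner_self_nonneg (homHilb z w) f) fun h => hf ?_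
    exact Hilb.inner_definite (homHilb z w) f
      (Complex.ext h.symm (Hilb.inner_self_im (homHilb z w) f))
  obtain ⟨hx0, hxs⟩ := hspan hx
  obtain ⟨hy0, hys⟩ := hspan hy
  obtain ⟨c, hc⟩ := hxs (φ.hom ≫ dagger φ.hom)
  have hφ : φ.hom ≠ 0 := by
    intro h
    apply hx0
    rw [← φ.hom_inv_id, h, zero_comp]
  have h1 : homInner φ.hom φ.hom = c * homInner (𝟙 x) (𝟙 x) := by
    have h2 := homInner_comp_right (𝟙 x) φ.hom φ.hom
    rw [Category.id_comp, hc] at h2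
    rw [h2]
    exact Hilb.inner_smul_right (homHilb x x) c _ _
  obtain ⟨r, hr, hcr⟩ : ∃ r : ℝ, 0 < r ∧ c = r := by
    have h3 := hpos _ hφ
    have h4 := hpos _ hx0
    refine ⟨(homInner φ.hom φ.hom).re / (homInner (𝟙 x) (𝟙 x)).re, div_pos h3 h4, ?_⟩
    rw [Complex.ofReal_div, ← hreal, ← hreal, h1, mul_div_assoc, div_self, mul_one]
    rw [hreal]
    exact_mod_cast h4.ne'
  obtain ⟨s, hs⟩ : ∃ s : ℝ, s * s * r = 1 := by
    refine ⟨(Real.sqrt r)⁻¹, ?_⟩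
    rw [← mul_inv, Real.mul_self_sqrt hr.le, inv_mul_cancel₀ hr.ne']
  have hdag : dagger ((s : ℂ) • φ.hom) = (s : ℂ) • dagger φ.hom := by
    have := HStarCategory.dag_smul (s : ℂ) φ.hom
    rwa [Complex.conj_ofReal] at this
  have hl : ((s : ℂ) • φ.hom) ≫ dagger ((s : ℂ) • φ.hom) = 𝟙 x := by
    rw [hdag, Linear.smul_comp, Linear.comp_smul, hc, smul_smul, smul_smul, hcr]
    have : (s : ℂ) * s * r = 1 := by exact_mod_cast hs
    rw [this, one_smul]
  obtain ⟨d, hd⟩ := hys (dagger ((s : ℂ) • φ.hom) ≫ ((s : ℂ) • φ.hom))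
  refine ⟨(s : ℂ) • φ.hom, hl, ?_⟩
  have h5 : ((s : ℂ) • φ.hom) ≫ (dagger ((s : ℂ) • φ.hom) ≫ ((s : ℂ) • φ.hom)) =
      (s : ℂ) • φ.hom := by rw [← Category.assoc, hl, Category.id_comp]
  rw [hd, Linear.comp_smul, Category.comp_id] at h5
  have h6 : (s : ℂ) • φ.hom ≠ 0 := by
    intro h6
    apply hx0
    rw [← hl, h6, zero_comp]
  have h7 : d = 1 := by
    have h8 : (d - 1) • ((s : ℂ) • φ.hom) = 0 := by rw [sub_smul, h5, one_smul, sub_self]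
    exact sub_eq_zero.1 ((smul_eq_zero.1 h8).resolve_right h6)
  rw [hd, h7, one_smul]

/-- A marked unitary 2-representation of `G`: unitary linear *-endofunctors `act g` of a marked
2-Hilbert space, with unitary natural isomorphisms `id ⇒ act 1` and `act g₂ ∘ act g₁ ⇒ act (g₂ g₁)`
satisfying the unit and associativity laws. The second family is indexed by triples with
`g₂ * g₁ = g`, so that the laws can be stated without transport along equalities in `G`. -/
structure TwoRep (G : Type v) [Group G] : Type (max (u + 1) (v + 1)) where
  H : MarkedTwoHilb.{u, v}
  act : G → (H ⥤ H)
  act_star : ∀ g, IsStarFunctor (act g)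
  act_bijective : ∀ g (x y : H), Function.Bijective fun f : x ⟶ y => (act g).map f
  act_inner : ∀ g {x y : H} (f f' : x ⟶ y), homInner ((act g).map f) ((act g).map f') = homInner f f'
  unit : 𝟭 H ⟶ act 1
  unit_unitary : ∀ x, IsUnitaryMor (unit.app x)
  mul : ∀ g₂ g₁ g : G, g₂ * g₁ = g → (act g₁ ⋙ act g₂ ⟶ act g)
  mul_unitary : ∀ g₂ g₁ g h x, IsUnitaryMor ((mul g₂ g₁ g h).app x)
  unit_mul : ∀ g (x : H),
    unit.app ((act g).obj x) ≫ (mul 1 g g (one_mul g)).app x = 𝟙 ((act g).obj x)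
  mul_unit : ∀ g (x : H),
    (act g).map (unit.app x) ≫ (mul g 1 g (mul_one g)).app x = 𝟙 ((act g).obj x)
  assoc : ∀ (g₃ g₂ g₁ g₃₂ g₂₁ g : G) (h₃₂ : g₃ * g₂ = g₃₂) (h₂₁ : g₂ * g₁ = g₂₁)
    (h : g₃ * g₂₁ = g) (h' : g₃₂ * g₁ = g) (x : H),
    (act g₃).map ((mul g₂ g₁ g₂₁ h₂₁).app x) ≫ (mul g₃ g₂₁ g h).app x =
      (mul g₃ g₂ g₃₂ h₃₂).app ((act g₁).obj x) ≫ (mul g₃₂ g₁ g h').app x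

namespace TwoRep
variable {G : Type v} [Group G]

section basic
variable (α : TwoRep.{u, v} G)

/-- The component `x ⟶ act 1 x` of the unit isomorphism. -/
def un (x : α.H) : x ⟶ (α.act 1).obj x := α.unit.app x

/-- The component `act g₂ (act g₁ x) ⟶ act g x` of the compositor, where `g₂ * g₁ = g`. -/
def mu {g₂ g₁ g : G} (h : g₂ * g₁ = g) (x : α.H) :
    (α.act g₂).obj ((α.act g₁).obj x) ⟶ (α.act g).obj x := (α.mul g₂ g₁ g h).app x

theorem un_unitary (x : α.H) : IsUnitaryMor (α.un x) := α.unit_unitary x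
theorem mu_unitary {g₂ g₁ g : G} (h : g₂ * g₁ = g) (x : α.H) : IsUnitaryMor (α.mu h x) :=
  α.mul_unitary _ _ _ _ _
theorem un_naturality {x y : α.H} (f : x ⟶ y) : f ≫ α.un y = α.un x ≫ (α.act 1).map f :=
  α.unit.naturality f
theorem mu_naturality {g₂ g₁ g : G} (h : g₂ * g₁ = g) {x y : α.H} (f : x ⟶ y) :
    (α.act g₂).map ((α.act g₁).map f) ≫ α.mu h y = α.mu h x ≫ (α.act g).map f :=
  (α.mul g₂ g₁ g h).naturality f
theorem un_mu (g : G) (x : α.H) : α.un ((α.act g).obj x) ≫ α.mu (one_mul g) x = 𝟙 _ :=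
  α.unit_mul g x
theorem map_un_mu (g : G) (x : α.H) : (α.act g).map (α.un x) ≫ α.mu (mul_one g) x = 𝟙 _ :=
  α.mul_unit g x
theorem mu_assoc {g₃ g₂ g₁ g₃₂ g₂₁ g : G} (h₃₂ : g₃ * g₂ = g₃₂) (h₂₁ : g₂ * g₁ = g₂₁)
    (h : g₃ * g₂₁ = g) (h' : g₃₂ * g₁ = g) (x : α.H) :
    (α.act g₃).map (α.mu h₂₁ x) ≫ α.mu h x = α.mu h₃₂ ((α.act g₁).obj x) ≫ α.mu h' x :=
  α.assoc _ _ _ _ _ _ _ _ _ _ _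

end basic
end TwoRep

theorem IsUnitaryMor.mono {H : Type*} [Category H] [Preadditive H] [Linear ℂ H]
    [HStarCategory H] {x y : H} {f : x ⟶ y} (hf : IsUnitaryMor f) : Mono f :=
  have : IsSplitMono f := ⟨⟨⟨dagger f, hf.1⟩⟩⟩
  inferInstance
theorem IsUnitaryMor.epi {H : Type*} [Category H] [Preadditive H] [Linear ℂ H]
    [HStarCategory H] {x y : H} {f : x ⟶ y} (hf : IsUnitaryMor f) : Epi f :=
  have : IsSplitEpi f := ⟨⟨⟨dagger f, hf.2⟩⟩⟩
  inferInstance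
/-- A unitary morphism as an isomorphism. -/
def IsUnitaryMor.iso {H : Type*} [Category H] [Preadditive H] [Linear ℂ H]
    [HStarCategory H] {x y : H} {f : x ⟶ y} (hf : IsUnitaryMor f) : x ≅ y :=
  ⟨f, dagger f, hf.1, hf.2⟩

namespace TwoRep
variable {G : Type v} [Group G]

/-- A morphism of unitary 2-representations: a linear *-functor `fn` together with unitary natural
isomorphisms `β_g ∘ fn ⇒ fn ∘ α_g`, compatible with the units and the compositors. -/
structure Mor (α β : TwoRep.{u, v} G) : Type (max u v) where
  fn : α.H ⥤ β.H
  star : IsStarFunctor fn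
  coh : ∀ g : G, fn ⋙ β.act g ⟶ α.act g ⋙ fn
  coh_unitary : ∀ g x, IsUnitaryMor ((coh g).app x)
  coh_unit : ∀ x, β.un (fn.obj x) ≫ (coh 1).app x = fn.map (α.un x)
  coh_mul : ∀ (g₂ g₁ g : G) (h : g₂ * g₁ = g) (x : α.H),
    β.mu h (fn.obj x) ≫ (coh g).app x =
      (β.act g₂).map ((coh g₁).app x) ≫ (coh g₂).app ((α.act g₁).obj x) ≫ fn.map (α.mu h x)

namespace Mor

/-- The component `β_g (fn x) ⟶ fn (α_g x)`. -/
def co {α β : TwoRep.{u, v} G} (σ : Mor α β) (g : G) (x : α.H) :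
    (β.act g).obj (σ.fn.obj x) ⟶ σ.fn.obj ((α.act g).obj x) := (σ.coh g).app x

section
variable {α β : TwoRep.{u, v} G} (σ : Mor α β)
theorem co_unitary (g : G) (x : α.H) : IsUnitaryMor (σ.co g x) := σ.coh_unitary g x
theorem co_naturality (g : G) {x y : α.H} (f : x ⟶ y) :
    (β.act g).map (σ.fn.map f) ≫ σ.co g y = σ.co g x ≫ σ.fn.map ((α.act g).map f) :=
  (σ.coh g).naturality f
theorem un_co (x : α.H) : β.un (σ.fn.obj x) ≫ σ.co 1 x = σ.fn.map (α.un x) := σ.coh_unit x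
theorem mu_co {g₂ g₁ g : G} (h : g₂ * g₁ = g) (x : α.H) :
    β.mu h (σ.fn.obj x) ≫ σ.co g x =
      (β.act g₂).map (σ.co g₁ x) ≫ σ.co g₂ ((α.act g₁).obj x) ≫ σ.fn.map (α.mu h x) :=
  σ.coh_mul _ _ _ h x
end

/-- The identity morphism. -/
def id (α : TwoRep.{u, v} G) : Mor α α where
  fn := 𝟭 α.H
  star := .id
  coh g := { app := fun x => 𝟙 _ }
  coh_unitary g x := IsUnitaryMor.id _
  coh_unit x := by simp
  coh_mul g₂ g₁ g h x := by simp

/-- The composite of morphisms of 2-representations. -/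
def comp {α β δ : TwoRep.{u, v} G} (σ : Mor α β) (ρ : Mor β δ) : Mor α δ where
  fn := σ.fn ⋙ ρ.fn
  star := σ.star.comp ρ.star
  coh g :=
    { app := fun x => ρ.co g (σ.fn.obj x) ≫ ρ.fn.map (σ.co g x)
      naturality := fun x y f => by
        dsimp
        rw [← Category.assoc, ρ.co_naturality, Category.assoc, Category.assoc, ← ρ.fn.map_comp,
          ← ρ.fn.map_comp, σ.co_naturality] }
  coh_unitary g x := (ρ.co_unitary _ _).comp (ρ.star.map_isUnitaryMor (σ.co_unitary _ _))
  coh_unit x := by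
    dsimp
    rw [← Category.assoc, ρ.un_co, ← ρ.fn.map_comp, σ.un_co]
  coh_mul g₂ g₁ g h x := by
    dsimp
    rw [← Category.assoc, ρ.mu_co, Category.assoc, Category.assoc, ← ρ.fn.map_comp, σ.mu_co,
      (δ.act g₂).map_comp, ρ.fn.map_comp, ρ.fn.map_comp, Category.assoc, Category.assoc]
    rw [← Category.assoc ((δ.act g₂).map (ρ.fn.map _)), ρ.co_naturality]
    simp only [Category.assoc]

/-- Two morphisms of 2-representations are isomorphic when there is an invertible modification
between them. -/
def Iso {α β : TwoRep.{u, v} G} (σ ρ : Mor α β) : Prop :=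
  ∃ θ : σ.fn ≅ ρ.fn, ∀ g x,
    σ.co g x ≫ θ.hom.app ((α.act g).obj x) = (β.act g).map (θ.hom.app x) ≫ ρ.co g x

theorem Iso.refl {α β : TwoRep.{u, v} G} (σ : Mor α β) : Iso σ σ :=
  ⟨CategoryTheory.Iso.refl _, fun g x => by simp⟩
theorem Iso.symm {α β : TwoRep.{u, v} G} {σ ρ : Mor α β} : Iso σ ρ → Iso ρ σ := by
  rintro ⟨θ, h⟩
  refine ⟨θ.symm, fun g x => ?_⟩
  have h1 := h g x
  rw [← cancel_mono (θ.inv.app _), Category.assoc, ← NatTrans.comp_app, θ.hom_inv_id,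
    NatTrans.id_app, Category.comp_id] at h1
  rw [CategoryTheory.Iso.symm_hom, h1, Category.assoc, ← Category.assoc, ← (β.act g).map_comp,
    ← NatTrans.comp_app, θ.inv_hom_id]
  simp
theorem Iso.trans {α β : TwoRep.{u, v} G} {σ ρ τ : Mor α β} : Iso σ ρ → Iso ρ τ → Iso σ τ := by
  rintro ⟨θ, h⟩ ⟨η, h'⟩
  refine ⟨θ.trans η, fun g x => ?_⟩
  simp only [CategoryTheory.Iso.trans_hom, NatTrans.comp_app, (β.act g).map_comp, Category.assoc]
  rw [← Category.assoc, h, Category.assoc, h']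

theorem Iso.comp_congr {α β δ : TwoRep.{u, v} G} {σ σ' : Mor α β} {ρ ρ' : Mor β δ} :
    Iso σ σ' → Iso ρ ρ' → Iso (σ.comp ρ) (σ'.comp ρ') := by
  rintro ⟨θ, h⟩ ⟨η, h'⟩
  refine ⟨NatIso.hcomp θ η, fun g x => ?_⟩
  have e1 : ∀ y, (NatIso.hcomp θ η).hom.app y =
      ρ.fn.map (θ.hom.app y) ≫ η.hom.app (σ'.fn.obj y) := by intro y; simp
  have e2 : ∀ (σ : Mor α β) (ρ : Mor β δ), (σ.comp ρ).co g x =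
      ρ.co g (σ.fn.obj x) ≫ ρ.fn.map (σ.co g x) := fun _ _ => rfl
  rw [e2, e2, e1, e1]
  change (ρ.co g (σ.fn.obj x) ≫ ρ.fn.map (σ.co g x)) ≫
    ρ.fn.map (θ.hom.app ((α.act g).obj x)) ≫ η.hom.app (σ'.fn.obj ((α.act g).obj x)) =
    (δ.act g).map (ρ.fn.map (θ.hom.app x) ≫ η.hom.app (σ'.fn.obj x)) ≫
      ρ'.co g (σ'.fn.obj x) ≫ ρ'.fn.map (σ'.co g x)
  rw [Category.assoc, ← Category.assoc (ρ.fn.map _), ← ρ.fn.map_comp, h, ρ.fn.map_comp,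
    Category.assoc, ← Category.assoc (ρ.co _ _), ← ρ.co_naturality, η.hom.naturality,
    (δ.act g).map_comp, Category.assoc, Category.assoc, ← Category.assoc (ρ.co _ _), h',
    Category.assoc]

end Mor

instance morSetoid (α β : TwoRep.{u, v} G) : Setoid (Mor α β) :=
  ⟨Mor.Iso, Mor.Iso.refl, Mor.Iso.symm, Mor.Iso.trans⟩

/-- The category of marked unitary 2-representations and isomorphism classes of morphisms. -/
instance : Category (TwoRep.{u, v} G) where
  Hom α β := Quotient (morSetoid α β)
  id α := ⟦Mor.id α⟧
  comp := Quotient.map₂ Mor.comp fun _ _ h _ _ h' => Mor.Iso.comp_congr h h'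
  id_comp := by
    rintro α β ⟨σ⟩
    refine Quotient.sound ⟨σ.fn.leftUnitor, fun g x => ?_⟩
    change (σ.co g x ≫ σ.fn.map (𝟙 _)) ≫ 𝟙 _ = (β.act g).map (𝟙 _) ≫ σ.co g x
    simp
  comp_id := by
    rintro α β ⟨σ⟩
    refine Quotient.sound ⟨σ.fn.rightUnitor, fun g x => ?_⟩
    change (𝟙 _ ≫ σ.co g x) ≫ 𝟙 _ = (β.act g).map (𝟙 _) ≫ σ.co g x
    simp
  assoc := by
    rintro α β δ ε ⟨σ⟩ ⟨ρ⟩ ⟨τ⟩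
    refine Quotient.sound ⟨Functor.associator _ _ _, fun g x => ?_⟩
    change (τ.co g _ ≫ τ.fn.map (ρ.co g _ ≫ ρ.fn.map (σ.co g x))) ≫ 𝟙 _ =
      (ε.act g).map (𝟙 _) ≫ (τ.co g _ ≫ τ.fn.map (ρ.co g _)) ≫ τ.fn.map (ρ.fn.map (σ.co g x))
    simp

/-- The isomorphism class of a morphism of 2-representations. -/
def Mor.toHom {α β : TwoRep.{u, v} G} (σ : Mor α β) : α ⟶ β := (⟦σ⟧ : Quotient (morSetoid α β))

end TwoRep

/-! ## Equivariant Hilbert bundles over the group and the 2-character -/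

/-- The loop groupoid of the one-object groupoid of `G`: objects are the elements of `G`, morphisms
`g ⟶ g'` are the `h` with `h g h⁻¹ = g'`. -/
structure LoopBG (G : Type v) : Type v where
  pt : G

namespace LoopBG
variable {G : Type v} [Group G]

/-- Morphisms of the loop groupoid. -/
@[ext] structure Hom (a b : LoopBG G) : Type v where
  elt : G
  conj_eq : elt * a.pt * elt⁻¹ = b.pt

instance : Category (LoopBG G) where
  Hom := Hom
  id a := ⟨1, by simp⟩
  comp {a b c} h k := ⟨k.elt * h.elt, by rw [← k.conj_eq, ← h.conj_eq]; group⟩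
  id_comp h := Hom.ext (mul_one _)
  comp_id h := Hom.ext (one_mul _)
  assoc h k l := Hom.ext (mul_assoc _ _ _).symm

@[ext] theorem hom_ext {a b : LoopBG G} {h k : a ⟶ b} (e : h.elt = k.elt) : h = k := by
  exact Hom.ext e
@[simp] theorem id_elt (a : LoopBG G) : Hom.elt (𝟙 a) = 1 := rfl
@[simp] theorem comp_elt {a b c : LoopBG G} (h : a ⟶ b) (k : b ⟶ c) :
    (h ≫ k).elt = k.elt * h.elt := rfl

/-- The inverse of a morphism. -/
def inv {a b : LoopBG G} (h : a ⟶ b) : b ⟶ a :=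
  ⟨h.elt⁻¹, by rw [← h.conj_eq]; group⟩

theorem isUnitary_of_inner (F : LoopBG G ⥤ Hilb.{w})
    (hF : ∀ {a b : LoopBG G} (h : a ⟶ b) (x y : F.obj a),
      (F.obj b).inner ((F.map h).lin x) ((F.map h).lin y) = (F.obj a).inner x y)
    {a b : LoopBG G} (h : a ⟶ b) : Hilb.IsUnitary (F.map h) := by
  refine ⟨Function.bijective_iff_has_inverse.2 ⟨(F.map (inv h)).lin, fun x => ?_, fun x => ?_⟩,
    hF h⟩
  · have h1 : h ≫ inv h = 𝟙 a := hom_ext (inv_mul_cancel _)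
    have h2 := F.map_comp h (inv h)
    rw [h1, F.map_id] at h2
    exact (LinearMap.congr_fun (congrArg Hilb.Hom.lin h2) x).symm
  · have h1 : inv h ≫ h = 𝟙 b := hom_ext (mul_inv_cancel _)
    have h2 := F.map_comp (inv h) h
    rw [h1, F.map_id] at h2
    exact (LinearMap.congr_fun (congrArg Hilb.Hom.lin h2) x).symm

end LoopBG

/-- A unitary equivariant Hilbert bundle over `G` (acting on itself by conjugation): a functor from
the loop groupoid to Hilbert spaces which acts by unitary maps. -/
structure HilbG (G : Type v) [Group G] : Type (max v (w + 1)) where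
  functor : LoopBG G ⥤ Hilb.{w}
  unitary : ∀ {a b : LoopBG G} (h : a ⟶ b), Hilb.IsUnitary (functor.map h)

namespace HilbG
variable {G : Type v} [Group G]

/-- Morphisms of equivariant Hilbert bundles are natural transformations. -/
@[ext] structure Hom (E F : HilbG.{v, w} G) : Type (max v w) where
  nat : E.functor ⟶ F.functor

instance : Category (HilbG.{v, w} G) where
  Hom := Hom
  id E := ⟨𝟙 _⟩
  comp f g := ⟨f.nat ≫ g.nat⟩

/-- The fibre of an equivariant Hilbert bundle over `g`. -/
def fibre (E : HilbG.{v, w} G) (g : G) : Hilb.{w} := E.functor.obj ⟨g⟩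

/-- The component of a morphism of equivariant Hilbert bundles over `g`. -/
def at' {E F : HilbG.{v, w} G} (f : E ⟶ F) (g : G) : E.fibre g ⟶ F.fibre g := f.nat.app ⟨g⟩

/-- Equivariant Hilbert bundles viewed in a larger universe. -/
def lift : HilbG.{v, v} G ⥤ HilbG.{v, max u v} G where
  obj E := ⟨E.functor ⋙ Hilb.liftFunctor.{u}, fun h => Hilb.isUnitary_liftFunctor (E.unitary h)⟩
  map f := ⟨Functor.whiskerRight f.nat _⟩
  map_id E := Hom.ext (Functor.whiskerRight_id' _)
  map_comp f g := Hom.ext (Functor.whiskerRight_comp _ _ _)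

end HilbG

namespace TwoRep
variable {G : Type v} [Group G] (α : TwoRep.{u, v} G)

theorem finrank_act (g : G) (x : α.H) :
    Module.finrank ℂ ((α.act g).obj x ⟶ (α.act g).obj x) = Module.finrank ℂ (x ⟶ x) :=
  (LinearEquiv.ofBijective ((α.act_star g).mapLin x x) (α.act_bijective g x x)).finrank_eq.symm

theorem exists_index (g : G) (i : α.H.ι) :
    ∃ j, Nonempty (α.H.e j ≅ (α.act g).obj (α.H.e i)) :=
  α.H.e_surj _ (by rw [finrank_act, α.H.simple_e])

/-- The action of `G` on the isomorphism classes of simple objects: `e (g • i) ≅ act g (e i)`. -/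
def perm (g : G) (i : α.H.ι) : α.H.ι := (α.exists_index g i).choose

theorem perm_spec (g : G) (i : α.H.ι) :
    Nonempty (α.H.e (α.perm g i) ≅ (α.act g).obj (α.H.e i)) := (α.exists_index g i).choose_spec

theorem perm_eq {g : G} {i j : α.H.ι} (φ : α.H.e j ≅ (α.act g).obj (α.H.e i)) :
    α.perm g i = j := by
  obtain ⟨ψ⟩ := α.perm_spec g i
  exact α.H.e_inj _ _ ⟨ψ.trans φ.symm⟩

theorem exists_unitary_perm (g : G) (i : α.H.ι) :
    ∃ f : α.H.e (α.perm g i) ⟶ (α.act g).obj (α.H.e i), IsUnitaryMor f := by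
  obtain ⟨φ⟩ := α.perm_spec g i
  exact exists_unitaryMor (α.H.simple_e _) (by rw [finrank_act, α.H.simple_e]) φ

/-- The action of `G` on the index set of the simple objects. -/
@[reducible] def permAction : MulAction G α.H.ι where
  smul := α.perm
  one_smul i := α.perm_eq (α.un_unitary _).iso
  mul_smul g h i := by
    obtain ⟨φ⟩ := α.perm_spec h i
    obtain ⟨ψ⟩ := α.perm_spec g (α.perm h i)
    exact α.perm_eq (ψ.trans (((α.act g).mapIso φ).trans (α.mu_unitary rfl _).iso))

theorem k_perm (g : G) (i : α.H.ι) : α.H.k (α.perm g i) = α.H.k i := by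
  obtain ⟨f, hf⟩ := α.exists_unitary_perm g i
  have h : (α.H.k (α.perm g i) : ℂ) = α.H.k i := by
    rw [α.H.k_coe, α.H.k_coe, hf.homInner_id, ← (α.act g).map_id, α.act_inner]
  exact_mod_cast h

section char
variable {g g' : G} (h : G) (hg : h * g * h⁻¹ = g')

/-- The component at `x` of the action of `h` on a transformation `θ : id ⟶ act g`: the composite
`x ⟶ act 1 x ⟶ h h⁻¹ x ⟶ h g h⁻¹ x ⟶ (h g) h⁻¹ x ⟶ g' x`. -/
def conjApp (θ : 𝟭 α.H ⟶ α.act g) (x : α.H) : x ⟶ (α.act g').obj x :=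
  α.un x ≫ dagger (α.mu (mul_inv_cancel h) x) ≫
    (α.act h).map (θ.app ((α.act h⁻¹).obj x)) ≫
    α.mu (rfl : h * g = h * g) ((α.act h⁻¹).obj x) ≫ α.mu hg x

theorem dagger_mu_naturality {g₂ g₁ g : G} (h : g₂ * g₁ = g) {x y : α.H} (f : x ⟶ y) :
    (α.act g).map f ≫ dagger (α.mu h y) =
      dagger (α.mu h x) ≫ (α.act g₂).map ((α.act g₁).map f) := by
  have := (α.mu_unitary h x).mono
  have := (α.mu_unitary h y).mono
  rw [← cancel_mono (α.mu h y), Category.assoc, (α.mu_unitary h y).2, Category.assoc,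
    mu_naturality, ← Category.assoc, (α.mu_unitary h x).2, Category.comp_id, Category.id_comp]

theorem conjApp_naturality (θ : 𝟭 α.H ⟶ α.act g) {x y : α.H} (f : x ⟶ y) :
    f ≫ α.conjApp h hg θ y = α.conjApp h hg θ x ≫ (α.act g').map f := by
  have hθ := θ.naturality ((α.act h⁻¹).map f)
  simp only [Functor.id_map] at hθ
  simp only [conjApp, Category.assoc]
  rw [← α.mu_naturality hg f, ← Category.assoc (α.mu _ _) ((α.act _).map _), ← mu_naturality]
  simp only [Category.assoc]
  rw [← Category.assoc ((α.act h).map _) ((α.act h).map _), ← (α.act h).map_comp, ← hθ,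
    (α.act h).map_comp, ← Category.assoc f, un_naturality]
  simp only [Category.assoc]
  rw [← Category.assoc ((α.act 1).map f), dagger_mu_naturality]
  simp only [Category.assoc]

/-- The action of `h` on a transformation `θ : id ⟶ act g`, as a transformation. -/
def conjNat (θ : 𝟭 α.H ⟶ α.act g) : 𝟭 α.H ⟶ α.act g' where
  app x := α.conjApp h hg θ x
  naturality _ _ f := α.conjApp_naturality h hg θ f

theorem conjApp_mu (θ : 𝟭 α.H ⟶ α.act g) {k : G} (hk : g' * h = k) (hk' : h * g = k) (x : α.H) :
    α.conjApp h hg θ ((α.act h).obj x) ≫ α.mu hk x =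
      (α.act h).map (θ.app x) ≫ α.mu hk' x := by
  subst hk'
  obtain ⟨ζ, hζ⟩ : ∃ ζ : x ⟶ (α.act h⁻¹).obj ((α.act h).obj x),
    ζ = α.un x ≫ dagger (α.mu (inv_mul_cancel h) x) := ⟨_, rfl⟩
  have hζmu : ζ ≫ α.mu (inv_mul_cancel h) x = α.un x := by
    rw [hζ, Category.assoc, (α.mu_unitary _ _).2, Category.comp_id]
  have tri : α.un ((α.act h).obj x) ≫ dagger (α.mu (mul_inv_cancel h) ((α.act h).obj x)) =
      (α.act h).map ζ := by
    have := (α.mu_unitary (mul_inv_cancel h) ((α.act h).obj x)).mono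
    have := (α.mu_unitary (one_mul h) x).mono
    rw [← cancel_mono (α.mu (mul_inv_cancel h) ((α.act h).obj x)), ← cancel_mono (α.mu (one_mul h) x)]
    simp only [Category.assoc]
    rw [← α.mu_assoc (mul_inv_cancel h) (inv_mul_cancel h) (mul_one h) (one_mul h) x,
      ← Category.assoc ((α.act h).map ζ), ← (α.act h).map_comp, hζmu, map_un_mu,
      α.mu_assoc (mul_inv_cancel h) (inv_mul_cancel h) (mul_one h) (one_mul h) x,
      ← Category.assoc (dagger _), (α.mu_unitary _ _).2, Category.id_comp, un_mu]
  have hθ := θ.naturality ζ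
  simp only [Functor.id_map] at hθ
  simp only [conjApp, Category.assoc]
  rw [← Category.assoc (α.un _), tri, ← Category.assoc ((α.act h).map ζ), ← (α.act h).map_comp,
    hθ, (α.act h).map_comp, Category.assoc, ← Category.assoc ((α.act h).map ((α.act g).map ζ)),
    mu_naturality, Category.assoc,
    ← α.mu_assoc hg (inv_mul_cancel h) (mul_one (h * g)) hk x,
    ← Category.assoc ((α.act (h * g)).map ζ), ← (α.act (h * g)).map_comp, hζmu, map_un_mu,
    Category.comp_id]

theorem conjNat_unique (θ : 𝟭 α.H ⟶ α.act g) (φ : 𝟭 α.H ⟶ α.act g') (hk : g' * h = h * g)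
    (H : ∀ x, φ.app ((α.act h).obj x) ≫ α.mu hk x = (α.act h).map (θ.app x) ≫ α.mu rfl x) :
    α.conjNat h hg θ = φ := by
  refine NatTrans.ext (funext fun y => ?_)
  have := (α.un_unitary y).epi
  have := (α.mu_unitary (mul_inv_cancel h) y).dag.epi
  have := (α.mu_unitary hk ((α.act h⁻¹).obj y)).mono
  obtain ⟨f, hf⟩ : ∃ f : y ≅ (α.act h).obj ((α.act h⁻¹).obj y),
      True := ⟨(α.un_unitary y).iso.trans (α.mu_unitary (mul_inv_cancel h) y).dag.iso, trivial⟩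
  have h1 := (α.conjNat h hg θ).naturality f.hom
  have h2 := φ.naturality f.hom
  have h3 : (α.conjNat h hg θ).app ((α.act h).obj ((α.act h⁻¹).obj y)) =
      φ.app ((α.act h).obj ((α.act h⁻¹).obj y)) := by
    rw [← cancel_mono (α.mu hk ((α.act h⁻¹).obj y)), H]
    exact α.conjApp_mu h hg θ hk rfl _
  rw [h3, h2] at h1
  exact ((cancel_mono ((α.act g').map f.hom)).1 h1).symm

theorem conjNat_id (θ : 𝟭 α.H ⟶ α.act g) (h1 : (1 : G) * g * 1⁻¹ = g) :
    α.conjNat 1 h1 θ = θ := by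
  refine α.conjNat_unique 1 h1 θ θ (by simp) fun x => ?_
  have := (α.un_unitary x).epi
  have key : ∀ (k : G) (h₁ : g * 1 = k) (h₂ : 1 * g = k),
      θ.app ((α.act 1).obj x) ≫ α.mu h₁ x = (α.act 1).map (θ.app x) ≫ α.mu h₂ x := by
    intro k h₁ h₂
    obtain rfl : g = k := by simpa using h₂
    have h3 := θ.naturality (α.un x)
    simp only [Functor.id_map] at h3
    rw [← cancel_epi (α.un x), ← Category.assoc, h3, Category.assoc, map_un_mu, ← Category.assoc,
      ← un_naturality, Category.assoc, un_mu]
  exact key _ _ rfl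

theorem conjNat_comp {g g' g'' : G} (h h' : G) (hg : h * g * h⁻¹ = g') (hg' : h' * g' * h'⁻¹ = g'')
    (hg'' : h' * h * g * (h' * h)⁻¹ = g'') (θ : 𝟭 α.H ⟶ α.act g) :
    α.conjNat (h' * h) hg'' θ = α.conjNat h' hg' (α.conjNat h hg θ) := by
  have e0 : g'' * (h' * h) = h' * h * g := by rw [← hg'']; group
  have e1 : g'' * h' = h' * g' := by rw [← hg']; group
  have e2 : g' * h = h * g := by rw [← hg]; group
  have e3 : h' * g' * h = h' * h * g := by rw [← hg]; group
  have e4 : h' * (h * g) = h' * h * g := by group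
  refine α.conjNat_unique _ hg'' θ _ e0 fun x => ?_
  have := (α.mu_unitary (rfl : h' * h = h' * h) x).epi
  rw [← cancel_epi (α.mu (rfl : h' * h = h' * h) x)]
  have h1 := (α.conjNat h' hg' (α.conjNat h hg θ)).naturality (α.mu (rfl : h' * h = h' * h) x)
  simp only [Functor.id_map] at h1
  rw [← Category.assoc, h1, Category.assoc, α.mu_assoc e1 rfl e0 e3 x, ← Category.assoc]
  have h2 := α.conjApp_mu h' hg' (α.conjNat h hg θ) e1 rfl ((α.act h).obj x)
  have h3 := α.conjApp_mu h hg θ e2 rfl x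
  change (α.conjApp h' hg' (α.conjNat h hg θ) _ ≫ _) ≫ _ = _
  rw [h2, Category.assoc, ← α.mu_assoc rfl e2 e4 e3 x, ← Category.assoc, ← (α.act h').map_comp]
  change (α.act h').map (α.conjApp h hg θ ((α.act h).obj x) ≫ _) ≫ _ = _
  rw [h3, (α.act h').map_comp, Category.assoc, α.mu_assoc rfl rfl e4 rfl x, ← Category.assoc,
    mu_naturality, Category.assoc]
  rfl

/-- The Hilbert space `Nat(id, act g)`. -/
def charFibre (g : G) : Hilb.{max u v} := natHilb (𝟭 α.H) (α.act g) .id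

theorem conjNat_inner {g g' : G} (h : G) (hg : h * g * h⁻¹ = g') (θ θ' : 𝟭 α.H ⟶ α.act g) :
    (α.charFibre g').inner (α.conjNat h hg θ) (α.conjNat h hg θ') =
      (α.charFibre g).inner θ θ' := by
  change ∑ i, (α.H.k i : ℂ) * homInner (α.conjApp h hg θ (α.H.e i)) (α.conjApp h hg θ' (α.H.e i)) =
    ∑ i, (α.H.k i : ℂ) * homInner (θ.app (α.H.e i)) (θ'.app (α.H.e i))
  let _ := α.permAction
  refine Fintype.sum_equiv (MulAction.toPerm h⁻¹) _ _ fun i => ?_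
  change _ = (α.H.k (α.perm h⁻¹ i) : ℂ) *
    homInner (θ.app (α.H.e (α.perm h⁻¹ i))) (θ'.app (α.H.e (α.perm h⁻¹ i)))
  rw [k_perm]
  congr 1
  simp only [conjApp]
  rw [(α.un_unitary _).homInner_comp_left, (α.mu_unitary _ _).dag.homInner_comp_left,
    ← Category.assoc, ← Category.assoc ((α.act h).map _), (α.mu_unitary _ _).homInner_comp_right,
    (α.mu_unitary _ _).homInner_comp_right, α.act_inner]
  obtain ⟨f, hf⟩ := α.exists_unitary_perm h⁻¹ i
  have h1 : ∀ η : 𝟭 α.H ⟶ α.act g, f ≫ η.app ((α.act h⁻¹).obj (α.H.e i)) =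
      η.app (α.H.e (α.perm h⁻¹ i)) ≫ (α.act g).map f := fun η => η.naturality f
  rw [← hf.homInner_comp_left, h1, h1, ((α.act_star g).map_isUnitaryMor hf).homInner_comp_right]

/-- The action of `h` on `Nat(id, act g)`, as a linear map. -/
def charMap {g g' : G} (h : G) (hg : h * g * h⁻¹ = g') :
    α.charFibre g →ₗ[ℂ] α.charFibre g' where
  toFun θ := α.conjNat h hg θ
  map_add' θ θ' := by
    refine NatTrans.ext (funext fun x => ?_)
    change α.un x ≫ dagger (α.mu (mul_inv_cancel h) x) ≫
      (α.act h).map (θ.app ((α.act h⁻¹).obj x) + θ'.app ((α.act h⁻¹).obj x)) ≫ _ =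
      α.conjApp h hg θ x + α.conjApp h hg θ' x
    rw [(α.act_star h).map_add]
    simp only [Preadditive.comp_add, Preadditive.add_comp]
    rfl
  map_smul' c θ := by
    refine NatTrans.ext (funext fun x => ?_)
    change α.un x ≫ dagger (α.mu (mul_inv_cancel h) x) ≫
      (α.act h).map (c • θ.app ((α.act h⁻¹).obj x)) ≫ _ = c • α.conjApp h hg θ x
    rw [(α.act_star h).map_smul]
    simp only [Linear.smul_comp, Linear.comp_smul]
    rfl

/-- The 2-character of a marked unitary 2-representation: the fibre over `g` is `Nat(id, act g)`,
and `h` acts by conjugation. -/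
def twoChar : HilbG.{v, max u v} G where
  functor :=
    { obj := fun g => α.charFibre g.pt
      map := fun h => ⟨α.charMap h.elt h.conj_eq⟩
      map_id := fun g => Hilb.hom_ext fun θ => α.conjNat_id θ _
      map_comp := fun h k => Hilb.hom_ext fun θ => α.conjNat_comp _ _ _ _ _ θ }
  unitary h := LoopBG.isUnitary_of_inner _ (fun h θ θ' => α.conjNat_inner h.elt h.conj_eq θ θ') h

end char

end TwoRep

/-! ## Equivariant gerbes -/

/-- A finite discrete `G`-equivariant gerbe with metric: a `U(1)`-central extension of the action
groupoid of a finite `G`-set `X`, that is, a groupoid with object set `X`, a full functor (the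
identity on objects) to the action groupoid of `X`, here given as the degree `deg u ∈ G` of an arrow,
and an identification of the arrows of degree `1` with a trivial central bundle of groups `U(1)`;
together with a `G`-invariant family of positive numbers `k x`. -/
structure Gerbe (G : Type v) [Group G] : Type (v + 1) where
  X : Type v
  [fintype : Fintype X]
  [action : MulAction G X]
  [groupoid : Groupoid.{v} X]
  deg : ∀ {x y : X}, (x ⟶ y) → G
  deg_smul : ∀ {x y : X} (u : x ⟶ y), deg u • x = y
  deg_id : ∀ x : X, deg (𝟙 x) = 1
  deg_comp : ∀ {x y z : X} (u : x ⟶ y) (w : y ⟶ z), deg (u ≫ w) = deg w * deg u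
  full : ∀ (g : G) (x y : X), g • x = y → ∃ u : x ⟶ y, deg u = g
  phase : ∀ x : X, Circle → (x ⟶ x)
  phase_mul : ∀ (x : X) (z z' : Circle), phase x (z * z') = phase x z ≫ phase x z'
  phase_injective : ∀ x : X, Function.Injective (phase x)
  deg_phase : ∀ (x : X) (z : Circle), deg (phase x z) = 1
  exists_phase : ∀ (x : X) (u : x ⟶ x), deg u = 1 → ∃ z, phase x z = u
  central : ∀ {x y : X} (z : Circle) (u : x ⟶ y), phase x z ≫ u = u ≫ phase y z
  k : X → ℝ
  k_pos : ∀ x, 0 < k x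
  k_smul : ∀ (g : G) (x : X), k (g • x) = k x

namespace Gerbe
variable {G : Type v} [Group G]

section basic
variable (𝒳 : Gerbe.{v} G)
instance : Fintype 𝒳.X := 𝒳.fintype
instance : MulAction G 𝒳.X := 𝒳.action
instance : Groupoid.{v} 𝒳.X := 𝒳.groupoid

/-- The action of `U(1)` on the arrows of a gerbe. -/
def sc (z : Circle) {x y : 𝒳.X} (u : x ⟶ y) : x ⟶ y := 𝒳.phase x z ≫ u

variable {𝒳} {x y t : 𝒳.X}

theorem phase_one (x : 𝒳.X) : 𝒳.phase x 1 = 𝟙 x := by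
  have h := 𝒳.phase_mul x 1 1
  rw [mul_one, ← cancel_mono (Groupoid.inv (𝒳.phase x 1)), Category.assoc] at h
  simpa using h.symm

theorem sc_one (u : x ⟶ y) : 𝒳.sc 1 u = u := by
  rw [sc, phase_one, Category.id_comp]
theorem sc_sc (z z' : Circle) (u : x ⟶ y) : 𝒳.sc z (𝒳.sc z' u) = 𝒳.sc (z * z') u := by
  rw [sc, sc, sc, 𝒳.phase_mul, Category.assoc]
theorem sc_comp (z : Circle) (u : x ⟶ y) (w : y ⟶ t) : 𝒳.sc z u ≫ w = 𝒳.sc z (u ≫ w) :=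
  Category.assoc _ _ _
theorem comp_sc (z : Circle) (u : x ⟶ y) (w : y ⟶ t) : u ≫ 𝒳.sc z w = 𝒳.sc z (u ≫ w) := by
  rw [sc, sc, ← Category.assoc, ← 𝒳.central, Category.assoc]
theorem sc_id (z : Circle) (x : 𝒳.X) : 𝒳.sc z (𝟙 x) = 𝒳.phase x z := Category.comp_id _
theorem deg_sc (z : Circle) (u : x ⟶ y) : 𝒳.deg (𝒳.sc z u) = 𝒳.deg u := by
  rw [sc, 𝒳.deg_comp, 𝒳.deg_phase, mul_one]
theorem sc_injective (u : x ⟶ y) {z z' : Circle} (h : 𝒳.sc z u = 𝒳.sc z' u) : z = z' :=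
  𝒳.phase_injective x ((cancel_mono u).1 h)
theorem deg_inv (u : x ⟶ y) : 𝒳.deg (Groupoid.inv u) = (𝒳.deg u)⁻¹ := by
  rw [eq_inv_iff_mul_eq_one, ← 𝒳.deg_comp, Groupoid.comp_inv, 𝒳.deg_id]
theorem exists_sc (u w : x ⟶ y) (h : 𝒳.deg u = 𝒳.deg w) : ∃ z, w = 𝒳.sc z u := by
  obtain ⟨z, hz⟩ := 𝒳.exists_phase x (w ≫ Groupoid.inv u)
    (by rw [𝒳.deg_comp, deg_inv, h, inv_mul_cancel])
  exact ⟨z, by rw [sc, hz, Category.assoc, Groupoid.inv_comp, Category.comp_id]⟩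
theorem inv_sc (z : Circle) (u : x ⟶ y) :
    Groupoid.inv (𝒳.sc z u) = 𝒳.sc z⁻¹ (Groupoid.inv u) := by
  rw [← cancel_epi (𝒳.sc z u), Groupoid.comp_inv, comp_sc, sc_comp, sc_sc, inv_mul_cancel,
    Groupoid.comp_inv, sc_one]
theorem target_unique {x x' y y' : 𝒳.X} (u : x ⟶ y) (u' : x' ⟶ y') (h : 𝒳.deg u = 𝒳.deg u')
    (hx : y = y') : x = x' := by
  rw [← 𝒳.deg_smul u, ← 𝒳.deg_smul u', h] at hx
  exact MulAction.injective _ hx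
/-- An arrow of prescribed degree into a given object. -/
theorem exists_to (g : G) (y : 𝒳.X) : ∃ u : g⁻¹ • y ⟶ y, 𝒳.deg u = g :=
  𝒳.full g _ _ (smul_inv_smul g y)

end basic

/-- The conjugate gerbe: the same groupoid, with the conjugate action of `U(1)`. -/
def conjugate (𝒳 : Gerbe.{v} G) : Gerbe.{v} G where
  X := 𝒳.X
  deg := 𝒳.deg
  deg_smul := 𝒳.deg_smul
  deg_id := 𝒳.deg_id
  deg_comp := 𝒳.deg_comp
  full := 𝒳.full
  phase x z := 𝒳.phase x z⁻¹
  phase_mul x z z' := by rw [mul_inv, 𝒳.phase_mul]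
  phase_injective x z z' h := inv_injective (𝒳.phase_injective x h)
  deg_phase x z := 𝒳.deg_phase x _
  exists_phase x u h := by
    obtain ⟨z, hz⟩ := 𝒳.exists_phase x u h
    exact ⟨z⁻¹, by rw [inv_inv, hz]⟩
  central z u := 𝒳.central _ u
  k := 𝒳.k
  k_pos := 𝒳.k_pos
  k_smul := 𝒳.k_smul

section tensor
variable (𝒴 𝒳 : Gerbe.{v} G)

/-- Objects of the tensor product of two gerbes. -/
@[ext] structure Pair : Type v where
  fst : 𝒴.X
  snd : 𝒳.X

variable {𝒴 𝒳}

/-- Pairs of arrows of the same degree. -/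
structure PreHom (p q : Pair 𝒴 𝒳) : Type v where
  fst : p.fst ⟶ q.fst
  snd : p.snd ⟶ q.snd
  deg_eq : 𝒴.deg fst = 𝒳.deg snd

/-- The identifications `(z v, u) ∼ (v, z u)` in the tensor product of torsors. -/
instance preHomSetoid (p q : Pair 𝒴 𝒳) : Setoid (PreHom p q) where
  r a b := ∃ z : Circle, b.fst = 𝒴.sc z a.fst ∧ a.snd = 𝒳.sc z b.snd
  iseqv :=
    { refl := fun a => ⟨1, by rw [sc_one], by rw [sc_one]⟩
      symm := by
        rintro a b ⟨z, h1, h2⟩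
        exact ⟨z⁻¹, by rw [h1, sc_sc, inv_mul_cancel, sc_one],
          by rw [h2, sc_sc, inv_mul_cancel, sc_one]⟩
      trans := by
        rintro a b c ⟨z, h1, h2⟩ ⟨z', h3, h4⟩
        exact ⟨z' * z, by rw [h3, h1, sc_sc], by rw [h2, h4, sc_sc, mul_comm]⟩ }

/-- Arrows of the tensor product of two gerbes: the tensor products of the torsors of arrows. -/
def TensorHom (p q : Pair 𝒴 𝒳) : Type v := Quotient (preHomSetoid p q)

/-- The arrow `v ⊗ u`. -/
def tmulHom {p q : Pair 𝒴 𝒳} (v : p.fst ⟶ q.fst) (u : p.snd ⟶ q.snd) (h : 𝒴.deg v = 𝒳.deg u) :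
    TensorHom p q := (⟦⟨v, u, h⟩⟧ : Quotient (preHomSetoid p q))

theorem tmulHom_sc {p q : Pair 𝒴 𝒳} (z : Circle) (v : p.fst ⟶ q.fst) (u : p.snd ⟶ q.snd)
    (h : 𝒴.deg v = 𝒳.deg u) (h1 : 𝒴.deg (𝒴.sc z v) = 𝒳.deg u) (h2 : 𝒴.deg v = 𝒳.deg (𝒳.sc z u)) :
    tmulHom (𝒴.sc z v) u h1 = tmulHom v (𝒳.sc z u) h2 :=
  Eq.symm (Quotient.sound ⟨z, rfl, rfl⟩)

instance : Groupoid (Pair 𝒴 𝒳) where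
  Hom p q := TensorHom p q
  id p := tmulHom (𝟙 _) (𝟙 _) (by rw [𝒴.deg_id, 𝒳.deg_id])
  comp := Quotient.map₂ (fun a b => ⟨a.fst ≫ b.fst, a.snd ≫ b.snd, by
      rw [𝒴.deg_comp, 𝒳.deg_comp, a.deg_eq, b.deg_eq]⟩) (by
    rintro a a' ⟨z, h1, h2⟩ b b' ⟨z', h3, h4⟩
    refine ⟨z * z', ?_, ?_⟩
    · change a'.fst ≫ b'.fst = 𝒴.sc _ (a.fst ≫ b.fst)
      rw [h1, h3, sc_comp, comp_sc, sc_sc]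
    · change a.snd ≫ b.snd = 𝒳.sc _ (a'.snd ≫ b'.snd)
      rw [h2, h4, sc_comp, comp_sc, sc_sc])
  inv := Quotient.map (fun a => ⟨Groupoid.inv a.fst, Groupoid.inv a.snd, by
      rw [deg_inv, deg_inv, a.deg_eq]⟩) (by
    rintro a a' ⟨z, h1, h2⟩
    refine ⟨z⁻¹, ?_, ?_⟩
    · change Groupoid.inv a'.fst = _
      rw [h1, inv_sc]
    · change Groupoid.inv a.snd = _
      rw [h2, inv_sc])
  id_comp := by
    rintro p q ⟨a⟩
    exact congrArg (Quotient.mk _) (by cases a; simp)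
  comp_id := by
    rintro p q ⟨a⟩
    exact congrArg (Quotient.mk _) (by cases a; simp)
  assoc := by
    rintro p q r s ⟨a⟩ ⟨b⟩ ⟨c⟩
    exact congrArg (Quotient.mk _) (by simp)
  inv_comp := by
    rintro p q ⟨a⟩
    exact congrArg (Quotient.mk _) (by simp)
  comp_inv := by
    rintro p q ⟨a⟩
    exact congrArg (Quotient.mk _) (by simp)

theorem tmulHom_comp {p q r : Pair 𝒴 𝒳} (v : p.fst ⟶ q.fst) (u : p.snd ⟶ q.snd)
    (h : 𝒴.deg v = 𝒳.deg u) (v' : q.fst ⟶ r.fst) (u' : q.snd ⟶ r.snd)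
    (h' : 𝒴.deg v' = 𝒳.deg u') (h'' : 𝒴.deg (v ≫ v') = 𝒳.deg (u ≫ u')) :
    (show p ⟶ q from tmulHom v u h) ≫ (show q ⟶ r from tmulHom v' u' h') =
      tmulHom (v ≫ v') (u ≫ u') h'' := rfl

instance : MulAction G (Pair 𝒴 𝒳) where
  smul g p := ⟨g • p.fst, g • p.snd⟩
  one_smul p := Pair.ext (one_smul _ _) (one_smul _ _)
  mul_smul g h p := Pair.ext (mul_smul _ _ _) (mul_smul _ _ _)

instance : Fintype (Pair 𝒴 𝒳) :=
  Fintype.ofEquiv (𝒴.X × 𝒳.X) ⟨fun p => ⟨p.1, p.2⟩, fun p => ⟨p.fst, p.snd⟩, fun _ => rfl, fun _ => rfl⟩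

variable (𝒴 𝒳)

/-- The tensor product of gerbes, with the product metric. -/
def tensor : Gerbe.{v} G where
  X := Pair 𝒴 𝒳
  deg := Quotient.lift (fun a => 𝒴.deg a.fst) (by
    rintro a b ⟨z, h1, h2⟩
    rw [h1, deg_sc])
  deg_smul := by
    rintro p q ⟨a⟩
    refine Pair.ext (𝒴.deg_smul a.fst) ?_
    change 𝒴.deg a.fst • p.snd = q.snd
    rw [a.deg_eq, 𝒳.deg_smul]
  deg_id p := 𝒴.deg_id _
  deg_comp := by
    rintro p q r ⟨a⟩ ⟨b⟩
    exact 𝒴.deg_comp _ _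
  full g p q h := by
    obtain ⟨v, hv⟩ := 𝒴.full g p.fst q.fst (congrArg Pair.fst h)
    obtain ⟨u, hu⟩ := 𝒳.full g p.snd q.snd (congrArg Pair.snd h)
    exact ⟨tmulHom v u (hv.trans hu.symm), hv⟩
  phase p z := tmulHom (𝒴.phase p.fst z) (𝟙 p.snd) (by rw [𝒴.deg_phase, 𝒳.deg_id])
  phase_mul p z z' := by
    have h : 𝒴.phase p.fst (z * z') = _ := 𝒴.phase_mul _ _ _
    refine congrArg (Quotient.mk _) ?_
    simp [h]
  phase_injective p z z' h := by
    obtain ⟨t, h1, h2⟩ := Quotient.exact h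
    change 𝒴.phase p.fst z' = 𝒴.phase p.fst t ≫ 𝒴.phase p.fst z at h1
    change 𝟙 p.snd = 𝒳.sc t (𝟙 p.snd) at h2
    have h3 : 𝒳.sc 1 (𝟙 p.snd) = 𝒳.sc t (𝟙 p.snd) := by rw [← h2, sc_one]
    rw [← sc_injective _ h3, phase_one, Category.id_comp] at h1
    exact (𝒴.phase_injective _ h1).symm
  deg_phase p z := 𝒴.deg_phase _ _
  exists_phase := by
    rintro p ⟨a⟩ h
    have h1 : 𝒴.deg a.fst = 1 := h
    have h2 : 𝒳.deg a.snd = 1 := by rw [← a.deg_eq, h1]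
    obtain ⟨z, hz⟩ := 𝒴.exists_phase _ _ h1
    obtain ⟨z', hz'⟩ := 𝒳.exists_phase _ _ h2
    refine ⟨z' * z, Eq.symm (Quotient.sound ⟨z', ?_, ?_⟩)⟩
    · change 𝒴.phase p.fst (z' * z) = 𝒴.phase p.fst z' ≫ a.fst
      rw [𝒴.phase_mul, hz]
    · change a.snd = 𝒳.sc z' (𝟙 p.snd)
      rw [sc_id, hz']
  central := by
    rintro p q z ⟨a⟩
    refine congrArg (Quotient.mk _) ?_
    simp [𝒴.central]
  k p := 𝒴.k p.fst * 𝒳.k p.snd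
  k_pos p := mul_pos (𝒴.k_pos _) (𝒳.k_pos _)
  k_smul g p := congrArg₂ (· * ·) (𝒴.k_smul _ _) (𝒳.k_smul _ _)

end tensor
end Gerbe

/-- A unitary equivariant vector bundle over a gerbe: a functor to Hilbert spaces which acts by
unitary maps and which is compatible with the actions of `U(1)`. -/
structure Bundle {G : Type v} [Group G] (𝒳 : Gerbe.{v} G) : Type (v + 1) where
  functor : 𝒳.X ⥤ Hilb.{v}
  unitary : ∀ {x y : 𝒳.X} (u : x ⟶ y), Hilb.IsUnitary (functor.map u)
  map_sc : ∀ {x y : 𝒳.X} (z : Circle) (u : x ⟶ y),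
    (functor.map (𝒳.sc z u)).lin = (z : ℂ) • (functor.map u).lin

/-! ## Morphisms of gerbes and their convolution -/

/-- A morphism of gerbes `𝒳 → 𝒴`: a unitary equivariant vector bundle over `𝒴 ⊗ 𝒳̄`. -/
def Kernel {G : Type v} [Group G] (𝒳 𝒴 : Gerbe.{v} G) : Type (v + 1) :=
  Bundle (𝒴.tensor 𝒳.conjugate)

namespace Kernel
variable {G : Type v} [Group G] {𝒳 𝒴 : Gerbe.{v} G}

/-- The object `(y, x)` of `𝒴 ⊗ 𝒳̄`. -/
def pt (y : 𝒴.X) (x : 𝒳.X) : (𝒴.tensor 𝒳.conjugate).X :=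
  (⟨y, x⟩ : Gerbe.Pair 𝒴 𝒳.conjugate)

/-- The first component of an object of `𝒴 ⊗ 𝒳̄`. -/
def lf (p : (𝒴.tensor 𝒳.conjugate).X) : 𝒴.X := Gerbe.Pair.fst (𝒴 := 𝒴) (𝒳 := 𝒳.conjugate) p

/-- The second component of an object of `𝒴 ⊗ 𝒳̄`. -/
def rt (p : (𝒴.tensor 𝒳.conjugate).X) : 𝒳.X := Gerbe.Pair.snd (𝒴 := 𝒴) (𝒳 := 𝒳.conjugate) p

/-- The arrow `v ⊗ ū` of `𝒴 ⊗ 𝒳̄`. -/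
def arrow {y y' : 𝒴.X} {x x' : 𝒳.X} (v : y ⟶ y') (u : x ⟶ x') (h : 𝒴.deg v = 𝒳.deg u) :
    (pt y x : (𝒴.tensor 𝒳.conjugate).X) ⟶ pt y' x' :=
  Gerbe.tmulHom (𝒴 := 𝒴) (𝒳 := 𝒳.conjugate) (p := ⟨y, x⟩) (q := ⟨y', x'⟩) v u h

theorem arrow_id (y : 𝒴.X) (x : 𝒳.X) (h : 𝒴.deg (𝟙 y) = 𝒳.deg (𝟙 x)) :
    arrow (𝟙 y) (𝟙 x) h = 𝟙 (pt y x) := rfl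

theorem arrow_comp {y y' y'' : 𝒴.X} {x x' x'' : 𝒳.X} (v : y ⟶ y') (u : x ⟶ x')
    (h : 𝒴.deg v = 𝒳.deg u) (v' : y' ⟶ y'') (u' : x' ⟶ x'') (h' : 𝒴.deg v' = 𝒳.deg u')
    (h'' : 𝒴.deg (v ≫ v') = 𝒳.deg (u ≫ u')) :
    arrow (v ≫ v') (u ≫ u') h'' = arrow v u h ≫ arrow v' u' h' := rfl

theorem arrow_sc_left {y y' : 𝒴.X} {x x' : 𝒳.X} (z : Circle) (v : y ⟶ y') (u : x ⟶ x')
    (h : 𝒴.deg v = 𝒳.deg u) (h' : 𝒴.deg (𝒴.sc z v) = 𝒳.deg u) :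
    arrow (𝒴.sc z v) u h' = (𝒴.tensor 𝒳.conjugate).sc z (arrow v u h) := by
  refine congrArg (Quotient.mk (Gerbe.preHomSetoid (𝒴 := 𝒴) (𝒳 := 𝒳.conjugate) ⟨y, x⟩ ⟨y', x'⟩))
    (?_ : (⟨𝒴.sc z v, u, h'⟩ : Gerbe.PreHom (𝒴 := 𝒴) (𝒳 := 𝒳.conjugate) ⟨y, x⟩ ⟨y', x'⟩) =
      ⟨𝒴.phase y z ≫ v, 𝟙 _ ≫ u, _⟩)
  congr 1
  exact (Category.id_comp u).symm

theorem arrow_sc_right {y y' : 𝒴.X} {x x' : 𝒳.X} (z : Circle) (v : y ⟶ y') (u : x ⟶ x')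
    (h : 𝒴.deg v = 𝒳.deg u) (h' : 𝒴.deg v = 𝒳.deg (𝒳.sc z u)) :
    arrow v (𝒳.sc z u) h' = (𝒴.tensor 𝒳.conjugate).sc z⁻¹ (arrow v u h) := by
  have h1 : 𝒳.conjugate.sc z⁻¹ (x := x) (y := x') u = 𝒳.sc z u := by
    change 𝒳.phase x z⁻¹⁻¹ ≫ u = _
    rw [inv_inv]
    rfl
  have h2 : 𝒴.deg (𝒴.sc z⁻¹ v) = 𝒳.deg u := by rw [Gerbe.deg_sc, h]
  rw [← arrow_sc_left z⁻¹ v u h h2]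
  refine Eq.trans ?_ (Gerbe.tmulHom_sc (𝒴 := 𝒴) (𝒳 := 𝒳.conjugate) (p := ⟨y, x⟩) (q := ⟨y', x'⟩)
    z⁻¹ v u h h2 (by rw [h1]; exact h')).symm
  unfold arrow
  congr 1
  exact h1.symm

theorem arrow_surj {p q : (𝒴.tensor 𝒳.conjugate).X} (a : p ⟶ q) :
    ∃ (y y' : 𝒴.X) (x x' : 𝒳.X) (v : y ⟶ y') (u : x ⟶ x') (h : 𝒴.deg v = 𝒳.deg u)
      (hp : p = pt y x) (hq : q = pt y' x'), HEq a (arrow v u h) := by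
  obtain ⟨⟨v, u, h⟩, rfl⟩ := Quotient.exists_rep a
  exact ⟨_, _, _, _, v, u, h, rfl, rfl, HEq.rfl⟩

section
variable (E : Kernel 𝒳 𝒴)

/-- The fibre `⟨y | E | x⟩`. -/
def fib (y : 𝒴.X) (x : 𝒳.X) : Hilb.{v} := E.functor.obj (pt y x)

/-- The map `E (v ⊗ ū) : ⟨y | E | x⟩ → ⟨y' | E | x'⟩`. -/
def act {y y' : 𝒴.X} {x x' : 𝒳.X} (v : y ⟶ y') (u : x ⟶ x') (h : 𝒴.deg v = 𝒳.deg u) :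
    E.fib y x →ₗ[ℂ] E.fib y' x' := (E.functor.map (arrow v u h)).lin

theorem act_id (y : 𝒴.X) (x : 𝒳.X) (h : 𝒴.deg (𝟙 y) = 𝒳.deg (𝟙 x)) :
    E.act (𝟙 y) (𝟙 x) h = LinearMap.id := by
  unfold act
  rw [arrow_id, E.functor.map_id]
  rfl

theorem act_comp {y y' y'' : 𝒴.X} {x x' x'' : 𝒳.X} (v : y ⟶ y') (u : x ⟶ x')
    (h : 𝒴.deg v = 𝒳.deg u) (v' : y' ⟶ y'') (u' : x' ⟶ x'') (h' : 𝒴.deg v' = 𝒳.deg u')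
    (h'' : 𝒴.deg (v ≫ v') = 𝒳.deg (u ≫ u')) :
    E.act (v ≫ v') (u ≫ u') h'' = E.act v' u' h' ∘ₗ E.act v u h := by
  unfold act
  rw [arrow_comp v u h v' u' h', E.functor.map_comp]
  rfl

theorem act_sc_left {y y' : 𝒴.X} {x x' : 𝒳.X} (z : Circle) (v : y ⟶ y') (u : x ⟶ x')
    (h : 𝒴.deg v = 𝒳.deg u) (h' : 𝒴.deg (𝒴.sc z v) = 𝒳.deg u) :
    E.act (𝒴.sc z v) u h' = (z : ℂ) • E.act v u h := by
  unfold act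
  rw [arrow_sc_left z v u h, E.map_sc]
  rfl

theorem act_sc_right {y y' : 𝒴.X} {x x' : 𝒳.X} (z : Circle) (v : y ⟶ y') (u : x ⟶ x')
    (h : 𝒴.deg v = 𝒳.deg u) (h' : 𝒴.deg v = 𝒳.deg (𝒳.sc z u)) :
    E.act v (𝒳.sc z u) h' = ((z⁻¹ : Circle) : ℂ) • E.act v u h := by
  unfold act
  rw [arrow_sc_right z v u h, E.map_sc]
  rfl

theorem act_inner {y y' : 𝒴.X} {x x' : 𝒳.X} (v : y ⟶ y') (u : x ⟶ x')
    (h : 𝒴.deg v = 𝒳.deg u) (a b : E.fib y x) :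
    (E.fib y' x').inner (E.act v u h a) (E.act v u h b) = (E.fib y x).inner a b :=
  (E.unitary (arrow v u h)).2 a b

end

/-- The data of a morphism of gerbes in terms of its fibres. -/
structure Data (𝒳 𝒴 : Gerbe.{v} G) : Type (v + 1) where
  fib : 𝒴.X → 𝒳.X → Hilb.{v}
  act : ∀ {y y' : 𝒴.X} {x x' : 𝒳.X} (v : y ⟶ y') (u : x ⟶ x') (h : 𝒴.deg v = 𝒳.deg u),
    fib y x →ₗ[ℂ] fib y' x'
  act_id : ∀ (y : 𝒴.X) (x : 𝒳.X) (h : 𝒴.deg (𝟙 y) = 𝒳.deg (𝟙 x)),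
    act (𝟙 y) (𝟙 x) h = LinearMap.id
  act_comp : ∀ {y y' y'' : 𝒴.X} {x x' x'' : 𝒳.X} (v : y ⟶ y') (u : x ⟶ x')
    (h : 𝒴.deg v = 𝒳.deg u) (v' : y' ⟶ y'') (u' : x' ⟶ x'') (h' : 𝒴.deg v' = 𝒳.deg u')
    (h'' : 𝒴.deg (v ≫ v') = 𝒳.deg (u ≫ u')),
    act (v ≫ v') (u ≫ u') h'' = act v' u' h' ∘ₗ act v u h
  act_sc_left : ∀ {y y' : 𝒴.X} {x x' : 𝒳.X} (z : Circle) (v : y ⟶ y') (u : x ⟶ x')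
    (h : 𝒴.deg v = 𝒳.deg u) (h' : 𝒴.deg (𝒴.sc z v) = 𝒳.deg u),
    act (𝒴.sc z v) u h' = (z : ℂ) • act v u h
  act_sc_right : ∀ {y y' : 𝒴.X} {x x' : 𝒳.X} (z : Circle) (v : y ⟶ y') (u : x ⟶ x')
    (h : 𝒴.deg v = 𝒳.deg u) (h' : 𝒴.deg v = 𝒳.deg (𝒳.sc z u)),
    act v (𝒳.sc z u) h' = ((z⁻¹ : Circle) : ℂ) • act v u h
  act_inner : ∀ {y y' : 𝒴.X} {x x' : 𝒳.X} (v : y ⟶ y') (u : x ⟶ x')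
    (h : 𝒴.deg v = 𝒳.deg u) (a b : fib y x),
    (fib y' x').inner (act v u h a) (act v u h b) = (fib y x).inner a b

namespace Data
variable (D : Data 𝒳 𝒴)

/-- The map of fibres induced by an arrow of `𝒴 ⊗ 𝒳̄`. -/
def mapHom (p q : Gerbe.Pair 𝒴 𝒳.conjugate) :
    Gerbe.TensorHom p q → (D.fib p.fst p.snd →ₗ[ℂ] D.fib q.fst q.snd) :=
  Quotient.lift (fun a => D.act a.fst (x := p.snd) (x' := q.snd) a.snd a.deg_eq) (by
    rintro ⟨v, u, h⟩ ⟨v', u', h'⟩ ⟨z, h1, h2⟩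
    obtain rfl : v' = 𝒴.sc z v := h1
    have h3 : u = 𝒳.sc z⁻¹ (x := p.snd) (y := q.snd) u' := h2
    subst h3
    have h4 : 𝒴.deg v = 𝒳.deg (x := p.snd) (y := q.snd) u' := by rw [← Gerbe.deg_sc z v]; exact h'
    refine (D.act_sc_right z⁻¹ v u' h4 h).trans ?_
    rw [inv_inv]
    exact (D.act_sc_left z v u' h4 h').symm)

theorem act_bijective {y y' : 𝒴.X} {x x' : 𝒳.X} (v : y ⟶ y') (u : x ⟶ x')
    (h : 𝒴.deg v = 𝒳.deg u) : Function.Bijective (D.act v u h) := by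
  have h' : 𝒴.deg (Groupoid.inv v) = 𝒳.deg (Groupoid.inv u) := by
    rw [Gerbe.deg_inv, Gerbe.deg_inv, h]
  refine Function.bijective_iff_has_inverse.2 ⟨D.act _ _ h', fun a => ?_, fun a => ?_⟩
  · have h1 := D.act_comp v u h _ _ h' (by rw [𝒴.deg_comp, 𝒳.deg_comp, h', h])
    simp only [Groupoid.comp_inv] at h1
    rw [D.act_id] at h1
    exact (LinearMap.congr_fun h1 a).symm
  · have h1 := D.act_comp _ _ h' v u h (by rw [𝒴.deg_comp, 𝒳.deg_comp, h', h])
    simp only [Groupoid.inv_comp] at h1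
    rw [D.act_id] at h1
    exact (LinearMap.congr_fun h1 a).symm

/-- A morphism of gerbes from its data. -/
def toKernel : Kernel 𝒳 𝒴 where
  functor :=
    { obj := fun p => D.fib (lf p) (rt p)
      map := fun {p q} a => ⟨D.mapHom p q a⟩
      map_id := fun p => Hilb.hom_ext fun x => LinearMap.congr_fun (D.act_id _ _ _) x
      map_comp := by
        rintro p q r ⟨a⟩ ⟨b⟩
        exact Hilb.hom_ext fun x => LinearMap.congr_fun (D.act_comp _ _ a.deg_eq _ _ b.deg_eq _) x }
  unitary := by
    rintro p q ⟨⟨v, u, h⟩⟩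
    exact ⟨D.act_bijective (x := rt p) (x' := rt q) v u h, D.act_inner (x := rt p) (x' := rt q) v u h⟩
  map_sc := by
    rintro p q z ⟨⟨v, u, h⟩⟩
    have h' : 𝒴.deg (𝒴.sc z v) = 𝒳.deg (x := rt p) (y := rt q) u := by
      rw [Gerbe.deg_sc]; exact h
    refine Eq.trans (?_ : _ = D.act (𝒴.sc z v) u h') (D.act_sc_left z v u h h')
    exact congrArg (D.mapHom p q) (arrow_sc_left (𝒳 := 𝒳) z v (x := rt p) (x' := rt q) u h h').symm

theorem toKernel_fib (y : 𝒴.X) (x : 𝒳.X) : D.toKernel.fib y x = D.fib y x := rfl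
theorem toKernel_act {y y' : 𝒴.X} {x x' : 𝒳.X} (v : y ⟶ y') (u : x ⟶ x')
    (h : 𝒴.deg v = 𝒳.deg u) : D.toKernel.act v u h = D.act v u h := rfl

end Data

/-- Two morphisms of gerbes are isomorphic when they are isomorphic as equivariant bundles. -/
def Iso (E F : Kernel 𝒳 𝒴) : Prop := Nonempty (E.functor ≅ F.functor)

theorem iso_of_maps {E F : Kernel 𝒳 𝒴} (θ : ∀ y x, E.fib y x →ₗ[ℂ] F.fib y x)
    (hbij : ∀ y x, Function.Bijective (θ y x))
    (hnat : ∀ {y y' : 𝒴.X} {x x' : 𝒳.X} (v : y ⟶ y') (u : x ⟶ x') (h : 𝒴.deg v = 𝒳.deg u) a,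
      θ y' x' (E.act v u h a) = F.act v u h (θ y x a)) : Iso E F := by
  refine ⟨NatIso.ofComponents (fun p =>
    { hom := ⟨θ (lf p) (rt p)⟩
      inv := ⟨(LinearEquiv.ofBijective _ (hbij (lf p) (rt p))).symm.toLinearMap⟩
      hom_inv_id := Hilb.hom_ext fun a =>
        (LinearEquiv.ofBijective _ (hbij (lf p) (rt p))).symm_apply_apply a
      inv_hom_id := Hilb.hom_ext fun a =>
        (LinearEquiv.ofBijective _ (hbij (lf p) (rt p))).apply_symm_apply a })
    ?_⟩
  rintro p q ⟨⟨v, u, h⟩⟩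
  exact Hilb.hom_ext fun a => hnat v u h a

theorem Iso.maps {E F : Kernel 𝒳 𝒴} (h : Iso E F) : ∃ θ : ∀ y x, E.fib y x →ₗ[ℂ] F.fib y x,
    (∀ y x, Function.Bijective (θ y x)) ∧
    ∀ {y y' : 𝒴.X} {x x' : 𝒳.X} (v : y ⟶ y') (u : x ⟶ x') (h : 𝒴.deg v = 𝒳.deg u) a,
      θ y' x' (E.act v u h a) = F.act v u h (θ y x a) := by
  obtain ⟨e⟩ := h
  refine ⟨fun y x => (e.hom.app (pt y x)).lin, fun y x =>
    Function.bijective_iff_has_inverse.2 ⟨(e.inv.app (pt y x)).lin, fun a => ?_, fun a => ?_⟩,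
    fun v u h a => ?_⟩
  · exact LinearMap.congr_fun (congrArg Hilb.Hom.lin (e.hom_inv_id_app (pt y x))) a
  · exact LinearMap.congr_fun (congrArg Hilb.Hom.lin (e.inv_hom_id_app (pt y x))) a
  · exact LinearMap.congr_fun (congrArg Hilb.Hom.lin (e.hom.naturality (arrow v u h))) a

end Kernel

namespace Hilb

/-- The tensor product of linear maps. -/
def tensorMap {V V' W W' : Hilb.{w}} (f : V →ₗ[ℂ] V') (g : W →ₗ[ℂ] W') :
    tensor V W →ₗ[ℂ] tensor V' W' :=
  (TensorProduct.map f g : V ⊗[ℂ] W →ₗ[ℂ] V' ⊗[ℂ] W')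

/-- The pure tensor `a ⊗ b`. -/
def tmul {V W : Hilb.{w}} (a : V) (b : W) : tensor V W := (a ⊗ₜ b : V ⊗[ℂ] W)

theorem tensor_induction {V W : Hilb.{w}} {p : tensor V W → Prop} (h0 : p 0)
    (h1 : ∀ a b, p (tmul a b)) (h2 : ∀ c d, p c → p d → p (c + d)) (a : tensor V W) : p a :=
  TensorProduct.induction_on (R := ℂ) (M := V) (N := W) (motive := p) a h0 h1 h2

theorem inner_tmul {V W : Hilb.{w}} (a c : V) (b d : W) :
    (tensor V W).inner (tmul a b) (tmul c d) = V.inner a c * W.inner b d := tensor_inner V W a c b d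

theorem tensorMap_tmul {V V' W W' : Hilb.{w}} (f : V →ₗ[ℂ] V') (g : W →ₗ[ℂ] W') (a : V) (b : W) :
    tensorMap f g (tmul a b) = tmul (f a) (g b) := rfl

theorem tensor_ext {V W : Hilb.{w}} {X : Type*} [AddCommGroup X] [Module ℂ X]
    {f g : tensor V W →ₗ[ℂ] X}
    (h : ∀ (a : V) (b : W), f (a ⊗ₜ b : V ⊗[ℂ] W) = g (a ⊗ₜ b : V ⊗[ℂ] W)) : f = g :=
  TensorProduct.ext' (g := (f : V ⊗[ℂ] W →ₗ[ℂ] X)) (h := (g : V ⊗[ℂ] W →ₗ[ℂ] X)) h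

theorem tensorMap_id (V W : Hilb.{w}) :
    tensorMap (LinearMap.id : V →ₗ[ℂ] V) (LinearMap.id : W →ₗ[ℂ] W) = LinearMap.id :=
  tensor_ext fun _ _ => rfl
theorem tensorMap_comp {V V' V'' W W' W'' : Hilb.{w}} (f : V →ₗ[ℂ] V') (f' : V' →ₗ[ℂ] V'')
    (g : W →ₗ[ℂ] W') (g' : W' →ₗ[ℂ] W'') :
    tensorMap (f' ∘ₗ f) (g' ∘ₗ g) = tensorMap f' g' ∘ₗ tensorMap f g :=
  tensor_ext fun _ _ => rfl
theorem tensorMap_tensorMap {V V' V'' W W' W'' : Hilb.{w}} (f : V →ₗ[ℂ] V') (f' : V' →ₗ[ℂ] V'')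
    (g : W →ₗ[ℂ] W') (g' : W' →ₗ[ℂ] W'') (a : tensor V W) :
    tensorMap f' g' (tensorMap f g a) = tensorMap (f' ∘ₗ f) (g' ∘ₗ g) a :=
  (LinearMap.congr_fun (tensorMap_comp f f' g g') a).symm
theorem tensorMap_smul_left {V V' W W' : Hilb.{w}} (c : ℂ) (f : V →ₗ[ℂ] V') (g : W →ₗ[ℂ] W') :
    tensorMap (c • f) g = c • tensorMap f g :=
  TensorProduct.map_smul_left c f g
theorem tensorMap_smul_right {V V' W W' : Hilb.{w}} (c : ℂ) (f : V →ₗ[ℂ] V') (g : W →ₗ[ℂ] W') :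
    tensorMap f (c • g) = c • tensorMap f g :=
  TensorProduct.map_smul_right c f g

theorem inner_tensorMap {V V' W W' : Hilb.{w}} (f : V →ₗ[ℂ] V') (g : W →ₗ[ℂ] W')
    (hf : ∀ a b, V'.inner (f a) (f b) = V.inner a b)
    (hg : ∀ a b, W'.inner (g a) (g b) = W.inner a b) (a b : tensor V W) :
    (tensor V' W').inner (tensorMap f g a) (tensorMap f g b) = (tensor V W).inner a b := by
  refine tensor_induction (p := fun a => (tensor V' W').inner (tensorMap f g a) (tensorMap f g b) =
      (tensor V W).inner a b) ?_ (fun x y => ?_) (fun c d hc hd => ?_) a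
  · rw [map_zero, inner_zero_left, inner_zero_left]
  · refine tensor_induction (p := fun b => (tensor V' W').inner (tensorMap f g (tmul x y))
        (tensorMap f g b) = (tensor V W).inner (tmul x y) b) ?_ (fun x' y' => ?_)
        (fun c d hc hd => ?_) b
    · rw [map_zero, inner_zero_right, inner_zero_right]
    · rw [tensorMap_tmul, tensorMap_tmul, inner_tmul, inner_tmul, hf, hg]
    · rw [map_add, inner_add_right, inner_add_right, hc, hd]
  · rw [map_add, inner_add_left, inner_add_left, hc, hd]

theorem tensorMap_bijective {V V' W W' : Hilb.{w}} {f : V →ₗ[ℂ] V'} {g : W →ₗ[ℂ] W'}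
    (hf : Function.Bijective f) (hg : Function.Bijective g) :
    Function.Bijective (tensorMap f g) :=
  (TensorProduct.congr (LinearEquiv.ofBijective f hf) (LinearEquiv.ofBijective g hg)).bijective

/-- Contraction of the first factor against a functional. -/
def contractLeft {V : Hilb.{w}} (W : Hilb.{w}) (ev : V →ₗ[ℂ] ℂ) : tensor V W →ₗ[ℂ] W :=
  ((TensorProduct.lid ℂ W).toLinearMap ∘ₗ TensorProduct.map ev LinearMap.id : V ⊗[ℂ] W →ₗ[ℂ] W)
/-- Contraction of the second factor against a functional. -/
def contractRight (V : Hilb.{w}) {W : Hilb.{w}} (ev : W →ₗ[ℂ] ℂ) : tensor V W →ₗ[ℂ] V :=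
  ((TensorProduct.rid ℂ V).toLinearMap ∘ₗ TensorProduct.map LinearMap.id ev : V ⊗[ℂ] W →ₗ[ℂ] V)

theorem contractLeft_bijective {V : Hilb.{w}} (W : Hilb.{w}) {ev : V →ₗ[ℂ] ℂ}
    (h : Function.Bijective ev) : Function.Bijective (contractLeft W ev) :=
  (TensorProduct.lid ℂ W).bijective.comp
    (TensorProduct.congr (LinearEquiv.ofBijective ev h) (LinearEquiv.refl ℂ W)).bijective
theorem contractRight_bijective (V : Hilb.{w}) {W : Hilb.{w}} {ev : W →ₗ[ℂ] ℂ}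
    (h : Function.Bijective ev) : Function.Bijective (contractRight V ev) :=
  (TensorProduct.rid ℂ V).bijective.comp
    (TensorProduct.congr (LinearEquiv.refl ℂ V) (LinearEquiv.ofBijective ev h)).bijective
theorem contractLeft_tensorMap {V V' W W' : Hilb.{w}} {ev : V →ₗ[ℂ] ℂ} {ev' : V' →ₗ[ℂ] ℂ}
    {f : V →ₗ[ℂ] V'} (g : W →ₗ[ℂ] W') (h : ∀ a, ev' (f a) = ev a) (a : tensor V W) :
    contractLeft W' ev' (tensorMap f g a) = g (contractLeft W ev a) := by
  refine LinearMap.congr_fun (f := contractLeft W' ev' ∘ₗ tensorMap f g)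
    (g := g ∘ₗ contractLeft W ev) (tensor_ext fun b c => ?_) a
  change ev' (f b) • g c = g (ev b • c)
  rw [h, map_smul]
theorem contractRight_tensorMap {V V' W W' : Hilb.{w}} {ev : W →ₗ[ℂ] ℂ} {ev' : W' →ₗ[ℂ] ℂ}
    (f : V →ₗ[ℂ] V') {g : W →ₗ[ℂ] W'} (h : ∀ a, ev' (g a) = ev a) (a : tensor V W) :
    contractRight V' ev' (tensorMap f g a) = f (contractRight V ev a) := by
  refine LinearMap.congr_fun (f := contractRight V' ev' ∘ₗ tensorMap f g)
    (g := f ∘ₗ contractRight V ev) (tensor_ext fun b c => ?_) a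
  change ev' (g c) • f b = f (ev c • b)
  rw [h, map_smul]

section
variable {ι : Type w} [Fintype ι] (k : ι → ℝ) (hk : ∀ i, 0 < k i) (V : ι → Hilb.{w})

/-- The components of a weighted direct sum. -/
def proj (i : ι) : weightedSum k hk V →ₗ[ℂ] V i := LinearMap.proj (φ := fun i => V i) i

theorem proj_bijective (i : ι) (h : ∀ j, j ≠ i → Subsingleton (V j)) :
    Function.Bijective (proj k hk V i) := by
  classical
  refine ⟨fun a b hab => funext fun j => ?_, fun a => ⟨Pi.single (M := fun i => V i) i a, ?_⟩⟩
  · by_cases hj : j = i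
    · subst hj; exact hab
    · exact (h j hj).elim _ _
  · exact Pi.single_eq_same (M := fun i => V i) i a

theorem distribRight_bijective (W : Hilb.{w}) :
    Function.Bijective fun (a : tensor W (weightedSum k hk V)) (i : ι) =>
      tensorMap (LinearMap.id : W →ₗ[ℂ] W) (proj k hk V i) a := by
  classical
  have h : (fun (a : tensor W (weightedSum k hk V)) (i : ι) =>
      tensorMap (LinearMap.id : W →ₗ[ℂ] W) (proj k hk V i) a) =
      (TensorProduct.piRight ℂ ℂ W fun i => V i) := by
    refine funext fun a => ?_
    refine LinearMap.congr_fun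
      (f := LinearMap.pi fun i => tensorMap (LinearMap.id : W →ₗ[ℂ] W) (proj k hk V i))
      (g := ((TensorProduct.piRight ℂ ℂ W fun i => V i).toLinearMap :
        W ⊗[ℂ] (∀ i, V i) →ₗ[ℂ] ∀ i, W ⊗[ℂ] V i)) (tensor_ext fun b c => ?_) a
    rfl
  rw [h]
  exact (TensorProduct.piRight ℂ ℂ W fun i => V i).bijective

theorem distribLeft_bijective (W : Hilb.{w}) :
    Function.Bijective fun (a : tensor (weightedSum k hk V) W) (i : ι) =>
      tensorMap (proj k hk V i) (LinearMap.id : W →ₗ[ℂ] W) a := by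
  have h1 := distribRight_bijective k hk V W
  have h2 := (TensorProduct.comm ℂ (weightedSum k hk V) W).bijective
  have h3 : Function.Bijective fun (a : ∀ i, tensor W (V i)) (i : ι) =>
      ((TensorProduct.comm ℂ W (V i)) (a i) : tensor (V i) W) :=
    Function.bijective_iff_has_inverse.2
      ⟨fun a i => (TensorProduct.comm ℂ (V i) W) (a i),
        fun a => funext fun i => TensorProduct.comm_comm ℂ (V i) W (a i),
        fun a => funext fun i => TensorProduct.comm_comm ℂ W (V i) (a i)⟩
  have h4 := (h3.comp h1).comp h2
  refine (congrArg Function.Bijective ?_).mp h4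
  refine funext fun a => funext fun i => ?_
  refine LinearMap.congr_fun
    (f := tensorMap (proj k hk V i) (LinearMap.id : W →ₗ[ℂ] W))
    (g := (TensorProduct.comm ℂ W (V i)).toLinearMap ∘ₗ
      (tensorMap (LinearMap.id : W →ₗ[ℂ] W) (proj k hk V i) :
        W ⊗[ℂ] (weightedSum k hk V) →ₗ[ℂ] W ⊗[ℂ] (V i)) ∘ₗ
      (TensorProduct.comm ℂ (weightedSum k hk V) W).toLinearMap) (tensor_ext fun b c => rfl) a |>.symm

end

/-- The associator of the tensor product of Hilbert spaces. -/
def assoc (U V W : Hilb.{w}) : tensor (tensor U V) W →ₗ[ℂ] tensor U (tensor V W) :=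
  ((TensorProduct.assoc ℂ U V W).toLinearMap : (U ⊗[ℂ] V) ⊗[ℂ] W →ₗ[ℂ] U ⊗[ℂ] (V ⊗[ℂ] W))

theorem assoc_bijective (U V W : Hilb.{w}) : Function.Bijective (assoc U V W) :=
  (TensorProduct.assoc ℂ U V W).bijective

theorem assoc_tensorMap {U V W U' V' W' : Hilb.{w}} (f : U →ₗ[ℂ] U') (g : V →ₗ[ℂ] V')
    (h : W →ₗ[ℂ] W') (a : tensor (tensor U V) W) :
    assoc U' V' W' (tensorMap (tensorMap f g) h a) =
      tensorMap f (tensorMap g h) (assoc U V W a) := by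
  refine LinearMap.congr_fun (f := assoc U' V' W' ∘ₗ tensorMap (tensorMap f g) h)
    (g := tensorMap f (tensorMap g h) ∘ₗ assoc U V W) ?_ a
  exact TensorProduct.ext_threefold fun _ _ _ => rfl

/-- The complex numbers, with `(a, b) = ā b`. -/
def line : Hilb.{w} where
  carrier := ULift.{w} ℂ
  core :=
    { inner := fun x y => conj x.down * y.down
      conj_inner_symm := fun x y => by simp [mul_comm]
      re_inner_nonneg := fun x => by
        rw [mul_comm, Complex.mul_conj]
        simpa using Complex.normSq_nonneg _
      add_left := fun x y z => by simp [add_mul]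
      smul_left := fun x y c => by simp [mul_assoc]
      definite := fun x h => ULift.ext _ _ (by simpa using h) }

theorem line_inner (a b : ULift.{w} ℂ) : line.{w}.inner a b = conj a.down * b.down := rfl

end Hilb

namespace Kernel
variable {G : Type v} [Group G] {𝒳 𝒴 𝒵 𝒲 : Gerbe.{v} G}

theorem act_bijective (E : Kernel 𝒳 𝒴) {y y' : 𝒴.X} {x x' : 𝒳.X} (v : y ⟶ y') (u : x ⟶ x')
    (h : 𝒴.deg v = 𝒳.deg u) : Function.Bijective (E.act v u h) :=
  (E.unitary (arrow v u h)).1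

section conv
variable (E : Kernel 𝒳 𝒴) (F : Kernel 𝒴 𝒵)

/-- The map `F (w ⊗ v̄) ⊗ E (v ⊗ ū)`. -/
def pairAct {z z' : 𝒵.X} {y y' : 𝒴.X} {x x' : 𝒳.X} (w : z ⟶ z') (v : y ⟶ y') (u : x ⟶ x')
    (h : 𝒵.deg w = 𝒴.deg v) (h' : 𝒴.deg v = 𝒳.deg u) :
    Hilb.tensor (F.fib z y) (E.fib y x) →ₗ[ℂ] Hilb.tensor (F.fib z' y') (E.fib y' x') :=
  Hilb.tensorMap (F.act w v h) (E.act v u h')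

theorem pairAct_indep {z z' : 𝒵.X} {y y' : 𝒴.X} {x x' : 𝒳.X} (w : z ⟶ z') (v v' : y ⟶ y')
    (u : x ⟶ x') (h : 𝒵.deg w = 𝒴.deg v) (h' : 𝒴.deg v = 𝒳.deg u) (k : 𝒵.deg w = 𝒴.deg v')
    (k' : 𝒴.deg v' = 𝒳.deg u) : pairAct E F w v' u k k' = pairAct E F w v u h h' := by
  obtain ⟨t, rfl⟩ := Gerbe.exists_sc v v' (h.symm.trans k)
  unfold pairAct
  rw [F.act_sc_right t w v h k, E.act_sc_left t v u h' k', Hilb.tensorMap_smul_left,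
    Hilb.tensorMap_smul_right, smul_smul, ← Circle.coe_mul, inv_mul_cancel, Circle.coe_one, one_smul]

/-- The fibres `⊕_y (1 / k y) ⟨z | F | y⟩ ⊗ ⟨y | E | x⟩` of the convolution. -/
def convFib (z : 𝒵.X) (x : 𝒳.X) : Hilb.{v} :=
  Hilb.weightedSum (fun y => (𝒴.k y)⁻¹) (fun y => inv_pos.2 (𝒴.k_pos y))
    (fun y => Hilb.tensor (F.fib z y) (E.fib y x))

/-- A chosen arrow of degree `g` into `y`. -/
def chosen (g : G) (y : 𝒴.X) : g⁻¹ • y ⟶ y := (Gerbe.exists_to g y).choose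

theorem deg_chosen (g : G) (y : 𝒴.X) : 𝒴.deg (chosen g y) = g := (Gerbe.exists_to g y).choose_spec

/-- The action of `w ⊗ ū` on the fibres of the convolution: the sum of the maps
`F (w ⊗ v̄) ⊗ E (v ⊗ ū)`, which do not depend on the choice of the arrows `v`. -/
def convAct {z z' : 𝒵.X} {x x' : 𝒳.X} (w : z ⟶ z') (u : x ⟶ x') (h : 𝒵.deg w = 𝒳.deg u) :
    convFib E F z x →ₗ[ℂ] convFib E F z' x' :=
  LinearMap.pi (φ := fun y => Hilb.tensor (F.fib z' y) (E.fib y x')) fun y =>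
    pairAct E F w (chosen (𝒵.deg w) y) u (deg_chosen _ _).symm ((deg_chosen _ _).trans h) ∘ₗ
      Hilb.proj _ _ (fun y => Hilb.tensor (F.fib z y) (E.fib y x)) ((𝒵.deg w)⁻¹ • y)

/-- The `y`-component of an element of a fibre of the convolution. -/
def convProj {z : 𝒵.X} {x : 𝒳.X} (y : 𝒴.X) :
    convFib E F z x →ₗ[ℂ] Hilb.tensor (F.fib z y) (E.fib y x) :=
  Hilb.proj _ _ (fun y => Hilb.tensor (F.fib z y) (E.fib y x)) y

theorem conv_ext {z : 𝒵.X} {x : 𝒳.X} {a b : convFib E F z x}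
    (h : ∀ y, convProj E F y a = convProj E F y b) : a = b := funext h

theorem convAct_apply {z z' : 𝒵.X} {y y' : 𝒴.X} {x x' : 𝒳.X} (w : z ⟶ z') (v : y ⟶ y')
    (u : x ⟶ x') (h : 𝒵.deg w = 𝒳.deg u) (h1 : 𝒵.deg w = 𝒴.deg v) (h2 : 𝒴.deg v = 𝒳.deg u)
    (a : convFib E F z x) :
    convProj E F y' (convAct E F w u h a) = pairAct E F w v u h1 h2 (convProj E F y a) := by
  obtain rfl : y = (𝒵.deg w)⁻¹ • y' := by rw [eq_inv_smul_iff, h1, 𝒴.deg_smul]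
  rw [pairAct_indep E F w (chosen (𝒵.deg w) y') v u (deg_chosen _ _).symm
    ((deg_chosen _ _).trans h) h1 h2]
  rfl

theorem pairAct_id (z : 𝒵.X) (y : 𝒴.X) (x : 𝒳.X) (h : 𝒵.deg (𝟙 z) = 𝒴.deg (𝟙 y))
    (h' : 𝒴.deg (𝟙 y) = 𝒳.deg (𝟙 x)) : pairAct E F (𝟙 z) (𝟙 y) (𝟙 x) h h' = LinearMap.id := by
  unfold pairAct
  rw [act_id, act_id, Hilb.tensorMap_id]

/-- The fibres and maps of the convolution `F ∘ E`. -/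
def convData : Data 𝒳 𝒵 where
  fib := convFib E F
  act w u h := convAct E F w u h
  act_id z x h := by
    refine LinearMap.ext fun a => conv_ext E F fun y => ?_
    rw [convAct_apply E F (𝟙 z) (𝟙 y) (𝟙 x) h (by rw [𝒵.deg_id, 𝒴.deg_id])
      (by rw [𝒴.deg_id, 𝒳.deg_id]), pairAct_id]
    rfl
  act_comp {z z' z'' x x' x''} w u h w' u' h' h'' := by
    refine LinearMap.ext fun a => conv_ext E F fun y => ?_
    obtain ⟨y', v', hv'⟩ : ∃ (y' : 𝒴.X) (v' : y' ⟶ y), 𝒴.deg v' = 𝒵.deg w' :=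
      ⟨_, _, deg_chosen (𝒵.deg w') y⟩
    obtain ⟨y'', v, hv⟩ : ∃ (y'' : 𝒴.X) (v : y'' ⟶ y'), 𝒴.deg v = 𝒵.deg w :=
      ⟨_, _, deg_chosen (𝒵.deg w) y'⟩
    rw [convAct_apply E F (w ≫ w') (v ≫ v') (u ≫ u') h''
      (by rw [𝒵.deg_comp, 𝒴.deg_comp, hv, hv']) (by rw [𝒳.deg_comp, 𝒴.deg_comp, hv, hv', h, h']),
      LinearMap.comp_apply, convAct_apply E F w' v' u' h' hv'.symm (hv'.trans h'),
      convAct_apply E F w v u h hv.symm (hv.trans h)]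
    unfold pairAct
    rw [F.act_comp w v hv.symm w' v' hv'.symm, E.act_comp v u (hv.trans h) v' u' (hv'.trans h'),
      Hilb.tensorMap_comp]
    rfl
  act_sc_left {z z' x x'} t w u h h' := by
    refine LinearMap.ext fun a => conv_ext E F fun y => ?_
    obtain ⟨y', v, hv⟩ : ∃ (y' : 𝒴.X) (v : y' ⟶ y), 𝒴.deg v = 𝒵.deg w :=
      ⟨_, _, deg_chosen (𝒵.deg w) y⟩
    rw [LinearMap.smul_apply, map_smul, convAct_apply E F _ v u h' (by rw [Gerbe.deg_sc, hv])
      (hv.trans h), convAct_apply E F w v u h hv.symm (hv.trans h)]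
    unfold pairAct
    rw [F.act_sc_left t w v hv.symm, Hilb.tensorMap_smul_left, LinearMap.smul_apply]
  act_sc_right {z z' x x'} t w u h h' := by
    refine LinearMap.ext fun a => conv_ext E F fun y => ?_
    obtain ⟨y', v, hv⟩ : ∃ (y' : 𝒴.X) (v : y' ⟶ y), 𝒴.deg v = 𝒵.deg w :=
      ⟨_, _, deg_chosen (𝒵.deg w) y⟩
    rw [LinearMap.smul_apply, map_smul, convAct_apply E F _ v _ h' hv.symm (hv.trans h'),
      convAct_apply E F w v u h hv.symm (hv.trans h)]
    unfold pairAct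
    rw [E.act_sc_right t v u (hv.trans h), Hilb.tensorMap_smul_right, LinearMap.smul_apply]
  act_inner {z z' x x'} w u h a b := by
    refine Fintype.sum_equiv (MulAction.toPerm (𝒵.deg w)⁻¹) _ _ fun y => ?_
    change _ = (((𝒴.k ((𝒵.deg w)⁻¹ • y))⁻¹ : ℝ) : ℂ) * _
    rw [𝒴.k_smul]
    congr 1
    exact Hilb.inner_tensorMap _ _ (F.act_inner _ _ _) (E.act_inner _ _ _) _ _

/-- The composite `F ∘ E` of morphisms of gerbes, given by convolution. -/
def comp : Kernel 𝒳 𝒵 := (convData E F).toKernel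

end conv

section id

/-- For arrows `v, u` of a gerbe which agree up to a phase, the phase `v / u`. -/
def ratio {y y' x x' : 𝒳.X} (v : y ⟶ y') (u : x ⟶ x') : Circle :=
  Classical.epsilon fun z => ∃ (h : y = x) (h' : y' = x'),
    v = eqToHom h ≫ 𝒳.sc z u ≫ eqToHom h'.symm

theorem ratio_sc {x x' : 𝒳.X} (z : Circle) (u : x ⟶ x') : ratio (𝒳.sc z u) u = z := by
  have h : ∃ z', ∃ (h : x = x) (h' : x' = x'),
      𝒳.sc z u = eqToHom h ≫ 𝒳.sc z' u ≫ eqToHom h'.symm := ⟨z, rfl, rfl, by simp⟩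
  obtain ⟨h1, h2, h3⟩ := Classical.epsilon_spec h
  have h4 : 𝒳.sc z u = 𝒳.sc (ratio (𝒳.sc z u) u) u := by simpa [ratio] using h3
  exact (Gerbe.sc_injective u h4).symm

theorem ratio_self {x x' : 𝒳.X} (u : x ⟶ x') : ratio u u = 1 := by
  have h := ratio_sc 1 u
  rwa [Gerbe.sc_one] at h

/-- Proofs of an equality, as a type. -/
structure EqType (y x : 𝒳.X) : Type v where
  eq : y = x

instance (y x : 𝒳.X) : Subsingleton (EqType y x) := ⟨fun ⟨_⟩ ⟨_⟩ => rfl⟩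

instance (y x : 𝒳.X) : Fintype (EqType y x) := Fintype.ofFinite _

variable (𝒳)

/-- The fibres `δ_{y x} k_x ℂ` of the identity: the weighted sum of `k_x ℂ` over the proofs
of `y = x`. -/
def idFib (y x : 𝒳.X) : Hilb.{v} :=
  Hilb.weightedSum (fun _ : EqType y x => 𝒳.k x) (fun _ => 𝒳.k_pos x) (fun _ => Hilb.line)

variable {𝒳}

/-- The coordinate on the fibre of the identity at `(y, x)`, where `y = x`. -/
def idEv {y x : 𝒳.X} (h : y = x) : idFib 𝒳 y x →ₗ[ℂ] Hilb.line.{v} :=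
  Hilb.proj (fun _ : EqType y x => 𝒳.k x) (fun _ => 𝒳.k_pos x) (fun _ => Hilb.line) ⟨h⟩

/-- The action of `v ⊗ ū` on the fibres of the identity: multiplication by the phase `v / u`. -/
def idAct {y y' x x' : 𝒳.X} (v : y ⟶ y') (u : x ⟶ x') (h : 𝒳.deg v = 𝒳.deg u) :
    idFib 𝒳 y x →ₗ[ℂ] idFib 𝒳 y' x' :=
  LinearMap.pi (φ := fun _ : EqType y' x' => (Hilb.line : Hilb.{v})) fun i =>
    (ratio v u : ℂ) • idEv (Gerbe.target_unique v u h i.eq)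

theorem idFib_ext {y x : 𝒳.X} {a b : idFib 𝒳 y x} (h : ∀ e : y = x, idEv e a = idEv e b) : a = b :=
  funext fun i => h i.eq

theorem idEv_idAct {x x' : 𝒳.X} (z : Circle) (u : x ⟶ x')
    (h : 𝒳.deg (𝒳.sc z u) = 𝒳.deg u) (a : idFib 𝒳 x x) :
    idEv rfl (idAct (𝒳.sc z u) u h a) = (z : ℂ) • idEv rfl a := by
  have e : ((ratio (𝒳.sc z u) u : Circle) : ℂ) = z := by rw [ratio_sc]
  rw [← e]
  rfl

theorem idFib_inner {x : 𝒳.X} (a b : idFib 𝒳 x x) :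
    (idFib 𝒳 x x).inner a b = (𝒳.k x : ℂ) * Hilb.line.inner (idEv rfl a) (idEv rfl b) := by
  have : Unique (EqType x x) := ⟨⟨⟨rfl⟩⟩, fun _ => Subsingleton.elim _ _⟩
  exact Fintype.sum_unique _

theorem idAct_congr {y y' x x' : 𝒳.X} {v v' : y ⟶ y'} {u : x ⟶ x'} (e : v = v')
    (h : 𝒳.deg v = 𝒳.deg u) (h' : 𝒳.deg v' = 𝒳.deg u) : idAct v u h = idAct v' u h' := by
  subst e; rfl

variable (𝒳)

/-- The fibres and maps of the identity morphism. -/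
def idData : Data 𝒳 𝒳 where
  fib := idFib 𝒳
  act v u h := idAct v u h
  act_id y x h := by
    refine LinearMap.ext fun a => idFib_ext fun e => ?_
    subst e
    rw [idAct_congr (Gerbe.sc_one (𝟙 y)).symm h (Gerbe.deg_sc _ _), idEv_idAct, Circle.coe_one,
      one_smul, LinearMap.id_apply]
  act_comp {y y' y'' x x' x''} v u h v' u' h' h'' := by
    refine LinearMap.ext fun a => idFib_ext fun e => ?_
    subst e
    obtain rfl := Gerbe.target_unique v' u' h' rfl
    obtain rfl := Gerbe.target_unique v u h rfl
    obtain ⟨z, rfl⟩ := Gerbe.exists_sc u v h.symm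
    obtain ⟨z', rfl⟩ := Gerbe.exists_sc u' v' h'.symm
    have h1 : 𝒳.sc z u ≫ 𝒳.sc z' u' = 𝒳.sc (z' * z) (u ≫ u') := by
      rw [Gerbe.comp_sc, Gerbe.sc_comp, Gerbe.sc_sc]
    rw [idAct_congr h1 h'' (Gerbe.deg_sc _ _), idEv_idAct, LinearMap.comp_apply, idEv_idAct,
      idEv_idAct, smul_smul, Circle.coe_mul]
  act_sc_left {y y' x x'} t v u h h' := by
    refine LinearMap.ext fun a => idFib_ext fun e => ?_
    subst e
    obtain rfl := Gerbe.target_unique v u h rfl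
    obtain ⟨z, rfl⟩ := Gerbe.exists_sc u v h.symm
    rw [idAct_congr (Gerbe.sc_sc t z u) h' (Gerbe.deg_sc _ _), idEv_idAct, LinearMap.smul_apply,
      map_smul, idEv_idAct, smul_smul, Circle.coe_mul]
  act_sc_right {y y' x x'} t v u h h' := by
    refine LinearMap.ext fun a => idFib_ext fun e => ?_
    subst e
    obtain rfl := Gerbe.target_unique v u h rfl
    obtain ⟨z, rfl⟩ := Gerbe.exists_sc u v h.symm
    have h1 : 𝒳.sc z u = 𝒳.sc (t⁻¹ * z) (𝒳.sc t u) := by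
      rw [Gerbe.sc_sc, mul_comm t⁻¹, inv_mul_cancel_right]
    rw [idAct_congr h1 h' (Gerbe.deg_sc _ _), idEv_idAct, LinearMap.smul_apply,
      map_smul, idEv_idAct, smul_smul, Circle.coe_mul]
  act_inner {y y' x x'} v u h a b := by
    by_cases hyx : y' = x'
    · subst hyx
      obtain rfl := Gerbe.target_unique v u h rfl
      obtain ⟨z, rfl⟩ := Gerbe.exists_sc u v h.symm
      have hk : 𝒳.k y' = 𝒳.k y := by
        have := 𝒳.k_smul (𝒳.deg u) y
        rwa [𝒳.deg_smul] at this
      rw [idFib_inner, idFib_inner, idEv_idAct, idEv_idAct, hk, Hilb.inner_smul_left,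
        Hilb.inner_smul_right, ← mul_assoc (conj _), ← Complex.normSq_eq_conj_mul_self,
        Circle.normSq_coe]
      simp
    · have h1 : IsEmpty (EqType y' x') := ⟨fun i => hyx i.eq⟩
      have h2 : IsEmpty (EqType y x) := ⟨fun i => hyx (by
        rw [← 𝒳.deg_smul v, ← 𝒳.deg_smul u, h, i.eq])⟩
      exact (Fintype.sum_empty _).trans (Fintype.sum_empty _).symm

/-- The identity morphism of a gerbe. -/
def id : Kernel 𝒳 𝒳 := (idData 𝒳).toKernel

end id
end Kernel

namespace Kernel
variable {G : Type v} [Group G] {𝒳 𝒴 𝒵 𝒲 : Gerbe.{v} G}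

/-- The `y`-component of an element of a fibre of the composite. -/
def compProj (E : Kernel 𝒳 𝒴) (F : Kernel 𝒴 𝒵) {z : 𝒵.X} {x : 𝒳.X} (y : 𝒴.X) :
    (comp E F).fib z x →ₗ[ℂ] Hilb.tensor (F.fib z y) (E.fib y x) := convProj E F y

theorem comp_ext (E : Kernel 𝒳 𝒴) (F : Kernel 𝒴 𝒵) {z : 𝒵.X} {x : 𝒳.X} {a b : (comp E F).fib z x}
    (h : ∀ y, compProj E F y a = compProj E F y b) : a = b := funext h

theorem comp_act_apply (E : Kernel 𝒳 𝒴) (F : Kernel 𝒴 𝒵) {z z' : 𝒵.X} {y y' : 𝒴.X} {x x' : 𝒳.X}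
    (w : z ⟶ z') (v : y ⟶ y') (u : x ⟶ x') (h : 𝒵.deg w = 𝒳.deg u) (h1 : 𝒵.deg w = 𝒴.deg v)
    (h2 : 𝒴.deg v = 𝒳.deg u) (a : (comp E F).fib z x) :
    compProj E F y' ((comp E F).act w u h a) = pairAct E F w v u h1 h2 (compProj E F y a) :=
  convAct_apply E F w v u h h1 h2 a

theorem comp_congr {E E' : Kernel 𝒳 𝒴} {F F' : Kernel 𝒴 𝒵} (hE : Iso E E') (hF : Iso F F') :
    Iso (comp E F) (comp E' F') := by
  obtain ⟨θ, hθ, nθ⟩ := hE.maps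
  obtain ⟨η, hη, nη⟩ := hF.maps
  obtain ⟨Θ, hΘ⟩ : ∃ Θ : ∀ z x, (comp E F).fib z x →ₗ[ℂ] (comp E' F').fib z x,
      ∀ z x y a, compProj E' F' y (Θ z x a) =
        Hilb.tensorMap (η z y) (θ y x) (compProj E F y a) :=
    ⟨fun z x => LinearMap.pi (φ := fun y => Hilb.tensor (F'.fib z y) (E'.fib y x)) fun y =>
      Hilb.tensorMap (η z y) (θ y x) ∘ₗ compProj E F y, fun _ _ _ _ => rfl⟩
  refine iso_of_maps Θ (fun z x => ?_) fun {z z' x x'} w u h a => ?_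
  · have hb := fun y => Hilb.tensorMap_bijective (hη z y) (hθ y x)
    refine ⟨fun a b hab => comp_ext E F fun y => (hb y).1 ?_, fun b => ?_⟩
    · rw [← hΘ, ← hΘ, hab]
    · choose a ha using fun y => (hb y).2 (compProj E' F' y b)
      exact ⟨a, comp_ext E' F' fun y => (hΘ z x y a).trans (ha y)⟩
  · refine comp_ext E' F' fun y => ?_
    obtain ⟨y', v, hv⟩ : ∃ (y' : 𝒴.X) (v : y' ⟶ y), 𝒴.deg v = 𝒵.deg w :=
      ⟨_, _, deg_chosen (𝒵.deg w) y⟩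
    rw [hΘ, comp_act_apply E F w v u h hv.symm (hv.trans h),
      comp_act_apply E' F' w v u h hv.symm (hv.trans h), hΘ]
    unfold pairAct
    rw [Hilb.tensorMap_tensorMap, Hilb.tensorMap_tensorMap]
    congr 2
    · exact LinearMap.ext fun c => nη _ _ _ c
    · exact LinearMap.ext fun c => nθ _ _ _ c

theorem idEv_bijective {y x : 𝒳.X} (h : y = x) : Function.Bijective (idEv h) :=
  Hilb.proj_bijective _ _ _ _ fun j hj => (hj (Subsingleton.elim _ _)).elim

/-- The coordinate of the line. -/
def lineDown : Hilb.line.{v} →ₗ[ℂ] ℂ := ULift.moduleEquiv.toLinearMap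

theorem lineDown_bijective : Function.Bijective lineDown.{v} := ULift.moduleEquiv.bijective

theorem idFib_subsingleton {y x : 𝒳.X} (h : y ≠ x) : Subsingleton (idFib 𝒳 y x) :=
  ⟨fun _ _ => idFib_ext fun e => (h e).elim⟩

theorem tensor_subsingleton_left {V W : Hilb.{w}} (h : Subsingleton V) :
    Subsingleton (Hilb.tensor V W) := inferInstanceAs (Subsingleton (V ⊗[ℂ] W))
theorem tensor_subsingleton_right {V W : Hilb.{w}} (h : Subsingleton W) :
    Subsingleton (Hilb.tensor V W) := inferInstanceAs (Subsingleton (V ⊗[ℂ] W))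

theorem idEv_idAct_self {x x' : 𝒳.X} (u : x ⟶ x') (h : 𝒳.deg u = 𝒳.deg u) (a : idFib 𝒳 x x) :
    idEv rfl (idAct u u h a) = idEv rfl a := by
  rw [idAct_congr (Gerbe.sc_one u).symm h (Gerbe.deg_sc _ _), idEv_idAct, Circle.coe_one, one_smul]

/-- The coordinate on a diagonal fibre of the identity. -/
def idCoord (x : 𝒳.X) : (id 𝒳).fib x x →ₗ[ℂ] ℂ :=
  (lineDown ∘ₗ idEv rfl : idFib 𝒳 x x →ₗ[ℂ] ℂ)

theorem idCoord_bijective (x : 𝒳.X) : Function.Bijective (idCoord x) :=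
  lineDown_bijective.comp (idEv_bijective (rfl : x = x))

theorem idCoord_act {x x' : 𝒳.X} (u : x ⟶ x') (a : (id 𝒳).fib x x) :
    idCoord x' ((id 𝒳).act u u rfl a) = idCoord x a :=
  congrArg lineDown (idEv_idAct_self u rfl a)

theorem id_comp_iso (E : Kernel 𝒳 𝒴) : Iso (comp (id 𝒳) E) E := by
  refine iso_of_maps (fun y x => Hilb.contractRight (E.fib y x) (idCoord x) ∘ₗ
    compProj (id 𝒳) E x) (fun y x => ?_) fun {y y' x x'} v u h a => ?_
  · refine (Hilb.contractRight_bijective _ (idCoord_bijective x)).comp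
      (Hilb.proj_bijective _ (fun x => inv_pos.2 (𝒳.k_pos x)) (fun x' => Hilb.tensor (E.fib y x') (idFib 𝒳 x' x)) x fun j hj => ?_)
    exact tensor_subsingleton_right (idFib_subsingleton hj)
  · rw [LinearMap.comp_apply, comp_act_apply (id 𝒳) E v u u h h rfl, LinearMap.comp_apply]
    exact Hilb.contractRight_tensorMap _ (idCoord_act u) _

theorem comp_id_iso (E : Kernel 𝒳 𝒴) : Iso (comp E (id 𝒴)) E := by
  refine iso_of_maps (fun y x => Hilb.contractLeft (E.fib y x) (idCoord y) ∘ₗ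
    compProj E (id 𝒴) y) (fun y x => ?_) fun {y y' x x'} v u h a => ?_
  · refine (Hilb.contractLeft_bijective _ (idCoord_bijective y)).comp
      (Hilb.proj_bijective _ (fun y => inv_pos.2 (𝒴.k_pos y)) (fun y' => Hilb.tensor (idFib 𝒴 y y') (E.fib y' x)) y fun j hj => ?_)
    exact tensor_subsingleton_left (idFib_subsingleton hj.symm)
  · rw [LinearMap.comp_apply, comp_act_apply E (id 𝒴) v v u h rfl h, LinearMap.comp_apply]
    exact Hilb.contractLeft_tensorMap _ (idCoord_act v) _

theorem assoc_iso (E : Kernel 𝒳 𝒴) (F : Kernel 𝒴 𝒵) (K : Kernel 𝒵 𝒲) :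
    Iso (comp E (comp F K)) (comp (comp E F) K) := by
  obtain ⟨A, hA⟩ : ∃ A : ∀ w x, (comp E (comp F K)).fib w x →ₗ[ℂ]
      (∀ z y, Hilb.tensor (K.fib w z) (Hilb.tensor (F.fib z y) (E.fib y x))),
      ∀ w x a z y, A w x a z y = Hilb.assoc _ _ _
        (Hilb.tensorMap (compProj F K z) (LinearMap.id : E.fib y x →ₗ[ℂ] E.fib y x)
          (compProj E (comp F K) y a)) :=
    ⟨fun w x => LinearMap.pi fun z => LinearMap.pi fun y => Hilb.assoc _ _ _ ∘ₗ
      Hilb.tensorMap (compProj F K z) (LinearMap.id : E.fib y x →ₗ[ℂ] E.fib y x) ∘ₗ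
        compProj E (comp F K) y, fun _ _ _ _ _ => rfl⟩
  obtain ⟨B, hB⟩ : ∃ B : ∀ w x, (comp (comp E F) K).fib w x →ₗ[ℂ]
      (∀ z y, Hilb.tensor (K.fib w z) (Hilb.tensor (F.fib z y) (E.fib y x))),
      ∀ w x a z y, B w x a z y =
        Hilb.tensorMap (LinearMap.id : K.fib w z →ₗ[ℂ] K.fib w z) (compProj E F y)
          (compProj (comp E F) K z a) :=
    ⟨fun w x => LinearMap.pi fun z => LinearMap.pi fun y =>
      Hilb.tensorMap (LinearMap.id : K.fib w z →ₗ[ℂ] K.fib w z) (compProj E F y) ∘ₗ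
        compProj (comp E F) K z, fun _ _ _ _ _ => rfl⟩
  have bA : ∀ w x, Function.Bijective (A w x) := by
    intro w x
    have h1 := fun y => Hilb.distribLeft_bijective (fun z => (𝒵.k z)⁻¹)
      (fun z => inv_pos.2 (𝒵.k_pos z)) (fun z => Hilb.tensor (K.fib w z) (F.fib z y)) (E.fib y x)
    have h2 := fun z y => Hilb.assoc_bijective (K.fib w z) (F.fib z y) (E.fib y x)
    refine ⟨fun a b hab => comp_ext E (comp F K) fun y => (h1 y).1 (funext fun z => (h2 z y).1 ?_),
      fun b => ?_⟩
    · exact ((hA w x a z y).symm.trans (congrFun (congrFun hab z) y)).trans (hA w x b z y)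
    · choose c hc using fun z y => (h2 z y).2 (b z y)
      choose a ha using fun y => (h1 y).2 (fun z => c z y)
      refine ⟨a, funext fun z => funext fun y => (hA w x a z y).trans ?_⟩
      exact (congrArg _ (congrFun (ha y) z)).trans (hc z y)
  have bB : ∀ w x, Function.Bijective (B w x) := by
    intro w x
    have h1 := fun z => Hilb.distribRight_bijective (fun y => (𝒴.k y)⁻¹)
      (fun y => inv_pos.2 (𝒴.k_pos y)) (fun y => Hilb.tensor (F.fib z y) (E.fib y x)) (K.fib w z)
    refine ⟨fun a b hab => comp_ext (comp E F) K fun z => (h1 z).1 (funext fun y => ?_),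
      fun b => ?_⟩
    · exact ((hB w x a z y).symm.trans (congrFun (congrFun hab z) y)).trans (hB w x b z y)
    · choose a ha using fun z => (h1 z).2 (b z)
      exact ⟨a, funext fun z => funext fun y => (hB w x a z y).trans (congrFun (ha z) y)⟩
  have nA : ∀ {w w' : 𝒲.X} {z z' : 𝒵.X} {y y' : 𝒴.X} {x x' : 𝒳.X} (s : w ⟶ w') (t : z ⟶ z')
      (v : y ⟶ y') (u : x ⟶ x') (h : 𝒲.deg s = 𝒳.deg u) (h1 : 𝒲.deg s = 𝒵.deg t)
      (h2 : 𝒵.deg t = 𝒴.deg v) (h3 : 𝒴.deg v = 𝒳.deg u) a,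
      A w' x' ((comp E (comp F K)).act s u h a) z' y' =
        Hilb.tensorMap (K.act s t h1) (Hilb.tensorMap (F.act t v h2) (E.act v u h3))
          (A w x a z y) := by
    intro w w' z z' y y' x x' s t v u h h1 h2 h3 a
    rw [hA, hA, comp_act_apply E (comp F K) s v u h (h1.trans h2) h3, ← Hilb.assoc_tensorMap]
    unfold pairAct
    rw [Hilb.tensorMap_tensorMap, Hilb.tensorMap_tensorMap]
    congr 3
    exact LinearMap.ext fun c => comp_act_apply F K s t v (h1.trans h2) h1 h2 c
  have nB : ∀ {w w' : 𝒲.X} {z z' : 𝒵.X} {y y' : 𝒴.X} {x x' : 𝒳.X} (s : w ⟶ w') (t : z ⟶ z')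
      (v : y ⟶ y') (u : x ⟶ x') (h : 𝒲.deg s = 𝒳.deg u) (h1 : 𝒲.deg s = 𝒵.deg t)
      (h2 : 𝒵.deg t = 𝒴.deg v) (h3 : 𝒴.deg v = 𝒳.deg u) a,
      B w' x' ((comp (comp E F) K).act s u h a) z' y' =
        Hilb.tensorMap (K.act s t h1) (Hilb.tensorMap (F.act t v h2) (E.act v u h3))
          (B w x a z y) := by
    intro w w' z z' y y' x x' s t v u h h1 h2 h3 a
    rw [hB, hB, comp_act_apply (comp E F) K s t u h h1 (h2.trans h3)]
    unfold pairAct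
    rw [Hilb.tensorMap_tensorMap, Hilb.tensorMap_tensorMap]
    congr 2
    exact LinearMap.ext fun c => comp_act_apply E F t v u (h2.trans h3) h2 h3 c
  let e := fun w x => LinearEquiv.ofBijective (B w x) (bB w x)
  have he : ∀ w x b, B w x ((e w x).symm b) = b := fun w x b =>
    (LinearEquiv.ofBijective (B w x) (bB w x)).apply_symm_apply b
  refine iso_of_maps (fun w x => (e w x).symm.toLinearMap ∘ₗ A w x)
    (fun w x => (e w x).symm.bijective.comp (bA w x)) fun {w w' x x'} s u h a => ?_
  refine (bB w' x').1 ?_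
  refine (he w' x' _).trans (funext fun z => funext fun y => ?_)
  obtain ⟨y', v, hv⟩ : ∃ (y' : 𝒴.X) (v : y' ⟶ y), 𝒴.deg v = 𝒲.deg s :=
    ⟨_, _, deg_chosen (𝒲.deg s) y⟩
  obtain ⟨z', t, ht⟩ : ∃ (z' : 𝒵.X) (t : z' ⟶ z), 𝒵.deg t = 𝒲.deg s :=
    ⟨_, _, deg_chosen (𝒲.deg s) z⟩
  rw [nB s t v u h ht.symm (ht.trans hv.symm) (hv.trans h),
    nA s t v u h ht.symm (ht.trans hv.symm) (hv.trans h)]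
  exact congrArg _ (congrFun (congrFun (he w x (A w x a)) z') y').symm

end Kernel

namespace Gerbe
variable {G : Type v} [Group G]

instance kernelSetoid (𝒳 𝒴 : Gerbe.{v} G) : Setoid (Kernel 𝒳 𝒴) where
  r := Kernel.Iso
  iseqv := ⟨fun _ => ⟨CategoryTheory.Iso.refl _⟩, fun ⟨e⟩ => ⟨e.symm⟩, fun ⟨e⟩ ⟨f⟩ => ⟨e.trans f⟩⟩

/-- The category of finite equivariant gerbes with metrics and isomorphism classes of morphisms. -/
instance : Category (Gerbe.{v} G) where
  Hom 𝒳 𝒴 := Quotient (kernelSetoid 𝒳 𝒴)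
  id 𝒳 := ⟦Kernel.id 𝒳⟧
  comp := Quotient.map₂ Kernel.comp fun _ _ h _ _ h' => Kernel.comp_congr h h'
  id_comp := by
    rintro 𝒳 𝒴 ⟨E⟩
    exact Quotient.sound (Kernel.id_comp_iso E)
  comp_id := by
    rintro 𝒳 𝒴 ⟨E⟩
    exact Quotient.sound (Kernel.comp_id_iso E)
  assoc := by
    rintro 𝒲 𝒳 𝒴 𝒵 ⟨E⟩ ⟨F⟩ ⟨K⟩
    exact (Quotient.sound (Kernel.assoc_iso E F K)).symm

end Gerbe

/-- The isomorphism class of a morphism of gerbes. -/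
def Kernel.toHom {G : Type v} [Group G] {𝒳 𝒴 : Gerbe.{v} G} (E : Kernel 𝒳 𝒴) : 𝒳 ⟶ 𝒴 :=
  (⟦E⟧ : Quotient (Gerbe.kernelSetoid 𝒳 𝒴))

/-! ## Transgression, push-forward and the geometric character -/

/-- The loop groupoid of the action groupoid of a `G`-set: its objects are the pairs `(x, g)` with
`g x = x`, its morphisms `(x, g) ⟶ (x', g')` are the `h` with `h x = x'` and `h g h⁻¹ = g'`. -/
structure LoopX (G : Type v) [Group G] (X : Type v) [MulAction G X] : Type v where
  pt : X
  elt : G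
  fix : elt • pt = pt

namespace LoopX
variable {G : Type v} [Group G] {X : Type v} [MulAction G X]

/-- Morphisms of the loop groupoid. -/
@[ext] structure Hom (a b : LoopX G X) : Type v where
  elt : G
  smul_eq : elt • a.pt = b.pt
  conj_eq : elt * a.elt * elt⁻¹ = b.elt

instance : Category (LoopX G X) where
  Hom := Hom
  id a := ⟨1, one_smul _ _, by simp⟩
  comp {a b c} h k := ⟨k.elt * h.elt, by rw [mul_smul, h.smul_eq, k.smul_eq], by
    rw [← k.conj_eq, ← h.conj_eq]; group⟩
  id_comp h := Hom.ext (mul_one _)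
  comp_id h := Hom.ext (one_mul _)
  assoc h k l := Hom.ext (mul_assoc _ _ _).symm

@[ext] theorem hom_ext {a b : LoopX G X} {h k : a ⟶ b} (e : h.elt = k.elt) : h = k := Hom.ext e
theorem id_elt (a : LoopX G X) : Hom.elt (𝟙 a) = 1 := rfl
theorem comp_elt {a b c : LoopX G X} (h : a ⟶ b) (k : b ⟶ c) :
    (h ≫ k).elt = k.elt * h.elt := rfl

end LoopX

/-- A `U(1)`-torsor. -/
structure U1Tor : Type (v + 1) where
  carrier : Type v
  [action : MulAction Circle carrier]
  nonempty : Nonempty carrier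
  existsUnique_smul : ∀ p q : carrier, ∃! z : Circle, z • q = p

namespace U1Tor

instance : CoeSort U1Tor.{v} (Type v) := ⟨carrier⟩
instance (P : U1Tor.{v}) : MulAction Circle P := P.action

/-- Morphisms of torsors are equivariant maps. -/
@[ext] structure Hom (P Q : U1Tor.{v}) : Type v where
  toFun : P → Q
  map_smul : ∀ (z : Circle) (p : P), toFun (z • p) = z • toFun p

instance : Category U1Tor.{v} where
  Hom := Hom
  id P := ⟨fun p => p, fun _ _ => rfl⟩
  comp f g := ⟨fun p => g.toFun (f.toFun p), fun z p => by rw [f.map_smul, g.map_smul]⟩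

section
variable (P : U1Tor.{v})

/-- The ratio `p / q` of two elements of a torsor. -/
def div {P : U1Tor.{v}} (p q : P) : Circle := (P.existsUnique_smul p q).choose

theorem div_smul (p q : P) : div p q • q = p := (P.existsUnique_smul p q).choose_spec.1
theorem div_eq {p q : P} {z : Circle} (h : z • q = p) : div p q = z :=
  ((P.existsUnique_smul p q).choose_spec.2 z h).symm
theorem smul_cancel {z z' : Circle} {p : P} (h : z • p = z' • p) : z = z' :=
  (P.existsUnique_smul (z' • p) p).unique h rfl

/-- The complex line `P_ℂ = (P × ℂ) / ((z p, λ) ∼ (p, z λ))` of a torsor, realised as the space of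
functions `f : P → ℂ` with `f (z p) = z⁻¹ f p`: the class of `(p, λ)` is the function whose value
at `p` is `λ`. -/
def lineSpace : Submodule ℂ (P → ℂ) where
  carrier := {f | ∀ (z : Circle) (p : P), f (z • p) = ((z⁻¹ : Circle) : ℂ) * f p}
  add_mem' {f g} hf hg z p := by simp only [Pi.add_apply, hf z p, hg z p, mul_add]
  zero_mem' z p := by simp
  smul_mem' c f hf z p := by
    simp only [Pi.smul_apply, hf z p, smul_eq_mul]
    ring

theorem lineSpace_ext {f f' : P.lineSpace} (p : P) (h : f.1 p = f'.1 p) : f = f' := by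
  refine Subtype.ext (funext fun q => ?_)
  rw [← P.div_smul q p, f.2, f'.2, h]

/-- The element `p ⊗ λ` of the line of a torsor. -/
def tmul (p : P) (c : ℂ) : P.lineSpace :=
  ⟨fun q => (div p q : ℂ) * c, fun z q => by
    have h : div p (z • q) = z⁻¹ * div p q := by
      apply div_eq
      rw [smul_smul, mul_right_comm, inv_mul_cancel, one_mul, div_smul]
    change ((div p (z • q) : Circle) : ℂ) * c = ((z⁻¹ : Circle) : ℂ) * ((div p q : Circle) * c)
    rw [h, Circle.coe_mul, mul_assoc]⟩

theorem tmul_apply (p : P) (c : ℂ) : (P.tmul p c).1 p = c := by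
  have h : div p p = 1 := div_eq P (one_smul _ _)
  simp [tmul, h]

theorem inner_indep (f f' : P.lineSpace) (p q : P) :
    conj (f.1 p) * f'.1 p = conj (f.1 q) * f'.1 q := by
  rw [← P.div_smul p q, f.2, f'.2, map_mul, mul_mul_mul_comm, ← Complex.normSq_eq_conj_mul_self,
    Circle.normSq_coe]
  simp

/-- The hermitian line of a torsor, with `(p ⊗ λ, p' ⊗ λ') = (p' / p) λ̄ λ'`. -/
def line : Hilb.{v} where
  carrier := P.lineSpace
  finite := by
    obtain ⟨p⟩ := P.nonempty
    exact FiniteDimensional.of_injective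
      ((LinearMap.proj p : (P → ℂ) →ₗ[ℂ] ℂ) ∘ₗ P.lineSpace.subtype)
      fun f f' h => lineSpace_ext P p h
  core :=
    { inner := fun f f' => conj (f.1 P.nonempty.some) * f'.1 P.nonempty.some
      conj_inner_symm := fun x y => by simp [mul_comm]
      re_inner_nonneg := fun x => by
        rw [mul_comm, Complex.mul_conj]
        simpa using Complex.normSq_nonneg _
      add_left := fun x y z => by simp [add_mul]
      smul_left := fun x y c => by simp [mul_assoc]
      definite := fun x h => lineSpace_ext P P.nonempty.some (by simpa using h) }

theorem inner_line (f f' : P.lineSpace) (p : P) :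
    P.line.inner f f' = conj (f.1 p) * f'.1 p := inner_indep P f f' _ p

theorem inner_tmul_tmul (p p' : P) (c c' : ℂ) :
    P.line.inner (P.tmul p c) (P.tmul p' c') = (div p' p : ℂ) * (conj c * c') := by
  rw [inner_line P _ _ p, tmul_apply]
  simp only [tmul]
  ring

end

theorem Hom.bijective {P Q : U1Tor.{v}} (f : P ⟶ Q) : Function.Bijective f.toFun := by
  refine ⟨fun p p' h => ?_, fun q => ?_⟩
  · rw [← P.div_smul p p'] at h
    have h1 : div p p' • f.toFun p' = (1 : Circle) • f.toFun p' := by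
      rw [← f.map_smul, h, one_smul]
    rw [← P.div_smul p p', Q.smul_cancel h1, one_smul]
  · obtain ⟨p⟩ := P.nonempty
    exact ⟨div q (f.toFun p) • p, by rw [f.map_smul, div_smul]⟩

/-- A morphism of torsors as a bijection. -/
def Hom.equiv {P Q : U1Tor.{v}} (f : P ⟶ Q) : P ≃ Q := Equiv.ofBijective f.toFun (Hom.bijective f)

theorem Hom.equiv_symm_smul {P Q : U1Tor.{v}} (f : P ⟶ Q) (z : Circle) (q : Q) :
    (Hom.equiv f).symm (z • q) = z • (Hom.equiv f).symm q := by
  rw [Equiv.symm_apply_eq]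
  change z • q = f.toFun _
  rw [f.map_smul]
  exact congrArg _ ((Hom.equiv f).apply_symm_apply q).symm

/-- The linear map `P_ℂ → Q_ℂ`, `p ⊗ λ ↦ f p ⊗ λ`. -/
def lineMap {P Q : U1Tor.{v}} (f : P ⟶ Q) : P.lineSpace →ₗ[ℂ] Q.lineSpace where
  toFun a := ⟨fun q => a.1 ((Hom.equiv f).symm q), fun z q => by
    change a.1 ((Hom.equiv f).symm (z • q)) = ((z⁻¹ : Circle) : ℂ) * a.1 ((Hom.equiv f).symm q)
    rw [Hom.equiv_symm_smul, a.2]⟩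
  map_add' _ _ := rfl
  map_smul' _ _ := rfl

theorem lineMap_apply {P Q : U1Tor.{v}} (f : P ⟶ Q) (a : P.lineSpace) (p : P) :
    (lineMap f a).1 (f.toFun p) = a.1 p :=
  congrArg a.1 ((Hom.equiv f).symm_apply_apply p)

theorem lineMap_tmul {P Q : U1Tor.{v}} (f : P ⟶ Q) (p : P) (c : ℂ) :
    lineMap f (P.tmul p c) = Q.tmul (f.toFun p) c :=
  lineSpace_ext Q (f.toFun p) (by rw [lineMap_apply, tmul_apply, tmul_apply])

/-- The functor `P ↦ P_ℂ`. -/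
def lineFunctor : U1Tor.{v} ⥤ Hilb.{v} where
  obj P := P.line
  map f := ⟨lineMap f⟩
  map_id P := by
    obtain ⟨p⟩ := P.nonempty
    exact Hilb.hom_ext fun a => lineSpace_ext P p (lineMap_apply (𝟙 P) a p)
  map_comp {P Q R} f g := by
    obtain ⟨p⟩ := P.nonempty
    refine Hilb.hom_ext fun a => lineSpace_ext R (g.toFun (f.toFun p)) ?_
    refine (lineMap_apply (f ≫ g) a p).trans ?_
    exact ((lineMap_apply g (lineMap f a) _).trans (lineMap_apply f a p)).symm

theorem isUnitary_lineFunctor {P Q : U1Tor.{v}} (f : P ⟶ Q) :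
    Hilb.IsUnitary (lineFunctor.map f) := by
  obtain ⟨p⟩ := P.nonempty
  refine ⟨⟨fun a b h => lineSpace_ext P p ?_, fun b => ⟨P.tmul p (b.1 (f.toFun p)), ?_⟩⟩,
    fun a b => ?_⟩
  · have h1 := lineMap_apply f a p
    rw [← h1, ← lineMap_apply f b p]
    exact congrArg (fun c : Q.lineSpace => c.1 (f.toFun p)) h
  · exact lineSpace_ext Q (f.toFun p) ((lineMap_apply f _ p).trans (tmul_apply P p _))
  · refine (inner_line Q _ _ (f.toFun p)).trans (Eq.trans ?_ (inner_line P a b p).symm)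
    exact congrArg₂ (fun c d : ℂ => conj c * d) (lineMap_apply f a p) (lineMap_apply f b p)

end U1Tor

namespace Gerbe
variable {G : Type v} [Group G] (𝒳 : Gerbe.{v} G)

/-- The loops of degree `g` at `x`. -/
@[ext] structure Loop (x : 𝒳.X) (g : G) : Type v where
  arr : x ⟶ x
  deg_eq : 𝒳.deg arr = g

instance (x : 𝒳.X) (g : G) : MulAction Circle (𝒳.Loop x g) where
  smul z u := ⟨𝒳.sc z u.arr, by rw [deg_sc, u.deg_eq]⟩
  one_smul u := Loop.ext (sc_one _)
  mul_smul z z' u := Loop.ext (sc_sc _ _ _).symm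

variable {𝒳} in
theorem Loop.smul_arr {x : 𝒳.X} {g : G} (z : Circle) (u : 𝒳.Loop x g) :
    (z • u).arr = 𝒳.sc z u.arr := rfl

/-- The torsor of loops of degree `g` at a fixed point `x` of `g`. -/
def loopTor (a : LoopX G 𝒳.X) : U1Tor.{v} where
  carrier := 𝒳.Loop a.pt a.elt
  nonempty := by
    obtain ⟨u, hu⟩ := 𝒳.full a.elt a.pt a.pt a.fix
    exact ⟨⟨u, hu⟩⟩
  existsUnique_smul p q := by
    obtain ⟨z, hz⟩ := exists_sc q.arr p.arr (q.deg_eq.trans p.deg_eq.symm)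
    exact ⟨z, Loop.ext hz.symm, fun z' h' =>
      sc_injective q.arr ((congrArg Loop.arr h').trans hz)⟩

variable {𝒳}

/-- Conjugation `u ↦ v u v⁻¹` of loops by an arrow `v`. -/
def conjLoop {a b : LoopX G 𝒳.X} (h : a ⟶ b) (v : a.pt ⟶ b.pt) (hv : 𝒳.deg v = h.elt)
    (u : 𝒳.Loop a.pt a.elt) : 𝒳.Loop b.pt b.elt :=
  ⟨Groupoid.inv v ≫ u.arr ≫ v, by
    rw [𝒳.deg_comp, 𝒳.deg_comp, deg_inv, hv, u.deg_eq, h.conj_eq]⟩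

theorem conjLoop_indep {a b : LoopX G 𝒳.X} (h : a ⟶ b) (v v' : a.pt ⟶ b.pt)
    (hv : 𝒳.deg v = h.elt) (hv' : 𝒳.deg v' = h.elt) (u : 𝒳.Loop a.pt a.elt) :
    conjLoop h v hv u = conjLoop h v' hv' u := by
  obtain ⟨z, rfl⟩ := exists_sc v v' (hv.trans hv'.symm)
  refine Loop.ext ?_
  change _ = Groupoid.inv (𝒳.sc z v) ≫ u.arr ≫ 𝒳.sc z v
  rw [inv_sc, comp_sc, comp_sc, sc_comp, sc_sc, mul_inv_cancel, sc_one]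
  rfl

/-- A chosen arrow covering a morphism of the loop groupoid. -/
def chosenLift {a b : LoopX G 𝒳.X} (h : a ⟶ b) : a.pt ⟶ b.pt :=
  (𝒳.full h.elt a.pt b.pt h.smul_eq).choose

theorem deg_chosenLift {a b : LoopX G 𝒳.X} (h : a ⟶ b) : 𝒳.deg (chosenLift h) = h.elt :=
  (𝒳.full h.elt a.pt b.pt h.smul_eq).choose_spec

variable (𝒳)

/-- The transgression of a gerbe: the functor from the loop groupoid to torsors which sends `(x, g)`
to the torsor of loops of degree `g` at `x`, on which `h` acts by `u ↦ v u v⁻¹` for any arrow `v`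
of degree `h` out of `x`. -/
def transgression : LoopX G 𝒳.X ⥤ U1Tor.{v} where
  obj a := 𝒳.loopTor a
  map h := ⟨conjLoop h (chosenLift h) (deg_chosenLift h), fun z u => by
    refine Loop.ext ?_
    change Groupoid.inv _ ≫ 𝒳.sc z u.arr ≫ _ = 𝒳.sc z (Groupoid.inv _ ≫ u.arr ≫ _)
    rw [sc_comp, comp_sc]⟩
  map_id a := by
    refine U1Tor.Hom.ext (funext fun u => ?_)
    refine (conjLoop_indep (𝟙 a) _ (𝟙 a.pt) (deg_chosenLift _) (𝒳.deg_id _) u).trans ?_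
    refine Loop.ext ?_
    change Groupoid.inv (𝟙 _) ≫ u.arr ≫ 𝟙 _ = u.arr
    simp
  map_comp {a b c} h k := by
    refine U1Tor.Hom.ext (funext fun u => ?_)
    refine (conjLoop_indep (h ≫ k) _ (chosenLift h ≫ chosenLift k) (deg_chosenLift _) (by
      rw [𝒳.deg_comp, deg_chosenLift, deg_chosenLift]; rfl) u).trans ?_
    refine Loop.ext ?_
    change Groupoid.inv (_ ≫ _) ≫ u.arr ≫ _ = Groupoid.inv _ ≫ (Groupoid.inv _ ≫ u.arr ≫ _) ≫ _
    simp

end Gerbe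

section push
variable {G : Type v} [Group G] {X : Type v} [MulAction G X]

/-- The fixed points of `g`. -/
@[ext] structure FixPt (X : Type v) [MulAction G X] (g : G) : Type v where
  pt : X
  fix : g • pt = pt

/-- A fixed point as an object of the loop groupoid. -/
def FixPt.loop {g : G} (x : FixPt X g) : LoopX G X := ⟨x.pt, g, x.fix⟩

instance [Fintype X] (g : G) : Fintype (FixPt X g) :=
  have : Finite (FixPt X g) := Finite.of_injective FixPt.pt fun _ _ h => FixPt.ext h
  Fintype.ofFinite _

/-- The fixed point `h⁻¹ x` of `g`, for a fixed point `x` of `h g h⁻¹`. -/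
def FixPt.pull {g g' : G} (h : G) (e : h * g * h⁻¹ = g') (x : FixPt X g') : FixPt X g :=
  ⟨h⁻¹ • x.pt, by
    have h1 : g * h⁻¹ = h⁻¹ * g' := by rw [← e]; group
    rw [smul_smul, h1, mul_smul, x.fix]⟩

/-- The morphism `h : (h⁻¹ x, g) ⟶ (x, h g h⁻¹)` of the loop groupoid. -/
def FixPt.pullHom {g g' : G} (h : G) (e : h * g * h⁻¹ = g') (x : FixPt X g') :
    (x.pull h e).loop ⟶ x.loop := ⟨h, smul_inv_smul _ _, e⟩

/-- Pulling back fixed points is a bijection. -/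
def FixPt.pullEquiv {g g' : G} (h : G) (e : h * g * h⁻¹ = g') : FixPt X g' ≃ FixPt X g where
  toFun := FixPt.pull h e
  invFun := FixPt.pull h⁻¹ (by rw [← e]; group)
  left_inv x := FixPt.ext (by simp [FixPt.pull])
  right_inv x := FixPt.ext (by simp [FixPt.pull])

variable [Fintype X] (k : X → ℝ) (hk : ∀ x, 0 < k x) (hkG : ∀ (g : G) x, k (g • x) = k x)
  (L : LoopX G X ⥤ Hilb.{v})

/-- The space of sections over the fixed points of `g`, with weights `k`. -/
def pushFibre (g : G) : Hilb.{v} :=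
  Hilb.weightedSum (fun x : FixPt X g => k x.pt) (fun x => hk x.pt) (fun x => L.obj x.loop)

/-- The value of a section at a fixed point. -/
def pushEval {g : G} (x : FixPt X g) : pushFibre k hk L g →ₗ[ℂ] L.obj x.loop :=
  Hilb.proj _ _ (fun x : FixPt X g => L.obj x.loop) x

theorem push_ext {g : G} {ψ ψ' : pushFibre k hk L g}
    (h : ∀ x, pushEval k hk L x ψ = pushEval k hk L x ψ') : ψ = ψ' := funext h

/-- The action of `h` on sections, `(h ψ) (h x, h g h⁻¹) = L(h) ψ (x, g)`. -/
def pushMap {g g' : G} (h : G) (e : h * g * h⁻¹ = g') :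
    pushFibre k hk L g →ₗ[ℂ] pushFibre k hk L g' :=
  LinearMap.pi (φ := fun x : FixPt X g' => L.obj x.loop) fun x =>
    (L.map (x.pullHom h e)).lin ∘ₗ pushEval k hk L (x.pull h e)

theorem pushMap_apply {g g' : G} (h : G) (e : h * g * h⁻¹ = g') (x : FixPt X g) (x' : FixPt X g')
    (m : x.loop ⟶ x'.loop) (hm : m.elt = h) (ψ : pushFibre k hk L g) :
    pushEval k hk L x' (pushMap k hk L h e ψ) = (L.map m).lin (pushEval k hk L x ψ) := by
  obtain rfl : x = x'.pull h e := FixPt.ext (by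
    have h1 : m.elt • x.pt = x'.pt := m.smul_eq
    rw [hm] at h1
    exact eq_inv_smul_iff.2 h1)
  obtain rfl : m = x'.pullHom h e := LoopX.hom_ext hm
  rfl

/-- The push-forward to `G` of a hermitian bundle over the loop groupoid of a finite `G`-set with an
invariant metric. -/
def pushforward (hL : ∀ {a b : LoopX G X} (h : a ⟶ b), Hilb.IsUnitary (L.map h)) :
    HilbG.{v, v} G where
  functor :=
    { obj := fun g => pushFibre k hk L g.pt
      map := fun h => ⟨pushMap k hk L h.elt h.conj_eq⟩
      map_id := fun g => Hilb.hom_ext fun ψ => push_ext k hk L fun x => by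
        refine (pushMap_apply k hk L _ _ x x (𝟙 x.loop) rfl ψ).trans ?_
        rw [L.map_id]
        rfl
      map_comp := fun {a b c} h h' => Hilb.hom_ext fun ψ => push_ext k hk L fun x => by
        have m2 := x.pullHom h'.elt h'.conj_eq
        refine (pushMap_apply k hk L _ _ _ x ((x.pull h'.elt h'.conj_eq).pullHom h.elt h.conj_eq ≫
          x.pullHom h'.elt h'.conj_eq) rfl ψ).trans ?_
        rw [L.map_comp]
        rfl }
  unitary {a b} h := by
    refine LoopBG.isUnitary_of_inner _ (fun {a b} h ψ ψ' => ?_) h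
    refine Fintype.sum_equiv (FixPt.pullEquiv h.elt h.conj_eq) _ _ fun x => ?_
    have h1 : k (x.pull h.elt h.conj_eq).pt = k x.pt := hkG _ _
    change (k x.pt : ℂ) * _ = (k (x.pull h.elt h.conj_eq).pt : ℂ) * _
    rw [h1]
    exact congrArg _ ((hL (x.pullHom h.elt h.conj_eq)).2 _ _)

end push

namespace Gerbe
variable {G : Type v} [Group G] (𝒳 : Gerbe.{v} G)

/-- The geometric character of a gerbe: the push-forward of the line bundle of its transgression. -/
def geomChar : HilbG.{v, v} G :=
  pushforward 𝒳.k 𝒳.k_pos 𝒳.k_smul (𝒳.transgression ⋙ U1Tor.lineFunctor)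
    fun h => U1Tor.isUnitary_lineFunctor (𝒳.transgression.map h)

/-- The object `(x, g)` of the loop groupoid determined by a loop of degree `g` at `x`. -/
def Loop.fixPt {𝒳 : Gerbe.{v} G} {x : 𝒳.X} {g : G} (u : 𝒳.Loop x g) : FixPt 𝒳.X g :=
  ⟨x, by rw [← u.deg_eq, 𝒳.deg_smul]⟩

/-- The section `u ⊗ (1 / √k_x)` over the fixed points of `g` which is localized at `x`, where `u` is
a loop of degree `g` at `x`. -/
def localSection {𝒳 : Gerbe.{v} G} {x : 𝒳.X} {g : G} (u : 𝒳.Loop x g) : 𝒳.geomChar.fibre g :=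
  open Classical in
  (Pi.single (M := fun y : FixPt 𝒳.X g => (𝒳.loopTor y.loop).lineSpace) u.fixPt
    ((𝒳.loopTor u.fixPt.loop).tmul u ((1 / Real.sqrt (𝒳.k x) : ℝ) : ℂ)))

end Gerbe

/-! ## The gerbe of a marked unitary 2-representation -/

namespace TwoRep
variable {G : Type v} [Group G] (α : TwoRep.{u, v} G)

/-- Transport along an equality of group elements. -/
def cast {g g' : G} (h : g = g') (x : α.H) : (α.act g).obj x ⟶ (α.act g').obj x :=
  eqToHom (by rw [h])

theorem cast_rfl (g : G) (x : α.H) : α.cast (rfl : g = g) x = 𝟙 _ := rfl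
theorem cast_trans {g g' g'' : G} (h : g = g') (h' : g' = g'') (x : α.H) :
    α.cast h x ≫ α.cast h' x = α.cast (h.trans h') x := by
  subst h h'; rw [cast_rfl, Category.id_comp]
theorem cast_unitary {g g' : G} (h : g = g') (x : α.H) : IsUnitaryMor (α.cast h x) := by
  subst h; exact IsUnitaryMor.id _
theorem mu_cast {g₂ g₁ g g' : G} (h : g₂ * g₁ = g) (h' : g = g') (x : α.H) :
    α.mu h x ≫ α.cast h' x = α.mu (h.trans h') x := by
  subst h'; rw [cast_rfl, Category.comp_id]
theorem map_cast_mu {g₂ g₁ g₁' g : G} (e : g₁ = g₁') (h' : g₂ * g₁' = g) (x : α.H) :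
    (α.act g₂).map (α.cast e x) ≫ α.mu h' x = α.mu (by rw [e, h']) x := by
  subst e; rw [cast_rfl, (α.act g₂).map_id, Category.id_comp]
theorem act_cast_mu {g₂ g₂' g₁ g : G} (e : g₂ = g₂') (h' : g₂' * g₁ = g) (x : α.H) :
    α.cast e ((α.act g₁).obj x) ≫ α.mu h' x = α.mu (by rw [e, h']) x := by
  subst e; rw [cast_rfl, Category.id_comp]
theorem cast_naturality {g g' : G} (e : g = g') {x y : α.H} (f : x ⟶ y) :
    (α.act g).map f ≫ α.cast e y = α.cast e x ≫ (α.act g').map f := by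
  subst e; rw [cast_rfl, cast_rfl, Category.id_comp, Category.comp_id]

/-- Arrows `i ⟶ j` of the gerbe of a 2-representation: an element `g` of `G` together with a unitary
morphism `e j ⟶ act g (e i)`. -/
structure Arr (i j : α.H.ι) : Type v where
  deg : G
  hom : α.H.e j ⟶ (α.act deg).obj (α.H.e i)
  unitary : IsUnitaryMor hom

namespace Arr
variable {α} {i j l m : α.H.ι}

theorem ext' {a b : Arr α i j} (h : a.deg = b.deg) (e : a.hom ≫ α.cast h _ = b.hom) : a = b := by
  obtain ⟨g, u, hu⟩ := a
  obtain ⟨g', u', hu'⟩ := b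
  obtain rfl : g = g' := h
  have e' : u ≫ α.cast rfl _ = u' := e
  obtain rfl : u = u' := by rw [← e', cast_rfl, Category.comp_id]
  rfl

/-- The identity arrow, given by the unit of the 2-representation. -/
@[reducible] def id (i : α.H.ι) : Arr α i i := ⟨1, α.un _, α.un_unitary _⟩

/-- The composite `e l ⟶ act h (e j) ⟶ act h (act g (e i)) ⟶ act (h g) (e i)` of arrows. -/
@[reducible] def comp (a : Arr α i j) (b : Arr α j l) : Arr α i l :=
  ⟨b.deg * a.deg, b.hom ≫ (α.act b.deg).map a.hom ≫ α.mu rfl _,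
    b.unitary.comp (((α.act_star _).map_isUnitaryMor a.unitary).comp (α.mu_unitary _ _))⟩

/-- The inverse of an arrow. -/
@[reducible] def inv (a : Arr α i j) : Arr α j i :=
  ⟨a.deg⁻¹, α.un _ ≫ dagger (α.mu (inv_mul_cancel a.deg) _) ≫ (α.act a.deg⁻¹).map (dagger a.hom),
    (α.un_unitary _).comp ((α.mu_unitary _ _).dag.comp
      ((α.act_star _).map_isUnitaryMor a.unitary.dag))⟩

/-- Multiplication of an arrow by a phase. -/
@[reducible] def smul (z : Circle) (a : Arr α i j) : Arr α i j :=
  ⟨a.deg, (z : ℂ) • a.hom, by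
    have h : dagger ((z : ℂ) • a.hom) = conj (z : ℂ) • dagger a.hom := HStarCategory.dag_smul _ _
    have h1 : conj (z : ℂ) * (z : ℂ) = 1 := by
      rw [← Complex.normSq_eq_conj_mul_self, Circle.normSq_coe, Complex.ofReal_one]
    refine ⟨?_, ?_⟩
    · rw [h, Linear.smul_comp, Linear.comp_smul, smul_smul, mul_comm, h1, one_smul, a.unitary.1]
    · rw [h, Linear.smul_comp, Linear.comp_smul, smul_smul, h1, one_smul, a.unitary.2]⟩

end Arr

theorem tri (h : G) (x : α.H) :
    α.un ((α.act h).obj x) ≫ dagger (α.mu (mul_inv_cancel h) ((α.act h).obj x)) =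
      (α.act h).map (α.un x ≫ dagger (α.mu (inv_mul_cancel h) x)) := by
  have hζmu : (α.un x ≫ dagger (α.mu (inv_mul_cancel h) x)) ≫ α.mu (inv_mul_cancel h) x =
      α.un x := by
    rw [Category.assoc, (α.mu_unitary _ _).2, Category.comp_id]
  have := (α.mu_unitary (mul_inv_cancel h) ((α.act h).obj x)).mono
  have := (α.mu_unitary (one_mul h) x).mono
  rw [← cancel_mono (α.mu (mul_inv_cancel h) ((α.act h).obj x)), ← cancel_mono (α.mu (one_mul h) x)]
  simp only [Category.assoc]
  rw [← α.mu_assoc (mul_inv_cancel h) (inv_mul_cancel h) (mul_one h) (one_mul h) x,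
    ← Category.assoc ((α.act h).map (_ ≫ _)), ← (α.act h).map_comp, hζmu, map_un_mu,
    α.mu_assoc (mul_inv_cancel h) (inv_mul_cancel h) (mul_one h) (one_mul h) x,
    ← Category.assoc (dagger _), (α.mu_unitary _ _).2, Category.id_comp, un_mu]

/-- The groupoid underlying the gerbe of a 2-representation. -/
@[reducible] def arrGroupoid : Groupoid.{v} α.H.ι where
  Hom i j := Arr α i j
  id i := Arr.id i
  comp a b := a.comp b
  inv a := a.inv
  id_comp {i j} a := by
    refine Arr.ext' (mul_one _) ?_
    change (a.hom ≫ (α.act a.deg).map (α.un _) ≫ α.mu rfl _) ≫ α.cast _ _ = a.hom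
    rw [Category.assoc, Category.assoc, mu_cast, map_un_mu, Category.comp_id]
  comp_id {i j} a := by
    refine Arr.ext' (one_mul _) ?_
    change (α.un _ ≫ (α.act 1).map a.hom ≫ α.mu rfl _) ≫ α.cast _ _ = a.hom
    rw [Category.assoc, Category.assoc, mu_cast, ← Category.assoc, ← un_naturality, Category.assoc,
      un_mu, Category.comp_id]
  assoc {i j l m} a b c := by
    refine Arr.ext' (mul_assoc _ _ _).symm ?_
    change (c.hom ≫ (α.act c.deg).map (b.hom ≫ (α.act b.deg).map a.hom ≫ α.mu rfl _) ≫ α.mu rfl _) ≫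
      α.cast _ _ = (c.hom ≫ (α.act c.deg).map b.hom ≫ α.mu rfl _) ≫ (α.act (c.deg * b.deg)).map a.hom ≫ α.mu rfl _
    simp only [Category.assoc, CategoryTheory.Functor.map_comp]
    rw [mu_cast, α.mu_assoc (rfl : c.deg * b.deg = _) rfl _ rfl, ← Category.assoc ((α.act c.deg).map
      ((α.act b.deg).map _)), mu_naturality, Category.assoc]
  inv_comp {i j} a := by
    refine Arr.ext' (mul_inv_cancel _) ?_
    change (a.hom ≫ (α.act a.deg).map (α.un _ ≫ dagger (α.mu (inv_mul_cancel a.deg) _) ≫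
      (α.act a.deg⁻¹).map (dagger a.hom)) ≫ α.mu rfl _) ≫ α.cast _ _ = α.un _
    rw [Category.assoc, Category.assoc, mu_cast, ← Category.assoc (α.un _), (α.act a.deg).map_comp,
      ← tri, Category.assoc, Category.assoc, mu_naturality, ← Category.assoc (dagger _),
      (α.mu_unitary _ _).2, Category.id_comp, ← un_naturality, ← Category.assoc, a.unitary.1,
      Category.id_comp]
  comp_inv {i j} a := by
    refine Arr.ext' (inv_mul_cancel _) ?_
    change ((α.un _ ≫ dagger (α.mu (inv_mul_cancel a.deg) _) ≫ (α.act a.deg⁻¹).map (dagger a.hom)) ≫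
      (α.act a.deg⁻¹).map a.hom ≫ α.mu rfl _) ≫ α.cast _ _ = α.un _
    simp only [Category.assoc]
    rw [mu_cast, ← Category.assoc ((α.act a.deg⁻¹).map (dagger a.hom)), ← CategoryTheory.Functor.map_comp,
      a.unitary.2, CategoryTheory.Functor.map_id, Category.id_comp, (α.mu_unitary _ _).2, Category.comp_id]

theorem smul_id_comp (z : Circle) {i j : α.H.ι} (a : Arr α i j) :
    ((Arr.id i).smul z).comp a = a.smul z := by
  refine Arr.ext' (mul_one _) ?_
  change (a.hom ≫ (α.act a.deg).map ((z : ℂ) • α.un _) ≫ α.mu rfl _) ≫ α.cast _ _ = (z : ℂ) • a.hom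
  rw [(α.act_star _).map_smul, Category.assoc, Category.assoc, mu_cast, Linear.smul_comp, map_un_mu,
    Linear.comp_smul, Category.comp_id]

theorem comp_smul_id (z : Circle) {i j : α.H.ι} (a : Arr α i j) :
    a.comp ((Arr.id j).smul z) = a.smul z := by
  refine Arr.ext' (one_mul _) ?_
  change (((z : ℂ) • α.un _) ≫ (α.act 1).map a.hom ≫ α.mu rfl _) ≫ α.cast _ _ = (z : ℂ) • a.hom
  rw [Linear.smul_comp, Linear.smul_comp, Category.assoc, Category.assoc, mu_cast, ← Category.assoc,
    ← un_naturality, Category.assoc, un_mu, Category.comp_id]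

/-- The equivariant gerbe of a marked unitary 2-representation: its objects are the (indices of the)
distinguished simple objects, its arrows `i ⟶ j` of degree `g` are the unitary morphisms
`e j ⟶ act g (e i)`, and its metric is given by the scale factors. -/
def assocGerbe : Gerbe.{v} G where
  X := α.H.ι
  action := α.permAction
  groupoid := α.arrGroupoid
  deg a := Arr.deg a
  deg_smul a := α.perm_eq a.unitary.iso
  deg_id i := rfl
  deg_comp a b := rfl
  full g i j h := by
    obtain rfl : α.perm g i = j := h
    obtain ⟨f, hf⟩ := α.exists_unitary_perm g i
    exact ⟨⟨g, f, hf⟩, rfl⟩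
  phase i z := (Arr.id i).smul z
  phase_mul i z z' := by
    change _ = ((Arr.id i).smul z).comp ((Arr.id i).smul z')
    rw [smul_id_comp]
    refine Arr.ext' rfl ?_
    rw [cast_rfl, Category.comp_id]
    change ((z * z' : Circle) : ℂ) • α.un _ = (z : ℂ) • (z' : ℂ) • α.un _
    rw [smul_smul, Circle.coe_mul]
  phase_injective i z z' h := by
    have h1 : (z : ℂ) • α.un (α.H.e i) = (z' : ℂ) • α.un (α.H.e i) := by
      have h2 : HEq ((Arr.id i).smul z).hom ((Arr.id i).smul z').hom := by
        have h' : (Arr.id i).smul z = (Arr.id i).smul z' := h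
        rw [h']
      exact eq_of_heq h2
    have h3 : α.un (α.H.e i) ≠ 0 := by
      intro h0
      have h4 := (α.un_unitary (α.H.e i)).1
      rw [h0, zero_comp] at h4
      have h5 := α.H.k_pos i
      rw [MarkedTwoHilb.k, ← h4] at h5
      have h6 : homInner (0 : α.H.e i ⟶ α.H.e i) 0 = 0 := Hilb.inner_zero_left (homHilb _ _) _
      rw [h6] at h5
      exact lt_irrefl _ h5
    exact Circle.coe_injective (smul_left_injective ℂ h3 h1)
  deg_phase i z := rfl
  exists_phase i a h := by
    obtain ⟨g, u, hu⟩ := a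
    obtain rfl : g = 1 := h
    have h0 : 𝟙 (α.H.e i) ≠ 0 := by
      intro h0
      have h5 := α.H.k_pos i
      rw [MarkedTwoHilb.k, h0] at h5
      have h6 : homInner (0 : α.H.e i ⟶ α.H.e i) 0 = 0 := Hilb.inner_zero_left (homHilb _ _) _
      rw [h6] at h5
      exact lt_irrefl _ h5
    obtain ⟨c, hc⟩ := (finrank_eq_one_iff_of_nonzero' _ h0).1 (α.H.simple_e i)
      (u ≫ dagger (α.un (α.H.e i)))
    have hcu : c • α.un (α.H.e i) = u := by
      have h2 : (c • 𝟙 (α.H.e i)) ≫ α.un (α.H.e i) = u := by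
        rw [hc, Category.assoc, (α.un_unitary _).2, Category.comp_id]
      rwa [Linear.smul_comp, Category.id_comp] at h2
    have hn : Complex.normSq c = 1 := by
      have h3 := hu.1
      have h4 : dagger u = conj c • dagger (α.un (α.H.e i)) := by
        rw [← hcu]; exact HStarCategory.dag_smul _ _
      rw [h4, ← hcu, Linear.smul_comp, Linear.comp_smul, smul_smul, (α.un_unitary _).1,
        Complex.mul_conj] at h3
      have h5 : ((Complex.normSq c : ℂ) - 1) • 𝟙 (α.H.e i) = 0 := by
        rw [sub_smul, h3, one_smul, sub_self]
      exact_mod_cast sub_eq_zero.1 ((smul_eq_zero.1 h5).resolve_right h0)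
    have hc1 : c ∈ Submonoid.unitSphere ℂ := by
      refine mem_sphere_zero_iff_norm.2 ?_
      have := Complex.normSq_eq_norm_sq c
      rw [hn] at this
      nlinarith [norm_nonneg c]
    refine ⟨⟨c, hc1⟩, Arr.ext' rfl ?_⟩
    rw [cast_rfl, Category.comp_id]
    exact hcu
  central z a := (α.smul_id_comp z a).trans (α.comp_smul_id z a).symm
  k := α.H.k
  k_pos := α.H.k_pos
  k_smul g i := α.k_perm g i

theorem assocGerbe_sc (z : Circle) {i j : α.H.ι} (a : Arr α i j) :
    α.assocGerbe.sc z (x := i) (y := j) a = a.smul z := α.smul_id_comp z a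

namespace Mor
variable {α} {β : TwoRep.{u, v} G} (σ : Mor α β)

/-- The action of a pair of arrows of the same degree on the morphisms `e m ⟶ σ (e i)`: the
composite `e m' ⟶ β_g (e m) ⟶ β_g (σ (e i)) ⟶ σ (α_g (e i)) ⟶ σ (e i')`. -/
def bundleMap {i i' : α.H.ι} {m m' : β.H.ι} (b : Arr β m m') (a : Arr α i i') (h : b.deg = a.deg)
    (l : β.H.e m ⟶ σ.fn.obj (α.H.e i)) : β.H.e m' ⟶ σ.fn.obj (α.H.e i') :=
  b.hom ≫ (β.act b.deg).map l ≫ σ.co b.deg (α.H.e i) ≫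
    σ.fn.map (dagger (a.hom ≫ α.cast h.symm (α.H.e i)))

section
variable {i i' : α.H.ι} {m m' : β.H.ι} (b : Arr β m m') (a : Arr α i i')

theorem bundleMap_add (h : b.deg = a.deg) (l l' : β.H.e m ⟶ σ.fn.obj (α.H.e i)) :
    σ.bundleMap b a h (l + l') = σ.bundleMap b a h l + σ.bundleMap b a h l' := by
  simp only [bundleMap, (β.act_star _).map_add, Preadditive.add_comp, Preadditive.comp_add]

theorem bundleMap_smul (h : b.deg = a.deg) (c : ℂ) (l : β.H.e m ⟶ σ.fn.obj (α.H.e i)) :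
    σ.bundleMap b a h (c • l) = c • σ.bundleMap b a h l := by
  simp only [bundleMap, (β.act_star _).map_smul, Linear.smul_comp, Linear.comp_smul]

theorem bundleMap_phase_left (h : b.deg = a.deg) (z : Circle) (b' : Arr β m m')
    (e : b' = b.smul z) (h' : b'.deg = a.deg) (l : β.H.e m ⟶ σ.fn.obj (α.H.e i)) :
    σ.bundleMap b' a h' l = (z : ℂ) • σ.bundleMap b a h l := by
  subst e
  change ((z : ℂ) • b.hom) ≫ (β.act b.deg).map l ≫ σ.co b.deg (α.H.e i) ≫
    σ.fn.map (dagger (a.hom ≫ α.cast h.symm (α.H.e i))) = _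
  rw [Linear.smul_comp]
  rfl

theorem bundleMap_phase_right (h : b.deg = a.deg) (z : Circle) (a' : Arr α i i')
    (e : a' = a.smul z) (h' : b.deg = a'.deg) (l : β.H.e m ⟶ σ.fn.obj (α.H.e i)) :
    σ.bundleMap b a' h' l = ((z⁻¹ : Circle) : ℂ) • σ.bundleMap b a h l := by
  subst e
  change b.hom ≫ (β.act b.deg).map l ≫ σ.co b.deg (α.H.e i) ≫
    σ.fn.map (dagger (((z : ℂ) • a.hom) ≫ α.cast h.symm (α.H.e i))) = _
  have h1 : dagger ((z : ℂ) • a.hom ≫ α.cast h.symm (α.H.e i)) =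
      conj (z : ℂ) • dagger (a.hom ≫ α.cast h.symm (α.H.e i)) := HStarCategory.dag_smul _ _
  rw [Linear.smul_comp, h1, σ.star.map_smul, Linear.comp_smul, Linear.comp_smul, Linear.comp_smul,
    Circle.coe_inv_eq_conj]
  rfl

/-- The action of a pair of arrows, as a linear map. -/
def bundleLin (h : b.deg = a.deg) :
    homHilb (β.H.e m) (σ.fn.obj (α.H.e i)) →ₗ[ℂ] homHilb (β.H.e m') (σ.fn.obj (α.H.e i')) where
  toFun l := σ.bundleMap b a h l
  map_add' l l' := σ.bundleMap_add b a h l l'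
  map_smul' c l := σ.bundleMap_smul b a h c l

end

theorem bundleMap_id {i : α.H.ι} {m : β.H.ι} (h : (Arr.id m : Arr β m m).deg = (Arr.id i : Arr α i i).deg)
    (l : β.H.e m ⟶ σ.fn.obj (α.H.e i)) : σ.bundleMap (Arr.id m) (Arr.id i) h l = l := by
  change β.un _ ≫ (β.act 1).map l ≫ σ.co 1 _ ≫ σ.fn.map (dagger (α.un _ ≫ α.cast rfl _)) = l
  rw [cast_rfl, Category.comp_id, ← Category.assoc, ← un_naturality, Category.assoc,
    ← Category.assoc (β.un _), un_co, ← CategoryTheory.Functor.map_comp, (α.un_unitary _).1, CategoryTheory.Functor.map_id,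
    Category.comp_id]

theorem bundleMap_comp {i i' i'' : α.H.ι} {m m' m'' : β.H.ι} (b : Arr β m m') (a : Arr α i i')
    (h : b.deg = a.deg) (b' : Arr β m' m'') (a' : Arr α i' i'') (h' : b'.deg = a'.deg)
    (h'' : (b.comp b').deg = (a.comp a').deg) (l : β.H.e m ⟶ σ.fn.obj (α.H.e i)) :
    σ.bundleMap (b.comp b') (a.comp a') h'' l = σ.bundleMap b' a' h' (σ.bundleMap b a h l) := by
  obtain ⟨g, v, hv⟩ := b
  obtain ⟨g₁, u, hu⟩ := a
  obtain ⟨g', v', hv'⟩ := b'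
  obtain ⟨g₁', u', hu'⟩ := a'
  obtain rfl : g = g₁ := h
  obtain rfl : g' = g₁' := h'
  change (v' ≫ (β.act g').map v ≫ β.mu rfl _) ≫ (β.act (g' * g)).map l ≫ σ.co (g' * g) _ ≫
    σ.fn.map (dagger ((u' ≫ (α.act g').map u ≫ α.mu rfl _) ≫ α.cast rfl _)) =
    v' ≫ (β.act g').map (v ≫ (β.act g).map l ≫ σ.co g _ ≫ σ.fn.map (dagger (u ≫ α.cast rfl _))) ≫
      σ.co g' _ ≫ σ.fn.map (dagger (u' ≫ α.cast rfl _))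
  simp only [cast_rfl, Category.comp_id, dagger_comp, CategoryTheory.Functor.map_comp, Category.assoc]
  rw [← Category.assoc (β.mu rfl _), ← mu_naturality, Category.assoc, ← Category.assoc (β.mu rfl _),
    mu_co]
  simp only [Category.assoc]
  rw [← Category.assoc (σ.fn.map (α.mu rfl _)), ← CategoryTheory.Functor.map_comp, (α.mu_unitary _ _).1,
    CategoryTheory.Functor.map_id, Category.id_comp, ← Category.assoc ((β.act g').map (σ.fn.map _)),
    co_naturality, (α.act_star g').map_dagger]
  simp only [Category.assoc]

theorem bundleMap_inner {i i' : α.H.ι} {m m' : β.H.ι} (b : Arr β m m') (a : Arr α i i')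
    (h : b.deg = a.deg) (l l' : β.H.e m ⟶ σ.fn.obj (α.H.e i)) :
    homInner (σ.bundleMap b a h l) (σ.bundleMap b a h l') = homInner l l' := by
  simp only [bundleMap]
  rw [b.unitary.homInner_comp_left, ((σ.co_unitary _ _).comp (σ.star.map_isUnitaryMor
    (a.unitary.comp (α.cast_unitary h.symm _)).dag)).homInner_comp_right, β.act_inner]

/-- The morphism of gerbes associated to a morphism of 2-representations: the fibre over `(m, i)` is
`Hom(e m, σ (e i))`. -/
def bundle : Kernel α.assocGerbe β.assocGerbe :=
  Kernel.Data.toKernel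
    { fib := fun m i => homHilb (β.H.e m) (σ.fn.obj (α.H.e i))
      act := fun b a h => σ.bundleLin b a h
      act_id := fun m i h => LinearMap.ext fun l => σ.bundleMap_id h l
      act_comp := fun b a h b' a' h' h'' => LinearMap.ext fun l =>
        σ.bundleMap_comp b a h b' a' h' h'' l
      act_sc_left := fun {m m' i i'} z b a h h' => LinearMap.ext fun l =>
        σ.bundleMap_phase_left b a h z _ (β.assocGerbe_sc z b) h' l
      act_sc_right := fun {m m' i i'} z b a h h' => LinearMap.ext fun l =>
        σ.bundleMap_phase_right b a h z _ (α.assocGerbe_sc z a) h' l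
      act_inner := fun b a h l l' => σ.bundleMap_inner b a h l l' }

end Mor
end TwoRep

/-! ## The action of a morphism of 2-representations on 2-characters -/

/-- The extension of an assignment `obj` on objects to a functor. -/
structure FunctorOn {C : Type*} [Category C] {D : Type*} [Category D] (obj : C → D) where
  map : ∀ {x y : C}, (x ⟶ y) → (obj x ⟶ obj y)
  map_id : ∀ x : C, map (𝟙 x) = 𝟙 (obj x)
  map_comp : ∀ {x y z : C} (f : x ⟶ y) (g : y ⟶ z), map (f ≫ g) = map f ≫ map g

/-- The functor given by its assignment on objects and by its action on morphisms. -/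
def FunctorOn.toFunctor {C : Type*} [Category C] {D : Type*} [Category D] {obj : C → D}
    (F : FunctorOn obj) : C ⥤ D where
  obj := obj
  map := F.map
  map_id := F.map_id
  map_comp := F.map_comp

namespace TwoRep.Mor
variable {G : Type v} [Group G] {α β : TwoRep.{u, v} G} (σ : Mor α β)
  (R : β.H ⥤ α.H) (hR : IsStarFunctor R) (adj : σ.fn ⊣ R)

/-- The linear map `φ : Hom(σ (R y), y) → Hom(R y, R y)`, `f ↦ R f ∘ η`, of an adjunction. -/
def transpose (y : β.H) :
    homHilb (σ.fn.obj (R.obj y)) y →ₗ[ℂ] homHilb (R.obj y) (R.obj y) :=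
  (Linear.leftComp ℂ (R.obj y) (adj.unit.app (R.obj y)) ∘ₗ hR.mapLin _ _ :
    (σ.fn.obj (R.obj y) ⟶ y) →ₗ[ℂ] (R.obj y ⟶ R.obj y))

/-- The component at `y` of the transformation `id ⇒ σ ∘ R` which corresponds to the unit of the
adjunction under the even-handed structure of 2-Hilbert spaces: the morphism `(φ^* id)^*`, where
`φ^*` is the Hilbert space adjoint of `φ : Hom(σ (R y), y) → Hom(R y, R y)`. -/
def psiUnit (y : β.H) : y ⟶ σ.fn.obj (R.obj y) :=
  dagger (show σ.fn.obj (R.obj y) ⟶ y from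
    Hilb.adjoint (σ.transpose R hR adj y) (show homHilb (R.obj y) (R.obj y) from 𝟙 (R.obj y)))

/-- The component at `y` of the image of `θ : id ⟶ α_g` under the morphism of 2-characters induced
by `σ`: the composite `y ⟶ σ (R y) ⟶ σ (α_g (R y)) ⟶ β_g (σ (R y)) ⟶ β_g y`. -/
def charApp (g : G) (θ : 𝟭 α.H ⟶ α.act g) (y : β.H) : y ⟶ (β.act g).obj y :=
  σ.psiUnit R hR adj y ≫ σ.fn.map (θ.app (R.obj y)) ≫ dagger (σ.co g (R.obj y)) ≫
    (β.act g).map (adj.counit.app y)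

end TwoRep.Mor

/-- An element of the fibre `Nat(id, act g)` of the 2-character as a natural transformation. -/
def TwoRep.toNat {G : Type v} [Group G] {α : TwoRep.{u, v} G} {g : G} (θ : α.twoChar.fibre g) :
    𝟭 α.H ⟶ α.act g := θ

end

noncomputable section

/-! ## Dual frames of Hilbert spaces -/

/-! Everything rests on one principle: a sesquilinear contraction `∑ a, T (t a) (f a)` over dual
frames of a Hilbert space does not depend on the frames, and it can be carried along a pair of
adjoint maps (`Hilb.IsFrame.sum_adjoint`, `Hilb.IsFrame.sum_eq`). Applied to hom-spaces of an
H*-category, this gives the contraction `spread`, which sends `c : x ⟶ F x` to `∑ b* ≫ c ≫ F b` over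
an orthonormal basis of `Hom(x, y)`. It is independent of the basis, cyclic in `c` (`spread_comp`)
and natural in `y` (`spread_naturality`).

Schur's lemma and semisimplicity give the decomposition `1_x = ∑ i, k i ∑ b* ≫ b`, with `b` running
over an orthonormal basis of `Hom(e i, x)`. For a morphism `σ` with right adjoint `R`, the families
`σ(b) ≫ ψ*` and `σ(b) ≫ ε`, where `b` runs over an orthonormal basis of `Hom(e i, R y)`, are dual
frames of `Hom(σ(e i), y)`: this is what the definition of `Ψ(η)` as a Hilbert space adjoint amounts
to. Hence `χ(σ)(θ)_y` equals `∑ i, k i • spread (σ(θ_{e i}) ≫ σ_g⁻¹)` (`charApp_eq`), an expression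
without `R`. Independence of the adjoint is then evident, and cyclicity and the decomposition of
identities yield functoriality, equivariance and invariance under isomorphisms. A right adjoint is
built by representing `x ↦ Hom(F x, y)` isometrically on the simple objects; the isometry makes it a
*-functor.

For gerbes, `f ⊗ l ↦ f ≫ ρ(l)` identifies the convolution `⊕ m, Hom(e n, ρ(e m)) ⊗ Hom(e m, σ(e i))`
with `Hom(e n, ρσ(e i))`, again by the decomposition of the identity of `σ(e i)`. The geometric
character is functorial because the trace on a convolution is a sum over the fixed points of the
product of the traces (`tr_comp`), and because the phases of the chosen loops cancel.

The comparison sends `θ` to the section whose value at a loop `u : e i ⟶ α_g (e i)` is `k_i^(-1/2)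
(u, θ_{e i})`. If `i` is fixed by `g`, then `Hom(e i, α_g (e i))` is the line spanned by `u`, with
`(u, u) = k i`; otherwise it vanishes. So the map is unitary. It is natural because expanding `Tr
⟨σ⟩(w ⊗ ū)` in an orthonormal basis exhibits its conjugate as `(w, spread (σ(u) ≫ σ_g⁻¹))`
(`conj_tr_bundle`), the matrix coefficient of `χ(σ)` in its basis form. -/

/-- A map of two variables which is antilinear in the first and linear in the second variable. -/
structure IsSesq {V W X : Type*} [AddCommGroup V] [Module ℂ V] [AddCommGroup W] [Module ℂ W]
    [AddCommGroup X] [Module ℂ X] (T : V → W → X) : Prop where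
  add_left : ∀ v v' w, T (v + v') w = T v w + T v' w
  smul_left : ∀ (c : ℂ) v w, T (c • v) w = conj c • T v w
  add_right : ∀ v w w', T v (w + w') = T v w + T v w'
  smul_right : ∀ (c : ℂ) v w, T v (c • w) = c • T v w

namespace IsSesq
variable {V W X : Type*} [AddCommGroup V] [Module ℂ V] [AddCommGroup W] [Module ℂ W]
    [AddCommGroup X] [Module ℂ X] {T : V → W → X} {κ : Type*}

theorem sum_left (hT : IsSesq T) (s : Finset κ) (c : κ → ℂ) (v : κ → V) (w : W) :
    T (∑ a ∈ s, c a • v a) w = ∑ a ∈ s, conj (c a) • T (v a) w := by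
  classical
  induction s using Finset.induction_on with
  | empty => simpa using hT.smul_left 0 0 w
  | insert a s ha ih => rw [Finset.sum_insert ha, Finset.sum_insert ha, hT.add_left, ih, hT.smul_left]

theorem sum_right (hT : IsSesq T) (s : Finset κ) (c : κ → ℂ) (v : V) (w : κ → W) :
    T v (∑ a ∈ s, c a • w a) = ∑ a ∈ s, c a • T v (w a) := by
  classical
  induction s using Finset.induction_on with
  | empty => simpa using hT.smul_right 0 v 0
  | insert a s ha ih => rw [Finset.sum_insert ha, Finset.sum_insert ha, hT.add_right, ih, hT.smul_right]

end IsSesq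

namespace Hilb

theorem inner_sum_right (V : Hilb.{w}) {κ : Type*} (s : Finset κ) (x : V) (c : κ → ℂ) (y : κ → V) :
    V.inner x (∑ a ∈ s, c a • y a) = ∑ a ∈ s, c a * V.inner x (y a) :=
  IsSesq.sum_right (T := V.inner) ⟨inner_add_left V, inner_smul_left V, inner_add_right V,
    inner_smul_right V⟩ s c x y

theorem ext_inner_left (V : Hilb.{w}) {x y : V} (h : ∀ z, V.inner z x = V.inner z y) : x = y := by
  refine sub_eq_zero.1 (inner_definite V _ ?_)
  have h1 : x - y = x + (-1 : ℂ) • y := by rw [neg_one_smul, sub_eq_add_neg]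
  rw [show V.inner (x - y) (x - y) = V.inner (x - y) (x + (-1 : ℂ) • y) by rw [h1],
    inner_add_right, inner_smul_right, h]
  ring

/-- An orthonormal basis of a Hilbert space. -/
def onb (V : Hilb.{w}) : Fin (Module.finrank ℂ V) → V :=
  let _ := V.core.toNormedAddCommGroup
  let _ := InnerProductSpace.ofCore V.core.toCore
  stdOrthonormalBasis ℂ V

theorem sum_inner_onb (V : Hilb.{w}) (x : V) : ∑ a, V.inner (V.onb a) x • V.onb a = x := by
  let _ := V.core.toNormedAddCommGroup
  let _ := InnerProductSpace.ofCore V.core.toCore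
  exact (stdOrthonormalBasis ℂ V).sum_repr' x

theorem trace_eq_sum_onb {V : Hilb.{w}} (f : V →ₗ[ℂ] V) :
    LinearMap.trace ℂ V f = ∑ a, V.inner (V.onb a) (f (V.onb a)) := by
  let _ := V.core.toNormedAddCommGroup
  let _ := InnerProductSpace.ofCore V.core.toCore
  exact f.trace_eq_sum_inner (stdOrthonormalBasis ℂ V)

/-- Hilbert spaces of the same dimension are isometric. -/
theorem exists_isometry (V W : Hilb.{w}) (h : Module.finrank ℂ V = Module.finrank ℂ W) :
    ∃ e : V ≃ₗ[ℂ] W, ∀ x y, W.inner (e x) (e y) = V.inner x y := by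
  let _ := V.core.toNormedAddCommGroup
  let _ := InnerProductSpace.ofCore V.core.toCore
  let _ := W.core.toNormedAddCommGroup
  let _ := InnerProductSpace.ofCore W.core.toCore
  obtain ⟨e⟩ : Nonempty (V ≃ₗᵢ[ℂ] W) := 
    ⟨(stdOrthonormalBasis ℂ V).equiv (stdOrthonormalBasis ℂ W) (finCongr h)⟩
  exact ⟨e.toLinearEquiv, fun x y => e.inner_map_map x y⟩

/-- Two families `t`, `f` of vectors are dual frames when `x = ∑ a, (t a, x) f a` for all `x`. -/
def IsFrame (V : Hilb.{w}) {κ : Type*} [Fintype κ] (t f : κ → V) : Prop :=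
  ∀ x, ∑ a, V.inner (t a) x • f a = x

theorem isFrame_onb (V : Hilb.{w}) : V.IsFrame V.onb V.onb := V.sum_inner_onb

/-- The expansion operator of the swapped families is the Hilbert space adjoint of the original one,
and the identity is self-adjoint. -/
theorem IsFrame.symm {V : Hilb.{w}} {κ : Type*} [Fintype κ] {t f : κ → V} (h : V.IsFrame t f) :
    V.IsFrame f t := by
  intro x
  refine V.ext_inner_left fun z => ?_
  conv_rhs => rw [← h z]
  rw [inner_sum_right, IsSesq.sum_left (T := V.inner) ⟨inner_add_left V, inner_smul_left V,
    inner_add_right V, inner_smul_right V⟩]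
  refine Finset.sum_congr rfl fun a _ => ?_
  rw [inner_conj, smul_eq_mul, mul_comm]

/-- A sesquilinear contraction over dual frames can be transported along a map and its adjoint. -/
theorem IsFrame.sum_adjoint {V : Hilb.{v}} {W : Hilb.{w}} {X : Type*} [AddCommGroup X] [Module ℂ X]
    {T : V → W → X} (hT : IsSesq T) {κ κ' : Type*} [Fintype κ] [Fintype κ'] {t f : κ → V}
    {t' f' : κ' → W} (h : V.IsFrame t f) (h' : W.IsFrame t' f') (A : V → W) (A' : W → V)
    (hA : ∀ x y, V.inner (A' y) x = W.inner y (A x)) :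
    ∑ b, T (A' (t' b)) (f' b) = ∑ a, T (t a) (A (f a)) := by
  -- Both sides become the same double sum with coefficients `(A' (t' b), f a)`: `A (f a)` is
  -- expanded in the second frame, `A' (t' b)` in the first frame with its two families exchanged.
  have h1 : ∀ a, T (t a) (A (f a)) = ∑ b, V.inner (A' (t' b)) (f a) • T (t a) (f' b) := by
    intro a
    rw [← hT.sum_right]
    refine congrArg (T (t a)) ?_
    conv_lhs => rw [← h' (A (f a))]
    simp only [hA]
  have h2 : ∀ b, T (A' (t' b)) (f' b) = ∑ a, V.inner (A' (t' b)) (f a) • T (t a) (f' b) := by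
    intro b
    conv_lhs => rw [← h.symm (A' (t' b))]
    rw [hT.sum_left]
    simp only [inner_conj]
  simp only [h1, h2]
  exact Finset.sum_comm

/-- The case of the identity map: every pair of dual frames represents the same canonical element,
so the contraction depends on `T` alone. -/
theorem IsFrame.sum_eq {V : Hilb.{v}} {X : Type*} [AddCommGroup X] [Module ℂ X]
    {T : V → V → X} (hT : IsSesq T) {κ κ' : Type*} [Fintype κ] [Fintype κ'] {t f : κ → V}
    {t' f' : κ' → V} (h : V.IsFrame t f) (h' : V.IsFrame t' f') :
    ∑ b, T (t' b) (f' b) = ∑ a, T (t a) (f a) :=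
  h.sum_adjoint hT h' id id fun _ _ => rfl

end Hilb

/-! ## Orthonormal bases of morphisms -/

section HStar
variable {H : Type u} [Category.{v} H] [Preadditive H] [Linear ℂ H] [HStarCategory H]

theorem dagger_add {x y : H} (f g : x ⟶ y) : dagger (f + g) = dagger f + dagger g :=
  HStarCategory.dag_add f g
theorem dagger_smul {x y : H} (c : ℂ) (f : x ⟶ y) : dagger (c • f) = conj c • dagger f :=
  HStarCategory.dag_smul c f
theorem dagger_zero (x y : H) : dagger (0 : x ⟶ y) = 0 := by
  simpa using dagger_smul 0 (0 : x ⟶ y)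

/-- The involution, as an additive map. -/
def daggerHom (x y : H) : (x ⟶ y) →+ (y ⟶ x) where
  toFun := dagger
  map_zero' := dagger_zero x y
  map_add' := dagger_add

theorem dagger_sum {x y : H} {κ : Type*} (s : Finset κ) (f : κ → (x ⟶ y)) :
    dagger (∑ a ∈ s, f a) = ∑ a ∈ s, dagger (f a) := map_sum (daggerHom x y) f s

/-- Both sides equal `homInner (𝟙 x) (f ≫ dagger g)`. The involution is thus antiunitary. -/
theorem homInner_dagger {x y : H} (f g : x ⟶ y) : homInner (dagger f) (dagger g) = homInner g f := by
  have h1 := homInner_comp_left (dagger f) (𝟙 x) (dagger g)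
  have h2 := homInner_comp_right (𝟙 x) g f
  rw [Category.comp_id, dagger_dagger] at h1
  rw [Category.id_comp] at h2
  rw [h1, h2]

theorem homInner_add_right {x y : H} (f g h : x ⟶ y) :
    homInner f (g + h) = homInner f g + homInner f h := Hilb.inner_add_right (homHilb x y) f g h
theorem homInner_smul_right {x y : H} (c : ℂ) (f g : x ⟶ y) :
    homInner f (c • g) = c * homInner f g := Hilb.inner_smul_right (homHilb x y) c f g
theorem homInner_smul_left {x y : H} (c : ℂ) (f g : x ⟶ y) :
    homInner (c • f) g = conj c * homInner f g := Hilb.inner_smul_left (homHilb x y) c f g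
theorem homInner_zero_right {x y : H} (f : x ⟶ y) : homInner f 0 = 0 :=
  Hilb.inner_zero_right (homHilb x y) f

theorem eq_zero_of_homInner {x y : H} {f : x ⟶ y} (h : homInner f f = 0) : f = 0 :=
  Hilb.inner_definite (homHilb x y) f h

/-- An orthonormal basis of the space of morphisms between two objects. -/
def homBasis (x y : H) : Fin (Module.finrank ℂ (x ⟶ y)) → (x ⟶ y) := (homHilb x y).onb

theorem sum_homBasis {x y : H} (f : x ⟶ y) :
    ∑ a, homInner (homBasis x y a) f • homBasis x y a = f := (homHilb x y).sum_inner_onb f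

theorem isFrame_homBasis (x y : H) :
    (homHilb x y).IsFrame (homBasis x y) (homBasis x y) := (homHilb x y).isFrame_onb

/-- An antiunitary bijection carries orthonormal bases to orthonormal bases. This allows a sum over
a basis of `Hom(x, y)` to be replaced by one over a basis of `Hom(y, x)`. -/
theorem isFrame_dagger_homBasis (x y : H) : (homHilb x y).IsFrame
    (fun a => dagger (homBasis y x a)) (fun a => dagger (homBasis y x a)) := by
  intro (f : x ⟶ y)
  have h := congrArg dagger (sum_homBasis (dagger f))
  rw [dagger_dagger, dagger_sum] at h
  refine Eq.trans (Finset.sum_congr rfl fun a _ => ?_) h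
  rw [dagger_smul, homInner_conj]
  refine congrArg (· • _) ?_
  rw [← homInner_dagger, dagger_dagger]
  rfl

/-- The contractions over hom-spaces are all of this form, with `F'` the identity functor;
antilinearity in the first variable comes from the involution. -/
theorem isSesq_dagger_comp_map {K : Type*} [Category K] [Preadditive K] [Linear ℂ K]
    [HStarCategory K] {F : H ⥤ K} (hF : IsStarFunctor F) {F' : H ⥤ K} (hF' : IsStarFunctor F')
    {x y z w : H} (c : F'.obj x ⟶ F.obj z) :
    IsSesq fun (f : homHilb x y) (g : homHilb z w) =>
      F'.map (dagger (x := x) (y := y) f) ≫ c ≫ F.map (X := z) (Y := w) g where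
  add_left f f' g := by
    rw [show dagger (x := x) (y := y) (f + f') = _ from dagger_add (x := x) (y := y) f f',
      hF'.map_add, Preadditive.add_comp]
  smul_left r f g := by
    rw [show dagger (x := x) (y := y) (r • f) = _ from dagger_smul (x := x) (y := y) r f,
      hF'.map_smul, Linear.smul_comp]
  add_right f g g' := by
    rw [show F.map (X := z) (Y := w) (g + g') = _ from hF.map_add (x := z) (y := w) g g',
      Preadditive.comp_add, Preadditive.comp_add]
  smul_right r f g := by
    rw [show F.map (X := z) (Y := w) (r • g) = _ from hF.map_smul (x := z) (y := w) r g,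
      Linear.comp_smul, Linear.comp_smul]

end HStar

/-! ## Semisimplicity -/

namespace MarkedTwoHilb
variable {M : MarkedTwoHilb.{u, v}}

theorem k_ne_zero (i : M.ι) : (M.k i : ℂ) ≠ 0 := by exact_mod_cast (M.k_pos i).ne'

theorem id_e_ne_zero (i : M.ι) : 𝟙 (M.e i) ≠ 0 := by
  intro h
  have h1 := M.k_coe i
  rw [h, homInner_zero_right] at h1
  exact k_ne_zero i h1

/-- The scalar is found by pairing with the identity, whose square norm is `k i`. This is the source
of all the factors `k i` and their inverses. -/
theorem end_e_eq {i : M.ι} (f : M.e i ⟶ M.e i) :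
    f = ((M.k i : ℂ)⁻¹ * homInner (𝟙 (M.e i)) f) • 𝟙 (M.e i) := by
  obtain ⟨c, rfl⟩ := (finrank_eq_one_iff_of_nonzero' _ (id_e_ne_zero i)).1 (M.simple_e i) f
  rw [homInner_smul_right, ← M.k_coe, mul_comm c, inv_mul_cancel_left₀ (k_ne_zero i)]

/-- Schur's lemma, from positivity. If `f ≠ 0`, then `f ≫ f*` and `f* ≫ f` are scalars, nonzero
because `(1, f ≫ f*) = (f, f)`; a multiple of `f*` is then inverse to `f`, although distinct marked
objects are not isomorphic. -/
theorem hom_e_eq_zero {i j : M.ι} (h : i ≠ j) (f : M.e i ⟶ M.e j) : f = 0 := by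
  by_contra hf
  have h1 : ∀ {i j : M.ι} (f : M.e i ⟶ M.e j), f ≠ 0 → ∃ c : ℂ, c ≠ 0 ∧ f ≫ dagger f = c • 𝟙 _ := by
    intro i j f hf
    refine ⟨_, fun h0 => hf (eq_zero_of_homInner ?_), end_e_eq _⟩
    have h2 := homInner_comp_right (𝟙 _) f f
    rw [Category.id_comp] at h2
    rw [h2]
    exact (mul_eq_zero.1 h0).resolve_left (inv_ne_zero (k_ne_zero i))
  obtain ⟨c, hc, e1⟩ := h1 f hf
  obtain ⟨d, hd, e2⟩ := h1 (dagger f) fun h0 => hf (by rw [← dagger_dagger f, h0, dagger_zero])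
  rw [dagger_dagger] at e2
  -- Bracketing `f ≫ f* ≫ f` in two ways shows that the two scalars agree.
  have e3 : d • f = c • f := by
    rw [← Category.comp_id (d • f), Linear.smul_comp, ← Linear.comp_smul, ← e2, ← Category.assoc, e1,
      Linear.smul_comp, Category.id_comp]
  have e4 : d = c := smul_left_injective ℂ hf e3
  subst e4
  refine h (M.e_inj _ _ ⟨⟨f, d⁻¹ • dagger f, ?_, ?_⟩⟩)
  · rw [Linear.comp_smul, e1, smul_smul, inv_mul_cancel₀ hd, one_smul]
  · rw [Linear.smul_comp, e2, smul_smul, inv_mul_cancel₀ hd, one_smul]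

/-- The form of Schur's lemma in constant use: composing with an adjoint at a simple object computes
an inner product, up to `1 / k i`. -/
theorem comp_dagger_e {i : M.ι} {x : M} (s b : M.e i ⟶ x) :
    s ≫ dagger b = ((M.k i : ℂ)⁻¹ * homInner b s) • 𝟙 (M.e i) := by
  have h2 := homInner_comp_right (𝟙 _) b s
  rw [Category.id_comp] at h2
  rw [h2]
  exact end_e_eq _

/-- Expansion of a sum over the simple objects at a morphism out of one of them. -/
theorem sum_comp_dagger {X : Type*} [AddCommGroup X] [Module ℂ X] {i : M.ι} {x : M} (s : M.e i ⟶ x)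
    (T : ∀ j, (M.e i ⟶ M.e j) →ₗ[ℂ] (M.e j ⟶ x) →ₗ[ℂ] X) :
    ∑ j, (M.k j : ℂ) • ∑ a, T j (s ≫ dagger (homBasis (M.e j) x a)) (homBasis (M.e j) x a) =
      T i (𝟙 _) s := by
  classical
  -- Only `j = i` contributes, by Schur's lemma. There the scalars `(b, s) / k i` move to the second
  -- argument of `T`, where they reassemble `s`, and the weight `k i` cancels.
  rw [Finset.sum_eq_single i]
  · rw [Finset.smul_sum]
    conv_rhs => rw [← sum_homBasis s, map_sum]
    refine Finset.sum_congr rfl fun a _ => ?_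
    rw [comp_dagger_e, map_smul, map_smul, LinearMap.smul_apply, smul_smul,
      mul_inv_cancel_left₀ (k_ne_zero i)]
  · intro j _ hj
    rw [Finset.sum_eq_zero fun a _ => ?_, smul_zero]
    rw [hom_e_eq_zero hj.symm (s ≫ _), map_zero, LinearMap.zero_apply]
  · intro h
    exact absurd (Finset.mem_univ i) h

/-- The simple objects generate: the difference of composition with `f` and with `g` is linear and
kills every endomorphism factoring through a simple object, and `𝟙 x` is in the span of these. -/
theorem hom_ext_e {x y : M} {f g : x ⟶ y} (h : ∀ i (s : M.e i ⟶ x), s ≫ f = s ≫ g) : f = g := by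
  obtain ⟨T, hT⟩ : ∃ T : (x ⟶ x) →ₗ[ℂ] (x ⟶ y), ∀ d, T d = d ≫ f - d ≫ g :=
    ⟨Linear.rightComp ℂ x f - Linear.rightComp ℂ x g, fun d => rfl⟩
  have h0 : T (𝟙 x) = 0 := by
    refine Submodule.span_induction (p := fun f _ => T f = 0) ?_ (map_zero T)
      (fun a b _ _ ha hb => by rw [map_add, ha, hb, add_zero])
      (fun c a _ ha => by rw [map_smul, ha, smul_zero]) (id_mem_simpleSpan x)
    rintro _ ⟨i, r, s, rfl⟩
    rw [hT, Category.assoc, Category.assoc, h, sub_self]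
  rwa [hT, Category.id_comp, Category.id_comp, sub_eq_zero] at h0

/-- The decomposition of an object into simple objects. -/
theorem sum_dagger_comp (x : M) :
    ∑ i, (M.k i : ℂ) • ∑ a, dagger (homBasis (M.e i) x a) ≫ homBasis (M.e i) x a = 𝟙 x := by
  refine hom_ext_e fun i s => ?_
  have h := sum_comp_dagger s fun j => Linear.comp (S := ℂ) (M.e i) (M.e j) x
  simp only [Linear.comp_apply, Linear.leftComp_apply, Category.id_comp] at h
  rw [Category.comp_id, Preadditive.comp_sum]
  refine Eq.trans (Finset.sum_congr rfl fun j _ => ?_) h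
  rw [Linear.comp_smul, Preadditive.comp_sum]
  simp only [Category.assoc]

/-- The decomposition `sum_dagger_comp` again, with the bases of `Hom(e i, x)` exchanged for the
adjoints of bases of `Hom(x, e i)`. -/
theorem sum_comp_dagger_id (x : M) :
    ∑ i, (M.k i : ℂ) • ∑ a, homBasis x (M.e i) a ≫ dagger (homBasis x (M.e i) a) = 𝟙 x := by
  conv_rhs => rw [← sum_dagger_comp x]
  refine Finset.sum_congr rfl fun i _ => congrArg _ ?_
  have h := (isFrame_homBasis (M.e i) x).sum_eq (isSesq_dagger_comp_map (F := 𝟭 M) .id (F' := 𝟭 M)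
    .id (𝟙 _)) (isFrame_dagger_homBasis (M.e i) x)
  refine Eq.trans (Finset.sum_congr rfl fun a _ => ?_) (h.trans (Finset.sum_congr rfl fun a _ => ?_))
  · change _ = dagger (dagger _) ≫ 𝟙 _ ≫ dagger _
    rw [dagger_dagger, Category.id_comp]
  · change dagger _ ≫ 𝟙 _ ≫ _ = _
    rw [Category.id_comp]
    rfl

end MarkedTwoHilb

/-! ## Contraction over orthonormal bases of morphisms -/

section contract
variable {H : Type u} [Category.{v} H] [Preadditive H] [Linear ℂ H] [HStarCategory H]

/-- The contraction `∑ b, b* ≫ c ≫ F b` over an orthonormal basis of the morphisms `x ⟶ y`. -/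
def spread (F : H ⥤ H) {x : H} (y : H) : (x ⟶ F.obj x) →ₗ[ℂ] (y ⟶ F.obj y) :=
  ∑ a, Linear.leftComp ℂ _ (dagger (homBasis x y a)) ∘ₗ Linear.rightComp ℂ _ (F.map (homBasis x y a))

variable {F : H ⥤ H}

theorem spread_apply {x : H} (y : H) (c : x ⟶ F.obj x) : spread F y c =
    ∑ a, dagger (homBasis x y a) ≫ c ≫ F.map (homBasis x y a) := by
  simp [spread]

/-- Independence of the basis. The frames put in later come from an adjunction, from the action of a
group element, from adjoint bases, and from the single morphism `𝟙 (e i)`. -/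
theorem spread_eq_sum (hF : IsStarFunctor F) {x y : H} (c : x ⟶ F.obj x) {κ : Type*} [Fintype κ]
    {t f : κ → (x ⟶ y)} (h : (homHilb x y).IsFrame t f) :
    ∑ a, dagger (t a) ≫ c ≫ F.map (f a) = spread F y c := by
  rw [spread_apply]
  exact (isFrame_homBasis x y).sum_eq (isSesq_dagger_comp_map hF .id (c : (𝟭 H).obj x ⟶ _)) h

/-- Cyclicity of the contraction. -/
theorem spread_comp (hF : IsStarFunctor F) {x x' y : H} (p : x ⟶ x') (d : x' ⟶ F.obj x) :
    spread F y (p ≫ d) = spread F y (d ≫ F.map p) := by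
  rw [spread_apply, spread_apply]
  -- Precomposition with `p` and with `p*` are adjoint maps between `Hom(x', y)` and `Hom(x, y)`.
  have h := (isFrame_homBasis x' y).sum_adjoint
    (isSesq_dagger_comp_map hF .id (d : (𝟭 H).obj x' ⟶ F.obj x)) (isFrame_homBasis x y)
    (fun f : x' ⟶ y => p ≫ f) (fun f : x ⟶ y => dagger p ≫ f) (fun f g => by
      refine (homInner_comp_left (dagger p) g f).trans ?_
      rw [dagger_dagger]
      rfl)
  refine Eq.trans (Finset.sum_congr rfl fun a _ => ?_) (h.trans (Finset.sum_congr rfl fun a _ => ?_))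
  · change _ = dagger (dagger p ≫ homBasis x y a) ≫ d ≫ F.map _
    rw [dagger_comp, dagger_dagger, Category.assoc, Category.assoc]
  · change dagger _ ≫ d ≫ F.map (p ≫ homBasis x' y a) = _
    rw [F.map_comp, Category.assoc]

/-- Postcomposition with `f` and with `f*` are adjoint, so `f` can be moved from one leg of the
contraction to the other. Consequently one morphism `c : x ⟶ F x` spreads out to a transformation
from the identity to `F`. -/
theorem spread_naturality (hF : IsStarFunctor F) {x y y' : H} (c : x ⟶ F.obj x) (f : y ⟶ y') :
    f ≫ spread F y' c = spread F y c ≫ F.map f := by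
  rw [spread_apply, spread_apply, Preadditive.comp_sum, Preadditive.sum_comp]
  have h := (isFrame_homBasis x y).sum_adjoint
    (isSesq_dagger_comp_map hF .id (c : (𝟭 H).obj x ⟶ F.obj x)) (isFrame_homBasis x y')
    (fun g : x ⟶ y => g ≫ f) (fun g : x ⟶ y' => g ≫ dagger f) (fun g g' => by
      refine (homInner_comp_right g' (dagger f) g).trans ?_
      rw [dagger_dagger]
      rfl)
  refine Eq.trans (Finset.sum_congr rfl fun a _ => ?_) (h.trans (Finset.sum_congr rfl fun a _ => ?_))
  · change _ = dagger (homBasis x y' a ≫ dagger f) ≫ c ≫ F.map _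
    rw [dagger_comp, dagger_dagger, Category.assoc]
  · change dagger _ ≫ c ≫ F.map (homBasis x y a ≫ f) = _
    rw [F.map_comp, Category.assoc, Category.assoc]

end contract

/-! ### Expansion of natural transformations over the simple objects -/

section
variable {M : MarkedTwoHilb.{u, v}}

/-- Insert the decomposition of `𝟙 y` before `θ` and move `θ` inside by naturality. A transformation
is thereby recovered from its components at the simple objects. -/
theorem sum_spread_app {F : M ⥤ M} (θ : 𝟭 M ⟶ F) (y : M) :
    ∑ i, (M.k i : ℂ) • spread F y (θ.app (M.e i)) = θ.app y := by
  refine Eq.trans ?_ (Category.id_comp (θ.app y))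
  change _ = 𝟙 y ≫ θ.app y
  rw [← MarkedTwoHilb.sum_dagger_comp y, Preadditive.sum_comp]
  refine Finset.sum_congr rfl fun i _ => ?_
  rw [Linear.smul_comp, Preadditive.sum_comp, spread_apply]
  refine congrArg _ (Finset.sum_congr rfl fun a _ => ?_)
  rw [Category.assoc]
  exact congrArg (dagger (homBasis (M.e i) y a) ≫ ·) (θ.naturality (homBasis (M.e i) y a)).symm

/-- The core of functoriality: summing a double contraction over the intermediate simple objects
leaves a single one, because cyclicity collects the inner bases into `∑ j, k j ∑ b ≫ b* = 𝟙 x`. -/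
theorem sum_spread_spread {L : Type*} [Category L] [Preadditive L] [Linear ℂ L]
    [HStarCategory L] {F : M ⥤ M} {F' : L ⥤ L} (hF' : IsStarFunctor F')
    {ρ : M ⥤ L} (hρ : IsStarFunctor ρ) (t : F ⋙ ρ ⟶ ρ ⋙ F') {x : M} (c : x ⟶ F.obj x) (z : L) :
    ∑ j, (M.k j : ℂ) • spread F' z (ρ.map (spread F (M.e j) c) ≫ t.app (M.e j)) =
      spread F' z (ρ.map c ≫ t.app x) := by
  -- Expand the inner contraction, pull its right leg through `t` by naturality, and rotate its left
  -- leg `b*` to the far end by cyclicity, so that it meets `b`.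
  have h1 : ∀ j, spread F' z (ρ.map (spread F (M.e j) c) ≫ t.app (M.e j)) =
      ∑ a, spread F' z ((ρ.map c ≫ t.app x) ≫ F'.map (ρ.map (homBasis x (M.e j) a ≫
        dagger (homBasis x (M.e j) a)))) := by
    intro j
    have h2 : ρ.map (spread F (M.e j) c) ≫ t.app (M.e j) = ∑ a, ρ.map (dagger (homBasis x (M.e j) a)) ≫
        ρ.map c ≫ t.app x ≫ F'.map (ρ.map (homBasis x (M.e j) a)) := by
      rw [spread_apply]
      have h3 : ρ.map (∑ a, dagger (homBasis x (M.e j) a) ≫ c ≫ F.map (homBasis x (M.e j) a)) =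
          ∑ a, ρ.map (dagger (homBasis x (M.e j) a) ≫ c ≫ F.map (homBasis x (M.e j) a)) :=
        map_sum (hρ.mapLin _ _) _ _
      rw [h3, Preadditive.sum_comp]
      refine Finset.sum_congr rfl fun a _ => ?_
      have h4 := t.naturality (homBasis x (M.e j) a)
      simp only [Functor.comp_map] at h4
      rw [ρ.map_comp, ρ.map_comp, Category.assoc, Category.assoc, h4]
    rw [h2, map_sum]
    refine Finset.sum_congr rfl fun a _ => ?_
    rw [spread_comp hF', ρ.map_comp, F'.map_comp]
    simp only [Category.assoc]
  simp only [h1]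
  have h0 : spread F' z (ρ.map c ≫ t.app x) =
      spread F' z ((ρ.map c ≫ t.app x) ≫ F'.map (ρ.map (𝟙 x))) := by
    rw [ρ.map_id, F'.map_id]
    exact congrArg _ (Category.comp_id _).symm
  rw [h0, ← MarkedTwoHilb.sum_comp_dagger_id x]
  have h5 : ∀ f : x ⟶ x, spread F' z ((ρ.map c ≫ t.app x) ≫ F'.map (ρ.map f)) =
      (spread F' z ∘ₗ Linear.leftComp ℂ _ (ρ.map c ≫ t.app x) ∘ₗ (hρ.comp hF').mapLin x x) f :=
    fun _ => rfl
  simp only [h5, map_sum, map_smul]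

end

/-! ### The map of 2-characters in terms of orthonormal bases -/

namespace TwoRep
variable {G : Type v} [Group G]

/-- The action of `h` is an isometric bijection on hom-spaces, so it carries an orthonormal basis of
`Hom(x, y)` to one of `Hom(h x, h y)`. The hypothesis `e` says that `c'` is the image of `c` under
`h`, read through the compositors. -/
theorem map_spread_mu (β : TwoRep.{u, v} G) {g h g' k : G} (hk : h * g = k) (hk' : g' * h = k)
    {x : β.H} (c : x ⟶ (β.act g).obj x)
    (c' : (β.act h).obj x ⟶ (β.act g').obj ((β.act h).obj x))
    (e : c' ≫ β.mu hk' x = (β.act h).map c ≫ β.mu hk x) (y : β.H) :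
    spread (β.act g') ((β.act h).obj y) c' ≫ β.mu hk' y =
      (β.act h).map (spread (β.act g) y c) ≫ β.mu hk y := by
  have hf : (homHilb ((β.act h).obj x) ((β.act h).obj y)).IsFrame
      (fun a => (β.act h).map (homBasis x y a)) (fun a => (β.act h).map (homBasis x y a)) := by
    intro f
    obtain ⟨p, rfl⟩ := (β.act_bijective h x y).2 f
    have h1 := congrArg ((β.act_star h).mapLin x y) (sum_homBasis p)
    rw [map_sum] at h1
    refine Eq.trans (Finset.sum_congr rfl fun a _ => ?_) h1
    rw [map_smul]
    exact congrArg (· • _) (β.act_inner h (homBasis x y a) p)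
  have h2 : (β.act h).map (spread (β.act g) y c) = ∑ a, (β.act h).map
      (dagger (homBasis x y a) ≫ c ≫ (β.act g).map (homBasis x y a)) := by
    rw [spread_apply]
    exact map_sum ((β.act_star h).mapLin _ _) _ _
  rw [← spread_eq_sum (β.act_star g') c' hf, h2, Preadditive.sum_comp, Preadditive.sum_comp]
  refine Finset.sum_congr rfl fun a _ => ?_
  simp only [Functor.map_comp, Category.assoc]
  rw [mu_naturality, mu_naturality, ← (β.act_star h).map_dagger, ← Category.assoc c', e]
  simp only [Category.assoc]

namespace Mor
variable {α β : TwoRep.{u, v} G} (σ : Mor α β)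

/-- The inverse of the coherence isomorphism, as a transformation `σ α_g ⇒ β_g σ`. -/
def coDagger (g : G) : α.act g ⋙ σ.fn ⟶ σ.fn ⋙ β.act g where
  app x := dagger (σ.co g x)
  naturality x y f := by
    have := (σ.co_unitary g x).mono
    have := (σ.co_unitary g y).mono
    change σ.fn.map ((α.act g).map f) ≫ dagger (σ.co g y) =
      dagger (σ.co g x) ≫ (β.act g).map (σ.fn.map f)
    rw [← cancel_mono (σ.co g y), Category.assoc, Category.assoc, (σ.co_unitary g y).2,
      Category.comp_id, co_naturality, ← Category.assoc, (σ.co_unitary g x).2, Category.id_comp]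

theorem co_dagger_naturality (g : G) {x y : α.H} (f : x ⟶ y) :
    σ.fn.map ((α.act g).map f) ≫ dagger (σ.co g y) =
      dagger (σ.co g x) ≫ (β.act g).map (σ.fn.map f) := (σ.coDagger g).naturality f

/-- The morphism `σ (e i) ⟶ σ (α_g (e i)) ⟶ β_g (σ (e i))` determined by a transformation. -/
def pushAt (g : G) (θ : 𝟭 α.H ⟶ α.act g) (x : α.H) : σ.fn.obj x ⟶ (β.act g).obj (σ.fn.obj x) :=
  σ.fn.map (θ.app x) ≫ dagger (σ.co g x)

theorem pushAt_add (g : G) (θ θ' : 𝟭 α.H ⟶ α.act g) (x : α.H) :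
    σ.pushAt g (θ + θ') x = σ.pushAt g θ x + σ.pushAt g θ' x :=
  (congrArg (· ≫ _) (σ.star.map_add _ _)).trans (Preadditive.add_comp _ _ _ _ _ _)

theorem pushAt_smul (g : G) (c : ℂ) (θ : 𝟭 α.H ⟶ α.act g) (x : α.H) :
    σ.pushAt g (c • θ) x = c • σ.pushAt g θ x :=
  (congrArg (· ≫ _) (σ.star.map_smul _ _)).trans (Linear.smul_comp _ _ _ _ _ _)

/-- The image of a transformation under the morphism of 2-characters induced by `σ`, in terms of
orthonormal bases of the spaces of morphisms `σ (e i) ⟶ y`. -/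
def charNat (g : G) (θ : 𝟭 α.H ⟶ α.act g) : 𝟭 β.H ⟶ β.act g where
  app y := ∑ i, (α.H.k i : ℂ) • spread (β.act g) y (σ.pushAt g θ (α.H.e i))
  naturality y y' f := by
    simp only [Functor.id_map, Preadditive.comp_sum, Preadditive.sum_comp, Linear.comp_smul,
      Linear.smul_comp]
    exact Finset.sum_congr rfl fun i _ => congrArg _ (spread_naturality (β.act_star g) _ f)

theorem charNat_app (g : G) (θ : 𝟭 α.H ⟶ α.act g) (y : β.H) : (σ.charNat g θ).app y =
    ∑ i, (α.H.k i : ℂ) • spread (β.act g) y (σ.pushAt g θ (α.H.e i)) := rfl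

/-- For `s = 𝟙` this is the defining property of the Hilbert space adjoint of `transpose`;
naturality of the unit extends it to all `s`. It says that `s ↦ σ(s) ≫ ψ*` is adjoint to the
adjunction bijection. -/
theorem homInner_psiUnit (R : β.H ⥤ α.H) (hR : IsStarFunctor R) (adj : σ.fn ⊣ R) {x : α.H} {y : β.H}
    (s : x ⟶ R.obj y) (p : σ.fn.obj x ⟶ y) :
    homInner (σ.fn.map s ≫ dagger (σ.psiUnit R hR adj y)) p = homInner s (adj.homEquiv x y p) := by
  rw [homInner_comp_left, ← σ.star.map_dagger]
  unfold psiUnit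
  rw [dagger_dagger]
  refine (Hilb.inner_adjoint (σ.transpose R hR adj y) _ _).trans ?_
  change homInner (𝟙 (R.obj y)) (adj.unit.app (R.obj y) ≫ R.map (σ.fn.map (dagger s) ≫ p)) = _
  have h := adj.unit.naturality (dagger s)
  simp only [Functor.id_map, Functor.comp_map] at h
  rw [R.map_comp, ← Category.assoc, ← h, Category.assoc, Adjunction.homEquiv_unit]
  have h1 := homInner_comp_left s (𝟙 _) (adj.unit.app x ≫ R.map p)
  rw [Category.comp_id] at h1
  exact h1.symm

/-- The right-hand side makes no reference to the adjunction, so this is where independence of the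
right adjoint is proved. The adjunction enters only through a particular choice of dual frames of
`Hom(σ(e i), y)`. -/
theorem charApp_eq (R : β.H ⥤ α.H) (hR : IsStarFunctor R) (adj : σ.fn ⊣ R) (g : G)
    (θ : 𝟭 α.H ⟶ α.act g) (y : β.H) : σ.charApp R hR adj g θ y = (σ.charNat g θ).app y := by
  -- An endomorphism `f` of `R y` is inserted before `θ`; by linearity in `f`, the decomposition of
  -- `𝟙 (R y)` into simple objects can be substituted.
  obtain ⟨T, hT⟩ : ∃ T : (R.obj y ⟶ R.obj y) →ₗ[ℂ] (y ⟶ (β.act g).obj y),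
      ∀ f, T f = σ.psiUnit R hR adj y ≫ σ.fn.map (f ≫ θ.app (R.obj y)) ≫
        dagger (σ.co g (R.obj y)) ≫ (β.act g).map (adj.counit.app y) :=
    ⟨Linear.leftComp ℂ _ (σ.psiUnit R hR adj y) ∘ₗ Linear.rightComp ℂ _ (dagger (σ.co g (R.obj y)) ≫
      (β.act g).map (adj.counit.app y)) ∘ₗ σ.star.mapLin _ _ ∘ₗ
        Linear.rightComp ℂ _ (θ.app (R.obj y)), fun f => rfl⟩
  have h1 : σ.charApp R hR adj g θ y = T (𝟙 _) := by
    rw [hT]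
    exact congrArg (fun f => σ.psiUnit R hR adj y ≫ σ.fn.map f ≫ _) (Category.id_comp _).symm
  rw [h1, ← MarkedTwoHilb.sum_dagger_comp (R.obj y), charNat_app, map_sum]
  refine Finset.sum_congr rfl fun i _ => ?_
  rw [map_smul, map_sum]
  refine congrArg _ ?_
  -- To expand `p`, expand its transpose in the orthonormal basis of `Hom(e i, R y)` and transpose
  -- back with the counit; `homInner_psiUnit` identifies the coefficients.
  have hf : (homHilb (σ.fn.obj (α.H.e i)) y).IsFrame
      (fun a => σ.fn.map (homBasis (α.H.e i) (R.obj y) a) ≫ dagger (σ.psiUnit R hR adj y))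
      (fun a => σ.fn.map (homBasis (α.H.e i) (R.obj y) a) ≫ adj.counit.app y) := by
    intro (p : σ.fn.obj (α.H.e i) ⟶ y)
    have h2 := congrArg (Linear.rightComp ℂ _ (adj.counit.app y) ∘ₗ σ.star.mapLin _ _)
      (sum_homBasis (adj.homEquiv _ _ p))
    rw [map_sum] at h2
    have h3 : σ.fn.map (adj.homEquiv _ _ p) ≫ adj.counit.app y = p :=
      (adj.homEquiv_counit _ _ _).symm.trans (Equiv.symm_apply_apply _ _)
    refine Eq.trans (Finset.sum_congr rfl fun a _ => ?_) (h2.trans h3)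
    rw [map_smul]
    exact congrArg (· • _) (σ.homInner_psiUnit R hR adj _ p)
  rw [← spread_eq_sum (β.act_star g) _ hf]
  refine Finset.sum_congr rfl fun a _ => ?_
  have h4 := θ.naturality (homBasis (α.H.e i) (R.obj y) a)
  simp only [Functor.id_map] at h4
  rw [hT, dagger_comp, dagger_dagger, Category.assoc, h4, σ.fn.map_comp, σ.fn.map_comp,
    (β.act g).map_comp, pushAt, σ.star.map_dagger]
  simp only [Category.assoc]
  rw [← Category.assoc (σ.fn.map ((α.act g).map _)), co_dagger_naturality]
  simp only [Category.assoc]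

theorem charNat_id (g : G) (θ : 𝟭 α.H ⟶ α.act g) : (Mor.id α).charNat g θ = θ := by
  refine NatTrans.ext (funext fun y => ?_)
  rw [← sum_spread_app θ y, charNat_app]
  refine Finset.sum_congr rfl fun i _ => congrArg (fun c => (α.H.k i : ℂ) • spread (α.act g) y c) ?_
  change θ.app (α.H.e i) ≫ dagger (𝟙 _) = _
  rw [dagger_id, Category.comp_id]

/-- After the two sums over simple objects are exchanged, `sum_spread_spread` eliminates those of
the middle 2-representation. -/
theorem charNat_comp {δ : TwoRep.{u, v} G} (ρ : Mor β δ) (g : G) (θ : 𝟭 α.H ⟶ α.act g) :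
    (σ.comp ρ).charNat g θ = ρ.charNat g (σ.charNat g θ) := by
  refine NatTrans.ext (funext fun z => ?_)
  have h1 : ∀ j, spread (δ.act g) z (ρ.pushAt g (σ.charNat g θ) (β.H.e j)) =
      ∑ i, (α.H.k i : ℂ) • spread (δ.act g) z (ρ.fn.map (spread (β.act g) (β.H.e j)
        (σ.pushAt g θ (α.H.e i))) ≫ (ρ.coDagger g).app (β.H.e j)) := by
    intro j
    have h2 : ∀ f : β.H.e j ⟶ (β.act g).obj (β.H.e j),
        spread (δ.act g) z (ρ.fn.map f ≫ (ρ.coDagger g).app (β.H.e j)) =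
        (spread (δ.act g) z ∘ₗ Linear.rightComp ℂ _ ((ρ.coDagger g).app (β.H.e j)) ∘ₗ
          ρ.star.mapLin _ _) f := fun _ => rfl
    refine (h2 _).trans ?_
    rw [charNat_app, map_sum]
    refine Finset.sum_congr rfl fun i _ => ?_
    rw [map_smul]
    rfl
  rw [charNat_app, charNat_app]
  simp only [h1, Finset.smul_sum]
  rw [Finset.sum_comm]
  refine Finset.sum_congr rfl fun i _ => ?_
  have h3 := sum_spread_spread (δ.act_star g) ρ.star (ρ.coDagger g) (σ.pushAt g θ (α.H.e i)) z
  simp only [smul_comm _ (α.H.k i : ℂ), ← Finset.smul_sum]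
  rw [h3]
  refine congrArg (fun c => (α.H.k i : ℂ) • spread (δ.act g) z c) ?_
  change ρ.fn.map (σ.fn.map (θ.app _)) ≫ dagger (ρ.co g _ ≫ ρ.fn.map (σ.co g _)) =
    ρ.fn.map (σ.fn.map (θ.app _) ≫ dagger (σ.co g _)) ≫ dagger (ρ.co g _)
  rw [dagger_comp, ρ.fn.map_comp, ρ.star.map_dagger, Category.assoc]

/-- An isomorphism `t` conjugates the contracted morphisms `pushAt` into each other, and a
conjugation disappears from the contraction by cyclicity. -/
theorem charNat_congr {ρ : Mor α β} (h : Iso σ ρ) (g : G) (θ : 𝟭 α.H ⟶ α.act g) :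
    σ.charNat g θ = ρ.charNat g θ := by
  obtain ⟨t, ht⟩ := h
  refine NatTrans.ext (funext fun y => ?_)
  rw [charNat_app, charNat_app]
  refine Finset.sum_congr rfl fun i _ => congrArg _ ?_
  obtain ⟨x, hx⟩ : ∃ x, x = α.H.e i := ⟨_, rfl⟩
  rw [← hx]
  have h1 : σ.pushAt g θ x = t.hom.app x ≫ ρ.pushAt g θ x ≫ (β.act g).map (t.inv.app x) := by
    have h2 := t.hom.naturality (θ.app x)
    simp only [Functor.id_obj] at h2
    have h3 : t.hom.app ((α.act g).obj x) ≫ dagger (ρ.co g x) =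
        dagger (σ.co g x) ≫ (β.act g).map (t.hom.app x) := by
      have := (σ.co_unitary g x).epi
      rw [← cancel_epi (σ.co g x), ← Category.assoc, ht, Category.assoc, (ρ.co_unitary g x).1,
        ← Category.assoc, (σ.co_unitary g x).1, Category.comp_id, Category.id_comp]
    rw [pushAt, pushAt, Category.assoc, ← Category.assoc (t.hom.app x), ← h2, Category.assoc,
      ← Category.assoc (t.hom.app _), h3, Category.assoc, ← (β.act g).map_comp, ← NatTrans.comp_app,
      t.hom_inv_id, NatTrans.id_app, (β.act g).map_id, Category.comp_id]
  rw [h1, spread_comp (β.act_star g), Category.assoc, ← (β.act g).map_comp, ← NatTrans.comp_app,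
    t.inv_hom_id, NatTrans.id_app, (β.act g).map_id, Category.comp_id]

/-- By `conjNat_unique` it suffices to compare at objects of the form `h y`. There the two sums
correspond under the permutation of the simple objects by `h`, which preserves the weights, and each
summand is transported by `map_spread_mu`. -/
theorem charNat_conj {g g' : G} (h : G) (hg : h * g * h⁻¹ = g') (θ : 𝟭 α.H ⟶ α.act g) :
    σ.charNat g' (α.conjNat h hg θ) = β.conjNat h hg (σ.charNat g θ) := by
  have hk : g' * h = h * g := by rw [← hg]; group
  refine (β.conjNat_unique h hg _ _ hk fun y => ?_).symm
  have h1 : (β.act h).map ((σ.charNat g θ).app y) = ∑ i, (α.H.k i : ℂ) •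
      (β.act h).map (spread (β.act g) y (σ.pushAt g θ (α.H.e i))) := by
    change (β.act_star h).mapLin _ _ _ = _
    rw [charNat_app, map_sum]
    simp only [map_smul]
    rfl
  rw [h1, charNat_app, Preadditive.sum_comp, Preadditive.sum_comp]
  let _ := α.permAction
  -- The summand of `i` for `g` is matched with the summand of `h i` for `g'`.
  refine (Fintype.sum_equiv (MulAction.toPerm h) _ _ fun i => ?_).symm
  change _ = ((α.H.k (α.perm h i) : ℂ) • spread (β.act g') _ (σ.pushAt g' _ (α.H.e (α.perm h i)))) ≫ _
  rw [k_perm, Linear.smul_comp, Linear.smul_comp]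
  refine congrArg _ ?_
  obtain ⟨f, hf⟩ := α.exists_unitary_perm h i
  revert f hf
  generalize α.H.e i = x
  intro f hf
  -- `pushAt` of the conjugated transformation at `α_h x`, conjugated by `σ.co h x`: the
  -- representative living on `β_h (σ x)` that `map_spread_mu` requires.
  obtain ⟨c', hc'⟩ : ∃ c', c' = σ.co h x ≫ σ.pushAt g' (α.conjNat h hg θ) ((α.act h).obj x) ≫
    (β.act g').map (dagger (σ.co h x)) := ⟨_, rfl⟩
  have e1 : c' ≫ β.mu hk (σ.fn.obj x) = (β.act h).map (σ.pushAt g θ x) ≫ β.mu rfl (σ.fn.obj x) := by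
    have h2 := σ.mu_co hk x
    have h3 := σ.mu_co (rfl : h * g = h * g) x
    have := (σ.co_unitary (h * g) x).mono
    have h4 := α.conjApp_mu h hg θ hk rfl x
    rw [← cancel_mono (σ.co (h * g) x), Category.assoc, Category.assoc, h2, h3, hc', pushAt, pushAt]
    simp only [Category.assoc, Functor.map_comp]
    rw [← Category.assoc ((β.act g').map (dagger _)), ← (β.act g').map_comp, (σ.co_unitary _ _).2,
      (β.act g').map_id, Category.id_comp, ← Category.assoc (dagger _), (σ.co_unitary _ _).2,
      Category.id_comp, ← σ.fn.map_comp]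
    change σ.co h x ≫ σ.fn.map (α.conjApp h hg θ _ ≫ _) = _
    rw [h4, σ.fn.map_comp, ← Category.assoc, ← co_naturality, Category.assoc,
      ← Category.assoc ((β.act h).map (dagger _)), ← (β.act h).map_comp, (σ.co_unitary _ _).2,
      (β.act h).map_id, Category.id_comp]
  rw [← β.map_spread_mu rfl hk _ c' e1]
  refine congrArg (· ≫ _) ?_
  have h5 := (α.conjNat h hg θ).naturality (dagger f)
  simp only [Functor.id_map] at h5
  rw [hc', spread_comp (β.act_star g'), Category.assoc, ← (β.act g').map_comp, (σ.co_unitary _ _).2,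
    (β.act g').map_id, Category.comp_id]
  -- The chosen unitary `f` replaces `α_h (e i)` by the marked simple object isomorphic to it. Both
  -- this conjugation and that by `σ.co` vanish by cyclicity.
  have h6 : σ.pushAt g' (α.conjNat h hg θ) ((α.act h).obj x) = σ.fn.map (dagger f) ≫
      σ.pushAt g' (α.conjNat h hg θ) _ ≫ (β.act g').map (σ.fn.map f) := by
    rw [pushAt, pushAt, Category.assoc, ← co_dagger_naturality, ← Category.assoc, ← σ.fn.map_comp, h5,
      σ.fn.map_comp, Category.assoc, ← Category.assoc (σ.fn.map ((α.act g').map _)), ← σ.fn.map_comp,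
      ← (α.act g').map_comp, hf.2, (α.act g').map_id, σ.fn.map_id, Category.id_comp]
  rw [h6, spread_comp (β.act_star g'), Category.assoc, ← (β.act g').map_comp, ← σ.fn.map_comp, hf.1,
    σ.fn.map_id, (β.act g').map_id, Category.comp_id]

theorem charNat_add (g : G) (θ θ' : 𝟭 α.H ⟶ α.act g) :
    σ.charNat g (θ + θ') = σ.charNat g θ + σ.charNat g θ' := by
  refine NatTrans.ext (funext fun y => ?_)
  change (σ.charNat g (θ + θ')).app y = (σ.charNat g θ).app y + (σ.charNat g θ').app y
  simp only [charNat_app, pushAt_add, map_add, smul_add, Finset.sum_add_distrib]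

theorem charNat_smul (g : G) (c : ℂ) (θ : 𝟭 α.H ⟶ α.act g) :
    σ.charNat g (c • θ) = c • σ.charNat g θ := by
  refine NatTrans.ext (funext fun y => ?_)
  change (σ.charNat g (c • θ)).app y = c • (σ.charNat g θ).app y
  simp only [charNat_app, pushAt_smul, map_smul, Finset.smul_sum, smul_comm c]

/-- The morphism of 2-characters induced by a morphism of 2-representations. -/
def charHom : α.twoChar ⟶ β.twoChar where
  nat :=
    { app := fun g => ⟨show α.charFibre g.pt →ₗ[ℂ] β.charFibre g.pt from
        { toFun := fun θ => σ.charNat g.pt θ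
          map_add' := fun θ θ' => σ.charNat_add g.pt θ θ'
          map_smul' := fun c θ => σ.charNat_smul g.pt c θ }⟩
      naturality := fun g g' h => Hilb.hom_ext fun θ => σ.charNat_conj h.elt h.conj_eq θ }

end Mor

/-- The 2-character as a functor. -/
def charFunctor : FunctorOn fun α : TwoRep.{u, v} G => α.twoChar where
  map := Quotient.lift (fun σ => σ.charHom) fun σ ρ h => HilbG.Hom.ext (NatTrans.ext (funext fun g =>
    Hilb.hom_ext fun θ => σ.charNat_congr h g.pt θ))
  map_id α := HilbG.Hom.ext (NatTrans.ext (funext fun g =>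
    Hilb.hom_ext fun θ => Mor.charNat_id g.pt θ))
  map_comp := by
    rintro α β δ ⟨σ⟩ ⟨ρ⟩
    exact HilbG.Hom.ext (NatTrans.ext (funext fun g =>
      Hilb.hom_ext fun θ => σ.charNat_comp ρ g.pt θ))

end TwoRep

/-! ## Right adjoints of linear *-functors -/

namespace MarkedTwoHilb
variable {M : MarkedTwoHilb.{u, v}}

/-- Take the direct sum of `n i` copies of each `e i`; by Schur's lemma only the copies of `e i`
contribute to the dimension. -/
theorem exists_finrank_hom_e (n : M.ι → ℕ) :
    ∃ x : M, ∀ i, Module.finrank ℂ (M.e i ⟶ x) = n i := by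
  classical
  let f : (Σ i : M.ι, Fin (n i)) → M := fun a => M.e a.1
  refine ⟨⨁ f, fun i => ?_⟩
  have hfd : ∀ x y : M, FiniteDimensional ℂ (x ⟶ y) := HStarCategory.finDim
  let φ : (M.e i ⟶ ⨁ f) ≃ₗ[ℂ] (∀ a, M.e i ⟶ f a) :=
    { toFun := fun s a => s ≫ biproduct.π f a
      invFun := fun s => biproduct.lift s
      map_add' := fun s t => funext fun a => Preadditive.add_comp _ _ _ _ _ _
      map_smul' := fun c s => funext fun a => Linear.smul_comp _ _ _ _ _ _
      left_inv := fun s => by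
        refine biproduct.hom_ext _ _ fun a => ?_
        rw [biproduct.lift_π]
      right_inv := fun s => funext fun a => biproduct.lift_π s a }
  rw [φ.finrank_eq, Module.finrank_pi_fintype, Fintype.sum_sigma, Finset.sum_eq_single i]
  · change ∑ a : Fin (n i), Module.finrank ℂ (M.e i ⟶ M.e i) = n i
    simp [M.simple_e]
  · intro j _ hj
    refine Finset.sum_eq_zero fun a _ => ?_
    have : Subsingleton (M.e i ⟶ M.e j) :=
      ⟨fun s t => by rw [hom_e_eq_zero hj.symm s, hom_e_eq_zero hj.symm t]⟩
    exact Module.finrank_zero_of_subsingleton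
  · intro h
    exact absurd (Finset.mem_univ i) h

end MarkedTwoHilb

section
variable {M : MarkedTwoHilb.{u, v}} {K : Type u} [Category.{v} K] [Preadditive K] [Linear ℂ K]
  [HStarCategory K] {F : M ⥤ K}

/-- A universal morphism from a linear *-functor out of a marked 2-Hilbert space, which is
isometric on the morphisms out of the simple objects. -/
theorem exists_universal (hF : IsStarFunctor F) (y : K) : ∃ (x : M) (ε : F.obj x ⟶ y),
    (∀ t, Function.Bijective fun f : t ⟶ x => F.map f ≫ ε) ∧
      ∀ i (s s' : M.e i ⟶ x), homInner (F.map s ≫ ε) (F.map s' ≫ ε) = homInner s s' := by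
  obtain ⟨x, hx⟩ := M.exists_finrank_hom_e fun i => Module.finrank ℂ (F.obj (M.e i) ⟶ y)
  choose Φ hΦ using fun i => Hilb.exists_isometry (homHilb (M.e i) x) (homHilb (F.obj (M.e i)) y) (hx i)
  replace hΦ : ∀ i (s s' : M.e i ⟶ x), homInner (Φ i s : F.obj (M.e i) ⟶ y) (Φ i s') =
    homInner s s' := hΦ
  obtain ⟨Ψ, hΨ⟩ : ∃ Ψ : ∀ i, (M.e i ⟶ x) →ₗ[ℂ] (F.obj (M.e i) ⟶ y), ∀ i s, Ψ i s = Φ i s :=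
    ⟨fun i => (Φ i).toLinearMap, fun _ _ => rfl⟩
  have hb : ∀ i, Function.Bijective (Ψ i) := fun i =>
    (funext (hΨ i) : ⇑(Ψ i) = Φ i) ▸ (Φ i).bijective
  -- The requirement `F s ≫ ε = Ψ i s` for all `s : e i ⟶ x`, together with the decomposition of `𝟙
  -- x`, forces this formula. The isometries `Ψ i` themselves are arbitrary.
  obtain ⟨ε, hε⟩ : ∃ ε : F.obj x ⟶ y, ε = ∑ i, (M.k i : ℂ) • ∑ a,
      F.map (dagger (homBasis (M.e i) x a)) ≫ Ψ i (homBasis (M.e i) x a) := ⟨_, rfl⟩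
  have h1 : ∀ i (s : M.e i ⟶ x), F.map s ≫ ε = Ψ i s := by
    intro i s
    have h := MarkedTwoHilb.sum_comp_dagger s fun j =>
      (Linear.comp (S := ℂ) (F.obj (M.e i)) (F.obj (M.e j)) y).compl₁₂ (hF.mapLin _ _) (Ψ j)
    rw [hε, Preadditive.comp_sum]
    refine Eq.trans (Finset.sum_congr rfl fun j _ => ?_) (h.trans ?_)
    · rw [Linear.comp_smul, Preadditive.comp_sum]
      refine congrArg _ (Finset.sum_congr rfl fun a _ => ?_)
      rw [← Category.assoc, ← F.map_comp]
      rfl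
    · change F.map (𝟙 _) ≫ Ψ i s = _
      rw [F.map_id, Category.id_comp]
  refine ⟨x, ε, fun t => ⟨fun f f' h => M.hom_ext_e fun i s => (hb i).1 ?_, fun p => ?_⟩,
    fun i s s' => ?_⟩
  · have h2 : F.map f ≫ ε = F.map f' ≫ ε := h
    rw [← h1, ← h1, F.map_comp, F.map_comp, Category.assoc, Category.assoc, h2]
  -- A preimage of `p` is glued from preimages of its restrictions to simple objects, along the
  -- decomposition of `𝟙 t`.
  · choose q hq using fun i (s : F.obj (M.e i) ⟶ y) => (hb i).2 s
    refine ⟨∑ i, (M.k i : ℂ) • ∑ a, dagger (homBasis (M.e i) t a) ≫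
      q i (F.map (homBasis (M.e i) t a) ≫ p), ?_⟩
    change (Linear.rightComp ℂ _ ε ∘ₗ hF.mapLin _ _) _ = p
    have h2 : p = (Linear.rightComp ℂ _ p ∘ₗ hF.mapLin _ _) (𝟙 t) := by
      change p = F.map (𝟙 t) ≫ p
      rw [F.map_id, Category.id_comp]
    conv_rhs => rw [h2, ← MarkedTwoHilb.sum_dagger_comp t]
    simp only [map_sum, map_smul]
    refine Finset.sum_congr rfl fun i _ => congrArg _ (Finset.sum_congr rfl fun a _ => ?_)
    change F.map (_ ≫ _) ≫ ε = F.map (_ ≫ _) ≫ p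
    rw [F.map_comp, F.map_comp, Category.assoc, Category.assoc, h1, hq]
  · rw [h1, h1, hΨ, hΨ, hΦ]

/-- A linear *-functor out of a marked 2-Hilbert space has a right adjoint which is a linear
*-functor. -/
theorem exists_right_adjoint (hF : IsStarFunctor F) :
    ∃ R : K ⥤ M, IsStarFunctor R ∧ Nonempty (F ⊣ R) := by
  choose R ε hb hi using exists_universal hF
  let E : ∀ x y, (F.obj x ⟶ y) ≃ (x ⟶ R y) := fun x y => (Equiv.ofBijective _ (hb y x)).symm
  have hE : ∀ x y (f : x ⟶ R y), (E x y).symm f = F.map f ≫ ε y := fun _ _ _ => rfl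
  have he : ∀ x' x y (f : x' ⟶ x) (g : F.obj x ⟶ y), E x' y (F.map f ≫ g) = f ≫ E x y g := by
    intro x' x y f g
    rw [← Equiv.eq_symm_apply, hE, F.map_comp, Category.assoc, ← hE, Equiv.symm_apply_apply]
  refine ⟨Adjunction.rightAdjointOfEquiv E he, ?_, ⟨Adjunction.adjunctionOfEquivRight E he⟩⟩
  have hm : ∀ {y y' : K} (f : y ⟶ y'),
      F.map ((Adjunction.rightAdjointOfEquiv E he).map f) ≫ ε y' = ε y ≫ f := by
    intro y y' f
    refine ((E (R y) y').symm_apply_apply _).trans ?_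
    rw [hE, F.map_id, Category.id_comp]
  have hm' : ∀ {y y' : K} (f : y ⟶ y') {x : M} (s : x ⟶ R y),
      F.map (s ≫ (Adjunction.rightAdjointOfEquiv E he).map f) ≫ ε y' = (F.map s ≫ ε y) ≫ f := by
    intro y y' f x s
    rw [F.map_comp, Category.assoc, hm, Category.assoc]
  refine ⟨fun {y y'} f g => (hb y' _).1 ?_, fun {y y'} c f => (hb y' _).1 ?_, fun {y y'} f => ?_⟩
  · change F.map _ ≫ ε y' = F.map (_ + _) ≫ ε y'
    rw [hF.map_add, Preadditive.add_comp, hm, hm, hm, Preadditive.comp_add]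
  · change F.map _ ≫ ε y' = F.map (_ • _) ≫ ε y'
    rw [hF.map_smul, Linear.smul_comp, hm, hm, Linear.comp_smul]
  -- This is where the isometry is needed. Tested against `t : e i ⟶ R y`, both sides become `((F t
  -- ≫ ε) ≫ f, F s ≫ ε)`, since the inner products on `Hom(e i, R y)` are computed after applying
  -- `F` and the counit.
  · refine M.hom_ext_e fun i (s : M.e i ⟶ R y') => Hilb.ext_inner_left (homHilb (M.e i) (R y))
      fun (t : M.e i ⟶ R y) => ?_
    change homInner t _ = homInner t _
    rw [← hi, hm', ← homInner_comp_right, ← homInner_comp_right, ← hi, hm']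

end

/-! ## Functoriality of the associated gerbe -/

section homTmul
variable {H : Type u} [Category.{v} H] [Preadditive H] [Linear ℂ H] [HStarCategory H]
  {K : Type u} [Category.{v} K] [Preadditive K] [Linear ℂ K] [HStarCategory K]
  {x y : H} {z w : K}

/-- The tensor product of two morphisms, as an element of the tensor product of the spaces of
morphisms. -/
def homTmul : (x ⟶ y) →ₗ[ℂ] (z ⟶ w) →ₗ[ℂ] Hilb.tensor (homHilb x y) (homHilb z w) :=
  TensorProduct.mk ℂ (homHilb x y) (homHilb z w)

theorem homTmul_induction {p : Hilb.tensor (homHilb x y) (homHilb z w) → Prop} (h0 : p 0)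
    (h1 : ∀ (f : x ⟶ y) (g : z ⟶ w), p (homTmul f g)) (h2 : ∀ c d, p c → p d → p (c + d))
    (a : Hilb.tensor (homHilb x y) (homHilb z w)) : p a := Hilb.tensor_induction h0 h1 h2 a

end homTmul

/-! ### Maps out of convolutions and out of identity morphisms -/

namespace Kernel
variable {G : Type v} [Group G] {𝒳 𝒴 𝒵 : Gerbe.{v} G}

theorem Iso.symm {E F : Kernel 𝒳 𝒴} (h : Iso E F) : Iso F E := h.map CategoryTheory.Iso.symm

/-- A linear map out of a fibre of a composite, from its restrictions to the summands. -/
def compDesc (E : Kernel 𝒳 𝒴) (F : Kernel 𝒴 𝒵) {z : 𝒵.X} {x : 𝒳.X} {W : Type*} [AddCommGroup W]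
    [Module ℂ W] (f : ∀ y, Hilb.tensor (F.fib z y) (E.fib y x) →ₗ[ℂ] W) :
    (comp E F).fib z x →ₗ[ℂ] W := ∑ y, f y ∘ₗ compProj E F y

theorem compDesc_apply (E : Kernel 𝒳 𝒴) (F : Kernel 𝒴 𝒵) {z : 𝒵.X} {x : 𝒳.X} {W : Type*}
    [AddCommGroup W] [Module ℂ W] (f : ∀ y, Hilb.tensor (F.fib z y) (E.fib y x) →ₗ[ℂ] W)
    (a : (comp E F).fib z x) : compDesc E F f a = ∑ y, f y (compProj E F y a) := by
  simp [compDesc]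

/-- Equivariance of a map out of a convolution need only be checked on pure tensors, one summand at
a time: the degree of `w` permutes the summands and any arrow `v` of that degree implements the
action. -/
theorem compDesc_act (E : Kernel 𝒳 𝒴) (F : Kernel 𝒴 𝒵) {z z' : 𝒵.X} {x x' : 𝒳.X} {W W' : Type*}
    [AddCommGroup W] [Module ℂ W] [AddCommGroup W'] [Module ℂ W']
    (f : ∀ y, Hilb.tensor (F.fib z y) (E.fib y x) →ₗ[ℂ] W)
    (f' : ∀ y, Hilb.tensor (F.fib z' y) (E.fib y x') →ₗ[ℂ] W')
    (w : z ⟶ z') (u : x ⟶ x') (h : 𝒵.deg w = 𝒳.deg u) (T : W →ₗ[ℂ] W')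
    (hT : ∀ {y y' : 𝒴.X} (v : y ⟶ y') (h1 : 𝒵.deg w = 𝒴.deg v) (h2 : 𝒴.deg v = 𝒳.deg u) m l,
      f' y' (Hilb.tmul (F.act w v h1 m) (E.act v u h2 l)) = T (f y (Hilb.tmul m l)))
    (a : (comp E F).fib z x) :
    compDesc E F f' ((comp E F).act w u h a) = T (compDesc E F f a) := by
  rw [compDesc_apply, compDesc_apply, map_sum]
  refine (Fintype.sum_equiv (MulAction.toPerm (𝒵.deg w)) _ _ fun y => ?_).symm
  obtain ⟨y', hy⟩ : ∃ y', MulAction.toPerm (𝒵.deg w) y = y' := ⟨_, rfl⟩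
  rw [hy]
  obtain ⟨v, hv⟩ := 𝒴.full (𝒵.deg w) y y' hy
  rw [comp_act_apply E F w v u h hv.symm (hv.trans h)]
  generalize compProj E F y a = b
  refine Hilb.tensor_induction (p := fun b => T (f y b) = f' _ (pairAct E F w v u _ _ b)) ?_
    (fun m l => ?_) (fun c d hc hd => ?_) b
  · simp only [map_zero]
  · exact (hT v hv.symm (hv.trans h) m l).symm
  · simp only [map_add, hc, hd]

/-- A linear map out of a fibre of the identity, from its value at the generator. -/
def idDesc {y x : 𝒳.X} {W : Type*} [AddCommGroup W] [Module ℂ W] (t : y = x → W) :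
    (id 𝒳).fib y x →ₗ[ℂ] W :=
  ∑ j : EqType y x, LinearMap.toSpanSingleton ℂ W (t j.eq) ∘ₗ lineDown ∘ₗ idEv j.eq

theorem idDesc_self {x : 𝒳.X} {W : Type*} [AddCommGroup W] [Module ℂ W] (t : x = x → W)
    (a : (id 𝒳).fib x x) : idDesc t a = idCoord x a • t rfl := by
  have : Unique (EqType x x) := ⟨⟨⟨rfl⟩⟩, fun _ => Subsingleton.elim _ _⟩
  rw [idDesc, Fintype.sum_unique]
  rfl

/-- A morphism whose diagonal fibres are lines with an invariant generator and whose other fibres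
vanish is isomorphic to the identity. -/
theorem id_iso (E : Kernel 𝒳 𝒳) (t : ∀ x, E.fib x x) (ht : ∀ x, t x ≠ 0)
    (h1 : ∀ x, Module.finrank ℂ (E.fib x x) = 1) (h0 : ∀ y x, y ≠ x → Subsingleton (E.fib y x))
    (hact : ∀ {x x' : 𝒳.X} (u : x ⟶ x'), E.act u u rfl (t x) = t x') : Iso (id 𝒳) E := by
  refine iso_of_maps (fun y x => idDesc fun h => h ▸ t y) (fun y x => ?_)
    fun {y y' x x'} v u h a => ?_
  · by_cases hy : y = x
    · subst hy
      have h2 : Function.Bijective fun c : ℂ => c • t y :=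
        ⟨smul_left_injective ℂ (ht y), (finrank_eq_one_iff_of_nonzero' _ (ht y)).1 (h1 y)⟩
      have h3 := h2.comp (idCoord_bijective y)
      have h4 : ⇑(idDesc (y := y) (x := y) fun h => (h ▸ t y : E.fib y y)) =
          (fun c : ℂ => c • t y) ∘ idCoord y := funext fun a => idDesc_self _ a
      rwa [← h4] at h3
    · have h2 : Subsingleton ((id 𝒳).fib y x) := idFib_subsingleton hy
      have h3 := h0 y x hy
      exact ⟨Function.injective_of_subsingleton _, fun x => ⟨0, h3.elim _ _⟩⟩
  · by_cases hy : y = x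
    · subst hy
      obtain rfl : y' = x' := by rw [← 𝒳.deg_smul v, h, 𝒳.deg_smul u]
      -- Arrows of equal degree differ by a phase `z`, which acts on both bundles as multiplication
      -- by `z`; so invariance of the generator under `u ⊗ ū` suffices.
      obtain ⟨z, rfl⟩ := Gerbe.exists_sc u v h.symm
      rw [idDesc_self, idDesc_self, act_sc_left _ z u u rfl, act_sc_left _ z u u rfl,
        LinearMap.smul_apply, LinearMap.smul_apply, map_smul, idCoord_act, map_smul, hact,
        smul_eq_mul, mul_smul]
    · have h2 : Subsingleton ((id 𝒳).fib y x) := idFib_subsingleton hy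
      obtain rfl : a = 0 := h2.elim _ _
      simp only [map_zero]

end Kernel

/-! ### Compatibility of the associated bundles with composition -/

namespace TwoRep.Mor
variable {G : Type v} [Group G] {α β δ : TwoRep.{u, v} G} (σ : Mor α β) (ρ : Mor β δ)

theorem bundleMap_comp_app {σ ρ : Mor α β} (t : σ.fn ⟶ ρ.fn) (ht : ∀ g x,
    σ.co g x ≫ t.app ((α.act g).obj x) = (β.act g).map (t.app x) ≫ ρ.co g x)
    {m m' : β.H.ι} {i i' : α.H.ι} (b : Arr β m m') (a : Arr α i i') (h : b.deg = a.deg)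
    (l : β.H.e m ⟶ σ.fn.obj (α.H.e i)) :
    σ.bundleMap b a h l ≫ t.app (α.H.e i') = ρ.bundleMap b a h (l ≫ t.app (α.H.e i)) := by
  unfold bundleMap
  simp only [Category.assoc, Functor.map_comp]
  rw [t.naturality, ← Category.assoc (σ.co _ _), ht, Category.assoc]

theorem bundle_congr {σ ρ : Mor α β} (h : Iso σ ρ) : Kernel.Iso σ.bundle ρ.bundle := by
  obtain ⟨t, ht⟩ := h
  refine Kernel.iso_of_maps (fun m i => (Linear.rightComp ℂ (β.H.e m) (t.hom.app (α.H.e i)) :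
    (β.H.e m ⟶ σ.fn.obj (α.H.e i)) →ₗ[ℂ] (β.H.e m ⟶ ρ.fn.obj (α.H.e i)))) (fun m i => ?_)
    fun {m m' i i'} b a h l => ?_
  · refine Function.bijective_iff_has_inverse.2 ⟨(Linear.rightComp ℂ (β.H.e m) (t.inv.app (α.H.e i)) :
      (β.H.e m ⟶ ρ.fn.obj (α.H.e i)) →ₗ[ℂ] (β.H.e m ⟶ σ.fn.obj (α.H.e i))),
      fun (l : β.H.e m ⟶ σ.fn.obj (α.H.e i)) => ?_, fun (l : β.H.e m ⟶ ρ.fn.obj (α.H.e i)) => ?_⟩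
    · change (l ≫ _) ≫ _ = l
      rw [Category.assoc, ← NatTrans.comp_app, t.hom_inv_id, NatTrans.id_app, Category.comp_id]
    · change (l ≫ _) ≫ _ = l
      rw [Category.assoc, ← NatTrans.comp_app, t.inv_hom_id, NatTrans.id_app, Category.comp_id]
  · change σ.bundleMap b a h l ≫ t.hom.app (α.H.e i') = ρ.bundleMap b a h (l ≫ t.hom.app (α.H.e i))
    exact bundleMap_comp_app t.hom ht b a h l

/-- By Schur's lemma the fibre `Hom(e m, e i)` is zero off the diagonal and spanned by the identity
on it. That generator is invariant because `a ≫ a* = 𝟙` for a unitary `a`. -/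
theorem bundle_id (α : TwoRep.{u, v} G) :
    Kernel.Iso (Kernel.id α.assocGerbe) (Mor.id α).bundle := by
  refine Kernel.id_iso (Mor.id α).bundle (fun i => 𝟙 (α.H.e i)) MarkedTwoHilb.id_e_ne_zero
    α.H.simple_e (fun m i h => ⟨fun s t => ?_⟩) (fun {i i'} a => ?_)
  · exact (MarkedTwoHilb.hom_e_eq_zero h s).trans (MarkedTwoHilb.hom_e_eq_zero h t).symm
  · change a.hom ≫ (α.act a.deg).map (𝟙 _) ≫ 𝟙 _ ≫ dagger (a.hom ≫ α.cast rfl _) = _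
    rw [cast_rfl, Category.comp_id, (α.act _).map_id, Category.id_comp, Category.id_comp,
      a.unitary.1]

/-- The composition `f ⊗ l ↦ f ≫ ρ l`. -/
def compositionMap (n : δ.H.ι) (m : β.H.ι) (i : α.H.ι) :
    Hilb.tensor (homHilb (δ.H.e n) (ρ.fn.obj (β.H.e m))) (homHilb (β.H.e m) (σ.fn.obj (α.H.e i)))
      →ₗ[ℂ] (δ.H.e n ⟶ ρ.fn.obj (σ.fn.obj (α.H.e i))) :=
  TensorProduct.lift ((Linear.comp (S := ℂ) (δ.H.e n) (ρ.fn.obj (β.H.e m))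
    (ρ.fn.obj (σ.fn.obj (α.H.e i)))).compl₂ (ρ.star.mapLin _ _))

theorem compositionMap_homTmul {n : δ.H.ι} {m : β.H.ι} {i : α.H.ι}
    (f : δ.H.e n ⟶ ρ.fn.obj (β.H.e m)) (l : β.H.e m ⟶ σ.fn.obj (α.H.e i)) :
    compositionMap σ ρ n m i (homTmul f l) = f ≫ ρ.fn.map l := rfl

/-- The components of the inverse of the map given by composition. -/
def compositionInv (n : δ.H.ι) (i : α.H.ι) (m : β.H.ι) :
    (δ.H.e n ⟶ ρ.fn.obj (σ.fn.obj (α.H.e i))) →ₗ[ℂ] Hilb.tensor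
      (homHilb (δ.H.e n) (ρ.fn.obj (β.H.e m))) (homHilb (β.H.e m) (σ.fn.obj (α.H.e i))) :=
  (β.H.k m : ℂ) • ∑ a, homTmul.flip (homBasis (β.H.e m) (σ.fn.obj (α.H.e i)) a) ∘ₗ
      Linear.rightComp ℂ (δ.H.e n) (ρ.fn.map (dagger (homBasis (β.H.e m) (σ.fn.obj (α.H.e i)) a)))

theorem compositionInv_apply (n : δ.H.ι) (i : α.H.ι) (m : β.H.ι)
    (f : δ.H.e n ⟶ ρ.fn.obj (σ.fn.obj (α.H.e i))) : compositionInv σ ρ n i m f =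
      (β.H.k m : ℂ) • ∑ a, homTmul
        (f ≫ ρ.fn.map (dagger (homBasis (β.H.e m) (σ.fn.obj (α.H.e i)) a)))
        (homBasis (β.H.e m) (σ.fn.obj (α.H.e i)) a) := by
  rw [compositionInv, LinearMap.smul_apply, LinearMap.sum_apply]
  rfl

/-- By Schur's lemma `l ≫ b*` is the scalar `(b, l) / k m`. Moved across the tensor sign, these
scalars reassemble `l`, and the prefactor `k m` cancels. -/
theorem compositionInv_compositionMap (n : δ.H.ι) (i : α.H.ι) (m : β.H.ι)
    (c : Hilb.tensor (homHilb (δ.H.e n) (ρ.fn.obj (β.H.e m)))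
      (homHilb (β.H.e m) (σ.fn.obj (α.H.e i)))) :
    compositionInv σ ρ n i m (compositionMap σ ρ n m i c) = c := by
  refine homTmul_induction
    (p := fun c => compositionInv σ ρ n i m (compositionMap σ ρ n m i c) = c) ?_
    (fun f l => ?_) (fun c d hc hd => ?_) c
  · simp only [map_zero]
  · rw [compositionMap_homTmul, compositionInv_apply, Finset.smul_sum]
    conv_rhs => rw [← sum_homBasis l, map_sum]
    refine Finset.sum_congr rfl fun a _ => ?_
    rw [map_smul, Category.assoc, ← ρ.fn.map_comp, MarkedTwoHilb.comp_dagger_e, ρ.star.map_smul,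
      ρ.fn.map_id, Linear.comp_smul, Category.comp_id, map_smul, LinearMap.smul_apply,
      smul_smul, mul_inv_cancel_left₀ (MarkedTwoHilb.k_ne_zero m)]
  · simp only [map_add, hc, hd]

theorem compositionInv_compositionMap_of_ne (n : δ.H.ι) (i : α.H.ι) {m m' : β.H.ι} (hm : m' ≠ m)
    (c : Hilb.tensor (homHilb (δ.H.e n) (ρ.fn.obj (β.H.e m')))
      (homHilb (β.H.e m') (σ.fn.obj (α.H.e i)))) :
    compositionInv σ ρ n i m (compositionMap σ ρ n m' i c) = 0 := by
  refine homTmul_induction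
    (p := fun c => compositionInv σ ρ n i m (compositionMap σ ρ n m' i c) = 0) ?_
    (fun f l => ?_) (fun c d hc hd => ?_) c
  · simp only [map_zero]
  · rw [compositionMap_homTmul, compositionInv_apply, Finset.sum_eq_zero fun a _ => ?_, smul_zero]
    have h0 : ρ.fn.map (0 : β.H.e m' ⟶ β.H.e m) = 0 := (ρ.star.mapLin _ _).map_zero
    rw [Category.assoc, ← ρ.fn.map_comp, MarkedTwoHilb.hom_e_eq_zero hm (l ≫ _), h0, comp_zero,
      map_zero, LinearMap.zero_apply]
  · simp only [map_add, hc, hd, add_zero]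

/-- This is the image under `ρ` of the decomposition of the identity of `σ(e i)`, precomposed with
`f`. -/
theorem sum_compositionMap_compositionInv (n : δ.H.ι) (i : α.H.ι)
    (f : δ.H.e n ⟶ ρ.fn.obj (σ.fn.obj (α.H.e i))) :
    ∑ m, compositionMap σ ρ n m i (compositionInv σ ρ n i m f) = f := by
  have h1 : (Linear.leftComp ℂ _ f ∘ₗ ρ.star.mapLin _ _) (𝟙 (σ.fn.obj (α.H.e i))) = f := by
    change f ≫ ρ.fn.map (𝟙 _) = f
    rw [ρ.fn.map_id, Category.comp_id]
  conv_rhs => rw [← h1, ← MarkedTwoHilb.sum_dagger_comp (σ.fn.obj (α.H.e i)), map_sum]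
  refine Finset.sum_congr rfl fun m _ => ?_
  rw [compositionInv_apply, map_smul, map_smul, map_sum, map_sum]
  refine congrArg _ (Finset.sum_congr rfl fun a _ => ?_)
  rw [compositionMap_homTmul, Category.assoc, ← ρ.fn.map_comp]
  rfl

theorem compDesc_compositionMap_bijective (n : δ.H.ι) (i : α.H.ι) :
    Function.Bijective (Kernel.compDesc σ.bundle ρ.bundle (z := n) (x := i)
      fun m => compositionMap σ ρ n m i) := by
  refine Function.bijective_iff_has_inverse.2 ⟨fun f m => compositionInv σ ρ n i m f,
    fun a => Kernel.comp_ext σ.bundle ρ.bundle fun m => ?_, fun f =>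
      (Kernel.compDesc_apply _ _ _ _).trans (sum_compositionMap_compositionInv σ ρ n i f)⟩
  refine (congrArg (compositionInv σ ρ n i m) (Kernel.compDesc_apply _ _ _ a)).trans ?_
  refine (map_sum (compositionInv σ ρ n i m) _ _).trans ?_
  refine (Finset.sum_eq_single m (fun m' _ hm => ?_) fun h => absurd (Finset.mem_univ m) h).trans
    (compositionInv_compositionMap σ ρ n i m (Kernel.compProj σ.bundle ρ.bundle m a))
  exact compositionInv_compositionMap_of_ne σ ρ n i hm (Kernel.compProj σ.bundle ρ.bundle m' a)

/-- The composition map is bijective by semisimplicity. It is equivariant because an arrow `v` of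
the middle gerbe enters the two tensor factors as `v*` and `v`, which cancel by unitarity. -/
theorem bundle_comp : Kernel.Iso (Kernel.comp σ.bundle ρ.bundle) (σ.comp ρ).bundle := by
  refine Kernel.iso_of_maps (fun n i => Kernel.compDesc σ.bundle ρ.bundle
    (W := δ.H.e n ⟶ ρ.fn.obj (σ.fn.obj (α.H.e i))) fun m => compositionMap σ ρ n m i) (fun n i => ?_)
    fun {n n' i i'} c a h l => ?_
  · exact compDesc_compositionMap_bijective σ ρ n i
  · refine Kernel.compDesc_act σ.bundle ρ.bundle (fun m => compositionMap σ ρ n m i)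
      (fun m => compositionMap σ ρ n' m i') c a h ((σ.comp ρ).bundleLin c a h)
      (fun {m m'} b h1 h2 (f : δ.H.e n ⟶ ρ.fn.obj (β.H.e m)) (l : β.H.e m ⟶ σ.fn.obj (α.H.e i)) => ?_) l
    change ρ.bundleMap c b h1 f ≫ ρ.fn.map (σ.bundleMap b a h2 l) =
      (σ.comp ρ).bundleMap c a h (f ≫ ρ.fn.map l)
    obtain ⟨g, w, hw⟩ := c
    obtain ⟨g₁, v, hv⟩ := b
    obtain ⟨g₂, u, hu⟩ := a
    obtain rfl : g = g₁ := h1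
    obtain rfl : g = g₂ := h2
    change (w ≫ (δ.act g).map f ≫ ρ.co g _ ≫ ρ.fn.map (dagger (v ≫ β.cast rfl _))) ≫
      ρ.fn.map (v ≫ (β.act g).map l ≫ σ.co g _ ≫ σ.fn.map (dagger (u ≫ α.cast rfl _))) =
      w ≫ (δ.act g).map (f ≫ ρ.fn.map l) ≫ (ρ.co g _ ≫ ρ.fn.map (σ.co g _)) ≫
        ρ.fn.map (σ.fn.map (dagger (u ≫ α.cast rfl _)))
    simp only [cast_rfl, Category.comp_id, Category.assoc, Functor.map_comp]
    rw [← Category.assoc (ρ.fn.map (dagger v)), ← ρ.fn.map_comp, hv.2, ρ.fn.map_id, Category.id_comp,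
      ← Category.assoc (ρ.co g _), ← co_naturality, Category.assoc]

end TwoRep.Mor

/-- The associated gerbe as a functor. -/
def TwoRep.gerbeFunctor {G : Type v} [Group G] :
    FunctorOn fun α : TwoRep.{u, v} G => α.assocGerbe where
  map := Quotient.lift (fun σ => σ.bundle.toHom) fun σ ρ h => Quotient.sound (Mor.bundle_congr h)
  map_id α := Quotient.sound (Mor.bundle_id α).symm
  map_comp := by
    rintro α β δ ⟨σ⟩ ⟨ρ⟩
    exact Quotient.sound (Mor.bundle_comp σ ρ).symm

/-! ## Sections of the geometric character -/

namespace Gerbe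
variable {G : Type v} [Group G] {𝒳 : Gerbe.{v} G}

/-- The value at a loop of a section of the line bundle of the transgression. -/
def evalLoop {x : 𝒳.X} {g : G} (u : 𝒳.Loop x g) : 𝒳.geomChar.fibre g →ₗ[ℂ] ℂ where
  toFun ψ := (show (𝒳.loopTor u.fixPt.loop).lineSpace from
    pushEval 𝒳.k 𝒳.k_pos (𝒳.transgression ⋙ U1Tor.lineFunctor) u.fixPt ψ).1 u
  map_add' _ _ := rfl
  map_smul' _ _ := rfl

/-- A chosen loop over a fixed point. -/
def someLoop {g : G} (x : FixPt 𝒳.X g) : 𝒳.Loop x.pt g := (𝒳.loopTor x.loop).nonempty.some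

theorem evalLoop_smul {x : 𝒳.X} {g : G} (z : Circle) (u : 𝒳.Loop x g) (ψ : 𝒳.geomChar.fibre g) :
    evalLoop (z • u) ψ = ((z⁻¹ : Circle) : ℂ) * evalLoop u ψ :=
  (show (𝒳.loopTor u.fixPt.loop).lineSpace from
    pushEval 𝒳.k 𝒳.k_pos (𝒳.transgression ⋙ U1Tor.lineFunctor) u.fixPt ψ).2 z u

theorem exists_smul_loop {x : 𝒳.X} {g : G} (u u' : 𝒳.Loop x g) : ∃ z : Circle, u' = z • u := by
  obtain ⟨z, hz⟩ := exists_sc u.arr u'.arr (u.deg_eq.trans u'.deg_eq.symm)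
  exact ⟨z, Loop.ext hz⟩

/-- A section is determined by its values at loops. Working with these values, homogeneous of degree
`-1` under phases, avoids the lines of the torsors from here on. -/
theorem section_ext {g : G} {ψ ψ' : 𝒳.geomChar.fibre g}
    (h : ∀ (x : 𝒳.X) (u : 𝒳.Loop x g), evalLoop u ψ = evalLoop u ψ') : ψ = ψ' :=
  push_ext _ _ _ fun x => U1Tor.lineSpace_ext (𝒳.loopTor x.loop) (someLoop x) (h _ (someLoop x))

/-- The section with prescribed values at the loops. -/
def mkSection {g : G} (c : ∀ x : 𝒳.X, 𝒳.Loop x g → ℂ)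
    (hc : ∀ x (z : Circle) (u : 𝒳.Loop x g), c x (z • u) = ((z⁻¹ : Circle) : ℂ) * c x u) :
    𝒳.geomChar.fibre g :=
  fun x : FixPt 𝒳.X g => (⟨fun u => c x.pt u, fun z u => hc x.pt z u⟩ :
    (𝒳.loopTor x.loop).lineSpace)

theorem evalLoop_mkSection {g : G} (c : ∀ x : 𝒳.X, 𝒳.Loop x g → ℂ)
    (hc : ∀ x (z : Circle) (u : 𝒳.Loop x g), c x (z • u) = ((z⁻¹ : Circle) : ℂ) * c x u)
    {x : 𝒳.X} (u : 𝒳.Loop x g) : evalLoop u (mkSection c hc) = c x u := rfl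

/-- Conjugation of a loop by an arrow. -/
def conjBy {x x' : 𝒳.X} {g g' : G} (w : x ⟶ x') (h : 𝒳.deg w * g * (𝒳.deg w)⁻¹ = g')
    (u : 𝒳.Loop x g) : 𝒳.Loop x' g' :=
  ⟨Groupoid.inv w ≫ u.arr ≫ w, by rw [𝒳.deg_comp, 𝒳.deg_comp, deg_inv, u.deg_eq, h]⟩

theorem exists_conjBy {x x' : 𝒳.X} {g g' : G} (w : x ⟶ x') (h : 𝒳.deg w * g * (𝒳.deg w)⁻¹ = g')
    (u' : 𝒳.Loop x' g') : ∃ u, u' = conjBy w h u := by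
  refine ⟨⟨w ≫ u'.arr ≫ Groupoid.inv w, ?_⟩, Loop.ext ?_⟩
  · rw [𝒳.deg_comp, 𝒳.deg_comp, deg_inv, u'.deg_eq, ← h]
    group
  · simp [conjBy]

/-- The transgression acts through an arbitrarily chosen arrow of the given degree, but conjugation
of loops is insensitive to its phase, so any `w` may be used. -/
theorem evalLoop_map {x x' : 𝒳.X} {a b : LoopBG G} (h : a ⟶ b) (w : x ⟶ x')
    (hw : 𝒳.deg w = h.elt) (hd : 𝒳.deg w * a.pt * (𝒳.deg w)⁻¹ = b.pt) (u : 𝒳.Loop x a.pt)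
    (ψ : 𝒳.geomChar.fibre a.pt) :
    evalLoop (conjBy w hd u) ((𝒳.geomChar.functor.map h).lin ψ : 𝒳.geomChar.fibre b.pt) =
      evalLoop u ψ := by
  let m : u.fixPt.loop ⟶ (conjBy w hd u).fixPt.loop :=
    ⟨h.elt, by rw [← hw]; exact 𝒳.deg_smul w, h.conj_eq⟩
  have h1 := pushMap_apply 𝒳.k 𝒳.k_pos (𝒳.transgression ⋙ U1Tor.lineFunctor) h.elt h.conj_eq
    u.fixPt (conjBy w hd u).fixPt m rfl ψ
  have h2 : (𝒳.transgression.map m).toFun u = conjBy w hd u :=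
    (conjLoop_indep m (chosenLift m) w (deg_chosenLift m) hw u).trans rfl
  refine (congrArg (fun f : (𝒳.loopTor (conjBy w hd u).fixPt.loop).lineSpace =>
    f.1 (conjBy w hd u)) h1).trans ?_
  refine Eq.trans ?_ (U1Tor.lineMap_apply (𝒳.transgression.map m) _ u)
  rw [h2]
  rfl

theorem inner_section {g : G} (ψ ψ' : 𝒳.geomChar.fibre g) :
    (𝒳.geomChar.fibre g).inner ψ ψ' = ∑ x : FixPt 𝒳.X g,
      (𝒳.k x.pt : ℂ) * (conj (evalLoop (someLoop x) ψ) * evalLoop (someLoop x) ψ') := by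
  refine Finset.sum_congr rfl fun x _ => congrArg _ ?_
  exact U1Tor.inner_line (𝒳.loopTor x.loop) _ _ (someLoop x)

theorem evalLoop_localSection {x : 𝒳.X} {g : G} (u : 𝒳.Loop x g) :
    evalLoop u (localSection u) = ((1 / Real.sqrt (𝒳.k x) : ℝ) : ℂ) := by
  classical
  have h := Pi.single_eq_same (M := fun y : FixPt 𝒳.X g => (𝒳.loopTor y.loop).lineSpace) u.fixPt
    ((𝒳.loopTor u.fixPt.loop).tmul u ((1 / Real.sqrt (𝒳.k x) : ℝ) : ℂ))
  refine Eq.trans ?_ (U1Tor.tmul_apply (𝒳.loopTor u.fixPt.loop) u _)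
  refine congrArg (fun f : (𝒳.loopTor u.fixPt.loop).lineSpace => f.1 u) (Eq.trans ?_ h)
  change localSection u u.fixPt = _
  unfold localSection
  congr!

theorem evalLoop_localSection_of_ne {x y : 𝒳.X} {g : G} (u : 𝒳.Loop x g) (w : 𝒳.Loop y g)
    (hy : w.fixPt ≠ u.fixPt) : evalLoop w (localSection u) = 0 := by
  classical
  have h := Pi.single_eq_of_ne (M := fun y : FixPt 𝒳.X g => (𝒳.loopTor y.loop).lineSpace) hy
    ((𝒳.loopTor u.fixPt.loop).tmul u ((1 / Real.sqrt (𝒳.k x) : ℝ) : ℂ))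
  refine congrArg (fun f : (𝒳.loopTor w.fixPt.loop).lineSpace => f.1 w) (Eq.trans ?_ h)
  change localSection u w.fixPt = _
  unfold localSection
  congr!

theorem ofReal_sqrt_k_ne_zero (x : 𝒳.X) : ((Real.sqrt (𝒳.k x) : ℝ) : ℂ) ≠ 0 := by
  exact_mod_cast (Real.sqrt_pos.2 (𝒳.k_pos x)).ne'

theorem ofReal_sqrt_k_mul_self (x : 𝒳.X) :
    ((Real.sqrt (𝒳.k x) : ℝ) : ℂ) * ((Real.sqrt (𝒳.k x) : ℝ) : ℂ) = 𝒳.k x := by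
  exact_mod_cast Real.mul_self_sqrt (𝒳.k_pos x).le

/-- The weight `k x` of the inner product times the normalisation `k_x^(-1/2)` of the section leaves
`k_x^(1/2)`. -/
theorem inner_localSection {x : 𝒳.X} {g : G} (u : 𝒳.Loop x g) (ψ : 𝒳.geomChar.fibre g) :
    (𝒳.geomChar.fibre g).inner (localSection u) ψ =
      ((Real.sqrt (𝒳.k x) : ℝ) : ℂ) * evalLoop u ψ := by
  rw [inner_section, Finset.sum_eq_single u.fixPt]
  · have h : ∀ z : Circle, conj (((z⁻¹ : Circle) : ℂ)) * ((z⁻¹ : Circle) : ℂ) = 1 := by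
      intro z
      rw [← Complex.normSq_eq_conj_mul_self, Circle.normSq_coe, Complex.ofReal_one]
    obtain ⟨w, hw⟩ : ∃ w : 𝒳.Loop x g, w = someLoop u.fixPt := ⟨_, rfl⟩
    change (𝒳.k x : ℂ) * (conj (evalLoop (x := x) (someLoop u.fixPt) _) *
      evalLoop (x := x) (someLoop u.fixPt) ψ) = _
    rw [← hw]
    -- The loop used to evaluate the inner product differs from `u` by a phase, which cancels
    -- between the two values.
    obtain ⟨z, rfl⟩ := exists_smul_loop u w
    rw [evalLoop_smul, evalLoop_smul, map_mul, evalLoop_localSection, mul_mul_mul_comm, h, one_mul,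
      Complex.conj_ofReal, ← ofReal_sqrt_k_mul_self]
    have := ofReal_sqrt_k_ne_zero x
    push_cast
    field_simp
  · intro y _ hy
    rw [evalLoop_localSection_of_ne u (someLoop y) hy, map_zero, zero_mul, mul_zero]
  · intro h
    exact absurd (Finset.mem_univ _) h

theorem k_eq {x x' : 𝒳.X} (u : x ⟶ x') : 𝒳.k x = 𝒳.k x' := by
  rw [← 𝒳.deg_smul u, 𝒳.k_smul]

end Gerbe

/-! ## The geometric character of a morphism of gerbes -/

namespace Kernel
variable {G : Type v} [Group G] {𝒳 𝒴 𝒵 : Gerbe.{v} G}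

/-- The trace of `E (v ⊗ ū)`, for loops `v` and `u` of the same degree. -/
def tr (E : Kernel 𝒳 𝒴) {y : 𝒴.X} {x : 𝒳.X} {g : G} (v : 𝒴.Loop y g) (u : 𝒳.Loop x g) : ℂ :=
  LinearMap.trace ℂ (E.fib y x) (E.act v.arr u.arr (v.deg_eq.trans u.deg_eq.symm))

theorem tr_smul_left (E : Kernel 𝒳 𝒴) {y : 𝒴.X} {x : 𝒳.X} {g : G} (z : Circle) (v : 𝒴.Loop y g)
    (u : 𝒳.Loop x g) : E.tr (z • v) u = (z : ℂ) * E.tr v u := by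
  refine (congrArg _ (E.act_sc_left z v.arr u.arr (v.deg_eq.trans u.deg_eq.symm) _)).trans ?_
  rw [map_smul, smul_eq_mul]
  rfl

theorem tr_smul_right (E : Kernel 𝒳 𝒴) {y : 𝒴.X} {x : 𝒳.X} {g : G} (z : Circle) (v : 𝒴.Loop y g)
    (u : 𝒳.Loop x g) : E.tr v (z • u) = ((z⁻¹ : Circle) : ℂ) * E.tr v u := by
  refine (congrArg _ (E.act_sc_right z v.arr u.arr (v.deg_eq.trans u.deg_eq.symm) _)).trans ?_
  rw [map_smul, smul_eq_mul]
  rfl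

/-- The operator `E(w ⊗ ā)` conjugates `E(v ⊗ ū)` into the operator of the conjugated loops, and the
trace is invariant under conjugation. -/
theorem tr_conjBy (E : Kernel 𝒳 𝒴) {y y' : 𝒴.X} {x x' : 𝒳.X} {g g' : G} (w : y ⟶ y') (a : x ⟶ x')
    (hwa : 𝒴.deg w = 𝒳.deg a) (hw : 𝒴.deg w * g * (𝒴.deg w)⁻¹ = g')
    (ha : 𝒳.deg a * g * (𝒳.deg a)⁻¹ = g') (v : 𝒴.Loop y g) (u : 𝒳.Loop x g) :
    E.tr (Gerbe.conjBy w hw v) (Gerbe.conjBy a ha u) = E.tr v u := by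
  have h1 : 𝒴.deg (Groupoid.inv w) = 𝒳.deg (Groupoid.inv a) := by
    rw [Gerbe.deg_inv, Gerbe.deg_inv, hwa]
  have h2 : 𝒴.deg v.arr = 𝒳.deg u.arr := v.deg_eq.trans u.deg_eq.symm
  have h3 : 𝒴.deg (v.arr ≫ w) = 𝒳.deg (u.arr ≫ a) := by rw [𝒴.deg_comp, 𝒳.deg_comp, h2, hwa]
  have h4 : 𝒴.deg (w ≫ Groupoid.inv w) = 𝒳.deg (a ≫ Groupoid.inv a) := by
    rw [𝒴.deg_comp, 𝒳.deg_comp, h1, hwa]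
  have h5 : E.act (w ≫ Groupoid.inv w) (a ≫ Groupoid.inv a) h4 = LinearMap.id := by
    have : ∀ (p : y ⟶ y) (q : x ⟶ x) (hp : p = 𝟙 y) (hq : q = 𝟙 x) (h : 𝒴.deg p = 𝒳.deg q),
        E.act p q h = LinearMap.id := by
      rintro _ _ rfl rfl h
      exact E.act_id y x h
    exact this _ _ (Groupoid.comp_inv w) (Groupoid.comp_inv a) h4
  refine (congrArg _ (E.act_comp _ _ h1 _ _ h3 _)).trans ?_
  rw [LinearMap.trace_comp_comm', E.act_comp _ _ h2 _ _ hwa h3, ← LinearMap.comp_assoc,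
    ← E.act_comp _ _ hwa _ _ h1 h4, h5, LinearMap.id_comp]
  rfl

theorem Iso.tr_eq {E F : Kernel 𝒳 𝒴} (h : Iso E F) {y : 𝒴.X} {x : 𝒳.X} {g : G} (v : 𝒴.Loop y g)
    (u : 𝒳.Loop x g) : E.tr v u = F.tr v u := by
  obtain ⟨θ, hb, hn⟩ := h.maps
  rw [tr, tr, ← LinearMap.trace_conj' _ (LinearEquiv.ofBijective _ (hb y x))]
  refine congrArg _ (LinearMap.ext fun a => ?_)
  obtain ⟨b, rfl⟩ := (LinearEquiv.ofBijective _ (hb y x)).surjective a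
  rw [LinearEquiv.conj_apply_apply, LinearEquiv.symm_apply_apply]
  exact hn _ _ _ b

theorem tr_id_self {x : 𝒳.X} {g : G} (u : 𝒳.Loop x g) : (id 𝒳).tr u u = 1 := by
  have h : (id 𝒳).act u.arr u.arr rfl = LinearMap.id :=
    LinearMap.ext fun a => (idCoord_bijective x).1 (idCoord_act u.arr a)
  rw [tr, h, LinearMap.trace_id,
    (LinearEquiv.ofBijective (idCoord x) (idCoord_bijective x)).finrank_eq, Module.finrank_self,
    Nat.cast_one]

theorem tr_id_of_ne {y x : 𝒳.X} (h : y ≠ x) {g : G} (v : 𝒳.Loop y g) (u : 𝒳.Loop x g) :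
    (id 𝒳).tr v u = 0 := by
  have : Subsingleton ((id 𝒳).fib y x) := idFib_subsingleton h
  rw [tr, Subsingleton.elim ((id 𝒳).act v.arr u.arr _) 0, map_zero]

/-! ### Traces on a convolution -/

section comp
variable (E : Kernel 𝒳 𝒴) (F : Kernel 𝒴 𝒵)

/-- The inclusion of a summand of a fibre of the composite. -/
def compIncl [DecidableEq 𝒴.X] {z : 𝒵.X} {x : 𝒳.X} (y : 𝒴.X) :
    Hilb.tensor (F.fib z y) (E.fib y x) →ₗ[ℂ] (comp E F).fib z x :=
  LinearMap.single ℂ (fun y => (Hilb.tensor (F.fib z y) (E.fib y x) : Type v)) y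

theorem compProj_compIncl_self [DecidableEq 𝒴.X] {z : 𝒵.X} {x : 𝒳.X} (y : 𝒴.X)
    (a : Hilb.tensor (F.fib z y) (E.fib y x)) : compProj E F y (compIncl E F y a) = a :=
  Pi.single_eq_same (M := fun y => (Hilb.tensor (F.fib z y) (E.fib y x) : Type v)) y a

theorem compProj_compIncl_of_ne [DecidableEq 𝒴.X] {z : 𝒵.X} {x : 𝒳.X} {y y' : 𝒴.X} (h : y' ≠ y)
    (a : Hilb.tensor (F.fib z y) (E.fib y x)) : compProj E F y' (compIncl E F y a) = 0 :=
  Pi.single_eq_of_ne (M := fun y => (Hilb.tensor (F.fib z y) (E.fib y x) : Type v)) h a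

theorem sum_compIncl_compProj [DecidableEq 𝒴.X] (z : 𝒵.X) (x : 𝒳.X) :
    ∑ y, compIncl E F (z := z) (x := x) y ∘ₗ compProj E F y = LinearMap.id := by
  refine LinearMap.ext fun a => comp_ext E F fun y => ?_
  rw [LinearMap.sum_apply, map_sum, Finset.sum_eq_single y]
  · exact compProj_compIncl_self E F y _
  · intro y' _ h
    exact compProj_compIncl_of_ne E F h.symm _
  · intro h
    exact absurd (Finset.mem_univ _) h

/-- The operator permutes the summands as `g` permutes the points of the middle gerbe, so only fixed
points give diagonal blocks, and the trace of a tensor product is the product of the traces. The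
factors `1 / k y` rescale inner products only and do not affect traces. -/
theorem tr_comp {z : 𝒵.X} {x : 𝒳.X} {g : G} (w : 𝒵.Loop z g) (u : 𝒳.Loop x g) :
    (comp E F).tr w u =
      ∑ y : FixPt 𝒴.X g, F.tr w (Gerbe.someLoop y) * E.tr (Gerbe.someLoop y) u := by
  classical
  -- The trace of a block operator is the sum of the traces of its diagonal blocks.
  have hA : ∀ A : (comp E F).fib z x →ₗ[ℂ] (comp E F).fib z x, LinearMap.trace ℂ _ A =
      ∑ y, LinearMap.trace ℂ _ (compProj E F y ∘ₗ A ∘ₗ compIncl E F y) := by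
    intro A
    have h : A = ∑ y, A ∘ₗ compIncl E F y ∘ₗ compProj E F y := LinearMap.ext fun a => by
      conv_lhs => rw [← LinearMap.id_apply (R := ℂ) a, ← sum_compIncl_compProj E F z x]
      simp only [LinearMap.sum_apply, map_sum, LinearMap.comp_apply]
    conv_lhs => rw [h, map_sum]
    refine Finset.sum_congr rfl fun y _ => ?_
    rw [← LinearMap.comp_assoc, LinearMap.trace_comp_comm']
  rw [tr, hA]
  refine (Fintype.sum_of_injective FixPt.pt (fun _ _ h => FixPt.ext h) _ _ (fun y hy => ?_)
    fun y => ?_).symm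
  -- At a point that is not fixed the diagonal block is zero, since the summand of `y` receives only
  -- the summand of `g⁻¹ y`.
  · refine Eq.trans (congrArg _ (LinearMap.ext fun a => ?_)) (map_zero _)
    have hy' : (𝒵.deg w.arr)⁻¹ • y ≠ y := by
      intro h
      refine hy ⟨⟨y, ?_⟩, rfl⟩
      rw [← w.deg_eq]
      exact (inv_smul_eq_iff.1 h).symm
    refine (comp_act_apply E F w.arr (chosen (𝒵.deg w.arr) y) u.arr
      (w.deg_eq.trans u.deg_eq.symm) (deg_chosen _ _).symm
      ((deg_chosen _ _).trans (w.deg_eq.trans u.deg_eq.symm)) (compIncl E F y a)).trans ?_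
    rw [compProj_compIncl_of_ne E F hy', map_zero]
    rfl
  · have h1 : 𝒵.deg w.arr = 𝒴.deg (Gerbe.someLoop y).arr :=
      w.deg_eq.trans (Gerbe.someLoop y).deg_eq.symm
    have h2 : 𝒴.deg (Gerbe.someLoop y).arr = 𝒳.deg u.arr :=
      (Gerbe.someLoop y).deg_eq.trans u.deg_eq.symm
    have h3 : compProj E F y.pt ∘ₗ (comp E F).act w.arr u.arr (w.deg_eq.trans u.deg_eq.symm) ∘ₗ
        compIncl E F y.pt = pairAct E F w.arr (Gerbe.someLoop y).arr u.arr h1 h2 := by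
      refine LinearMap.ext fun a => ?_
      refine (comp_act_apply E F w.arr (Gerbe.someLoop y).arr u.arr _ h1 h2 _).trans ?_
      rw [compProj_compIncl_self]
    rw [h3]
    exact (LinearMap.trace_tensorProduct' (R := ℂ) (M := F.fib z y.pt) (N := E.fib y.pt x) _ _).symm

end comp

/-! ### Matrix coefficients and functoriality of the geometric character -/

section character
variable (E : Kernel 𝒳 𝒴)
open Gerbe

/-- Changing the loop by a phase multiplies the two factors by conjugate phases. Hence the formula
for the induced map does not depend on the loops chosen over the fixed points. -/
theorem conj_tr_mul_evalLoop {x : 𝒳.X} {y : 𝒴.X} {g : G} (v : 𝒴.Loop y g) (u u' : 𝒳.Loop x g)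
    (ψ : 𝒳.geomChar.fibre g) :
    conj (E.tr v u) * evalLoop u ψ = conj (E.tr v u') * evalLoop u' ψ := by
  obtain ⟨z, rfl⟩ := exists_smul_loop u u'
  rw [tr_smul_right, evalLoop_smul, map_mul, mul_mul_mul_comm, ← Complex.normSq_eq_conj_mul_self,
    Circle.normSq_coe, Complex.ofReal_one, one_mul]

/-- The map of geometric characters over `g` induced by a morphism of gerbes. -/
def charLin (g : G) : 𝒳.geomChar.fibre g →ₗ[ℂ] 𝒴.geomChar.fibre g where
  -- The square roots are forced by the prescribed matrix coefficients: pairing with the local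
  -- section of `v` multiplies the value at `v` by `k_y^(1/2)`, and the local section of `u` has
  -- value `k_x^(-1/2)` at `u`.
  toFun ψ := mkSection (fun y v => ((Real.sqrt (𝒴.k y) : ℝ) : ℂ)⁻¹ * ∑ x : FixPt 𝒳.X g,
      ((Real.sqrt (𝒳.k x.pt) : ℝ) : ℂ) *
        (conj (E.tr v (someLoop x)) * evalLoop (someLoop x) ψ)) fun y z v => by
    simp only [tr_smul_left, map_mul, ← Circle.coe_inv_eq_conj, Finset.mul_sum]
    exact Finset.sum_congr rfl fun x _ => by ring
  map_add' ψ ψ' := section_ext fun y v => by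
    rw [map_add]
    simp only [evalLoop_mkSection, map_add, mul_add, Finset.sum_add_distrib]
  map_smul' c ψ := section_ext fun y v => by
    rw [map_smul]
    simp only [evalLoop_mkSection, map_smul, smul_eq_mul, Finset.mul_sum, RingHom.id_apply]
    exact Finset.sum_congr rfl fun x _ => by ring

theorem evalLoop_charLin {y : 𝒴.X} {g : G} (v : 𝒴.Loop y g) (ψ : 𝒳.geomChar.fibre g) :
    evalLoop v (E.charLin g ψ) = ((Real.sqrt (𝒴.k y) : ℝ) : ℂ)⁻¹ * ∑ x : FixPt 𝒳.X g,
      ((Real.sqrt (𝒳.k x.pt) : ℝ) : ℂ) *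
        (conj (E.tr v (someLoop x)) * evalLoop (someLoop x) ψ) := rfl

/-- Pulling fixed points back along `h` matches the two sums. The metric is invariant, and
conjugating both loops by arrows of degree `h` changes neither the trace nor the value of the
transported section. -/
theorem charLin_map {a b : LoopBG G} (h : a ⟶ b) (ψ : 𝒳.geomChar.fibre a.pt) :
    E.charLin b.pt ((𝒳.geomChar.functor.map h).lin ψ : 𝒳.geomChar.fibre b.pt) =
      ((𝒴.geomChar.functor.map h).lin (E.charLin a.pt ψ) : 𝒴.geomChar.fibre b.pt) := by
  refine section_ext fun y' v' => ?_
  obtain ⟨w, hw⟩ := 𝒴.exists_to h.elt y'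
  have hd : 𝒴.deg w * a.pt * (𝒴.deg w)⁻¹ = b.pt := by rw [hw]; exact h.conj_eq
  obtain ⟨v, rfl⟩ := exists_conjBy w hd v'
  refine Eq.trans ?_ (evalLoop_map h w hw hd v _).symm
  refine (E.evalLoop_charLin _ _).trans (Eq.trans ?_ (E.evalLoop_charLin _ _).symm)
  rw [k_eq w]
  refine congrArg _ (Fintype.sum_equiv (FixPt.pullEquiv h.elt h.conj_eq) _ _ fun x' => ?_)
  obtain ⟨c, hc⟩ := 𝒳.exists_to h.elt x'.pt
  have hd' : 𝒳.deg c * a.pt * (𝒳.deg c)⁻¹ = b.pt := by rw [hc]; exact h.conj_eq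
  obtain ⟨u, hu⟩ := exists_conjBy c hd' (someLoop x')
  change _ = ((Real.sqrt (𝒳.k (h.elt⁻¹ • x'.pt)) : ℝ) : ℂ) * (conj (E.tr v (x := h.elt⁻¹ • x'.pt)
    (someLoop (x'.pull h.elt h.conj_eq))) * evalLoop (x := h.elt⁻¹ • x'.pt)
      (someLoop (x'.pull h.elt h.conj_eq)) ψ)
  rw [𝒳.k_smul]
  refine congrArg _ (Eq.trans ?_ (E.conj_tr_mul_evalLoop (x := h.elt⁻¹ • x'.pt) v u _ ψ))
  rw [hu, tr_conjBy E w c (hw.trans hc.symm)]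
  exact congrArg _ (evalLoop_map h c hc hd' u ψ)

theorem charLin_id (g : G) (ψ : 𝒳.geomChar.fibre g) : (id 𝒳).charLin g ψ = ψ := by
  refine section_ext fun x u => ?_
  rw [evalLoop_charLin, Finset.sum_eq_single u.fixPt]
  · refine (congrArg (fun c => _ * (_ * c))
      ((id 𝒳).conj_tr_mul_evalLoop (x := x) u (someLoop u.fixPt) u ψ)).trans ?_
    rw [tr_id_self, map_one, one_mul]
    exact inv_mul_cancel_left₀ (ofReal_sqrt_k_ne_zero x) _
  · intro y _ hy
    rw [tr_id_of_ne (y := x) (x := y.pt) fun h => hy (FixPt.ext h.symm), map_zero, zero_mul, mul_zero]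
  · intro h
    exact absurd (Finset.mem_univ _) h

/-- By `tr_comp` this is matrix multiplication over the fixed points of the middle gerbe; the
factors `k_y^(1/2)` and `k_y^(-1/2)` there cancel. -/
theorem charLin_comp (F : Kernel 𝒴 𝒵) (g : G) (ψ : 𝒳.geomChar.fibre g) :
    (comp E F).charLin g ψ = F.charLin g (E.charLin g ψ) := by
  refine section_ext fun z w => ?_
  simp only [evalLoop_charLin, tr_comp, map_sum, Finset.sum_mul, Finset.mul_sum, map_mul]
  rw [Finset.sum_comm]
  refine Finset.sum_congr rfl fun y _ => Finset.sum_congr rfl fun x _ => ?_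
  have := ofReal_sqrt_k_ne_zero y.pt
  field_simp

theorem Iso.charLin_eq {E F : Kernel 𝒳 𝒴} (h : Iso E F) (g : G) : E.charLin g = F.charLin g := by
  refine LinearMap.ext fun ψ => section_ext fun y v => ?_
  simp only [evalLoop_charLin, h.tr_eq]

theorem inner_charLin_localSection {g : G} {x : 𝒳.X} {y : 𝒴.X} (u : 𝒳.Loop x g) (v : 𝒴.Loop y g) :
    (𝒴.geomChar.fibre g).inner (localSection v) (E.charLin g (localSection u)) =
      conj (E.tr v u) := by
  rw [inner_localSection, evalLoop_charLin, mul_inv_cancel_left₀ (ofReal_sqrt_k_ne_zero y),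
    Finset.sum_eq_single u.fixPt]
  · refine (congrArg (fun c => _ * c)
      (E.conj_tr_mul_evalLoop (x := x) v (someLoop u.fixPt) u _)).trans ?_
    rw [evalLoop_localSection]
    change ((Real.sqrt (𝒳.k x) : ℝ) : ℂ) * _ = _
    have := ofReal_sqrt_k_ne_zero x
    push_cast
    field_simp
  · intro x' _ hx
    rw [evalLoop_localSection_of_ne u (someLoop x') hx, mul_zero, mul_zero]
  · intro h
    exact absurd (Finset.mem_univ _) h

/-- The morphism of geometric characters induced by a morphism of gerbes. -/
def charHom : 𝒳.geomChar ⟶ 𝒴.geomChar :=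
  HilbG.Hom.mk
    { app := fun a => ⟨E.charLin a.pt⟩
      naturality := fun a b h => Hilb.hom_ext fun ψ => E.charLin_map h ψ }

end character
end Kernel

/-- The geometric character as a functor. -/
def Gerbe.geomFunctor {G : Type v} [Group G] : FunctorOn fun 𝒴 : Gerbe.{v} G => 𝒴.geomChar where
  map {𝒳 𝒴} f := Quotient.lift (s := Gerbe.kernelSetoid 𝒳 𝒴) Kernel.charHom (fun E F h =>
    HilbG.Hom.ext (NatTrans.ext (funext fun a => Hilb.Hom.ext (h.charLin_eq a.pt)))) f
  map_id 𝒳 := HilbG.Hom.ext (NatTrans.ext (funext fun a => Hilb.hom_ext fun ψ =>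
    Kernel.charLin_id a.pt ψ))
  map_comp := by
    rintro 𝒳 𝒴 𝒵 ⟨E⟩ ⟨F⟩
    exact HilbG.Hom.ext (NatTrans.ext (funext fun a => Hilb.hom_ext fun ψ =>
      Kernel.charLin_comp E F a.pt ψ))

/-! ## The comparison of the 2-character with the geometric character -/

section
variable {H : Type u} [Category.{v} H] [Preadditive H] [Linear ℂ H] [HStarCategory H]

/-- The inner product with a fixed morphism, as a linear form. -/
def homInnerLin {x y : H} (f : x ⟶ y) : (x ⟶ y) →ₗ[ℂ] ℂ where
  toFun := homInner f
  map_add' := homInner_add_right f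
  map_smul' c g := homInner_smul_right c f g

theorem homInner_sum_right {x y : H} {κ : Type*} (s : Finset κ) (f : x ⟶ y) (g : κ → (x ⟶ y)) :
    homInner f (∑ a ∈ s, g a) = ∑ a ∈ s, homInner f (g a) := map_sum (homInnerLin f) g s

end

section
variable {M : MarkedTwoHilb.{u, v}} {F : M ⥤ M}

/-- The single morphisms `𝟙` and `𝟙 / k i` form dual frames of the line `End(e i)`. -/
theorem spread_e_self (hF : IsStarFunctor F) {i : M.ι} (c : M.e i ⟶ F.obj (M.e i)) :
    spread F (M.e i) c = (M.k i : ℂ)⁻¹ • c := by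
  have h : (homHilb (M.e i) (M.e i)).IsFrame (κ := Unit) (fun _ => (𝟙 (M.e i) : M.e i ⟶ M.e i))
      (fun _ => ((M.k i : ℂ)⁻¹ • 𝟙 (M.e i) : M.e i ⟶ M.e i)) := by
    intro (f : M.e i ⟶ M.e i)
    rw [Fintype.sum_unique]
    change homInner (𝟙 (M.e i)) f • ((M.k i : ℂ)⁻¹ • 𝟙 (M.e i)) = f
    rw [smul_smul, mul_comm]
    exact (MarkedTwoHilb.end_e_eq f).symm
  rw [← spread_eq_sum hF c h, Fintype.sum_unique, hF.map_smul, F.map_id, dagger_id, Linear.comp_smul,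
    Category.comp_id, Category.id_comp]

theorem spread_e_of_ne {i j : M.ι} (h : i ≠ j) (c : M.e i ⟶ F.obj (M.e i)) :
    spread F (M.e j) c = 0 := by
  rw [spread_apply]
  refine Finset.sum_eq_zero fun a _ => ?_
  rw [MarkedTwoHilb.hom_e_eq_zero h (homBasis _ _ a), dagger_zero, zero_comp]

end

theorem Gerbe.comp_conjBy {G : Type v} [Group G] {𝒳 : Gerbe.{v} G} {x x' : 𝒳.X} {g g' : G}
    (w : x ⟶ x') (h : 𝒳.deg w * g * (𝒳.deg w)⁻¹ = g') (u : 𝒳.Loop x g) :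
    w ≫ (conjBy w h u).arr = u.arr ≫ w := by
  simp [conjBy]

/-! ### Loops as unitary morphisms and the comparison map -/

namespace TwoRep
variable {G : Type v} [Group G] {α β : TwoRep.{u, v} G}

theorem Arr.hom_congr {i j : α.H.ι} {a b : Arr α i j} (h : a = b) :
    a.hom ≫ α.cast (congrArg Arr.deg h) _ = b.hom := by
  subst h
  exact Category.comp_id _

/-- The unitary morphism `e i ⟶ α_g (e i)` given by a loop. -/
def loopHom {i : α.H.ι} {g : G} (u : α.assocGerbe.Loop i g) : α.H.e i ⟶ (α.act g).obj (α.H.e i) :=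
  Arr.hom (i := i) (j := i) u.arr ≫ α.cast u.deg_eq _

theorem loopHom_unitary {i : α.H.ι} {g : G} (u : α.assocGerbe.Loop i g) :
    IsUnitaryMor (loopHom u) :=
  (Arr.unitary (i := i) (j := i) u.arr).comp (α.cast_unitary _ _)

theorem homInner_loopHom_self {i : α.H.ι} {g : G} (u : α.assocGerbe.Loop i g) :
    homInner (loopHom u) (loopHom u) = α.H.k i := by
  have h := (loopHom_unitary u).homInner_comp_left (𝟙 _) (𝟙 _)
  rw [Category.comp_id, ← (loopHom_unitary u).homInner_id] at h
  rw [h, α.H.k_coe]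

theorem loopHom_smul {i : α.H.ι} {g : G} (z : Circle) (u u' : α.assocGerbe.Loop i g)
    (h : u'.arr = Arr.smul z u.arr) : loopHom u' = (z : ℂ) • loopHom u := by
  obtain ⟨(a : Arr α i i), (ha : a.deg = g)⟩ := u
  obtain ⟨(b : Arr α i i), (hb : b.deg = g)⟩ := u'
  subst ha
  change b = a.smul z at h
  subst h
  change ((z : ℂ) • a.hom) ≫ 𝟙 _ = (z : ℂ) • (a.hom ≫ 𝟙 _)
  rw [Category.comp_id, Category.comp_id]

/-- A loop identifies `α_g (e i)` unitarily with `e i`, so by Schur's lemma it spans the space of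
morphisms; the coefficient uses `(u, u) = k i`. -/
theorem eq_smul_loopHom {i : α.H.ι} {g : G} (u : α.assocGerbe.Loop i g)
    (f : α.H.e i ⟶ (α.act g).obj (α.H.e i)) :
    f = ((α.H.k i : ℂ)⁻¹ * homInner (loopHom u) f) • loopHom u := by
  have h := MarkedTwoHilb.comp_dagger_e f (loopHom u)
  have h1 := congrArg (· ≫ loopHom u) h
  simp only [Category.assoc, (loopHom_unitary u).2, Category.comp_id, Linear.smul_comp,
    Category.id_comp] at h1
  exact h1

/-- Here `α_g (e i)` is isomorphic to a different marked simple object, so Schur's lemma applies. -/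
theorem hom_act_eq_zero {i : α.H.ι} {g : G} (h : α.perm g i ≠ i)
    (f : α.H.e i ⟶ (α.act g).obj (α.H.e i)) : f = 0 := by
  obtain ⟨φ, hφ⟩ := α.exists_unitary_perm g i
  have h1 := MarkedTwoHilb.hom_e_eq_zero h.symm (f ≫ dagger φ)
  rw [← Category.comp_id f, ← hφ.2, ← Category.assoc, h1, zero_comp]

/-- A sum over the simple objects of a function which vanishes at the objects that are not fixed. -/
theorem sum_fixPt {X : Type*} [AddCommMonoid X] {g : G} (F : α.H.ι → X)
    (h : ∀ i, α.perm g i ≠ i → F i = 0) :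
    ∑ i, F i = ∑ x : FixPt α.assocGerbe.X g, F x.pt := by
  refine (Fintype.sum_of_injective (FixPt.pt (X := α.assocGerbe.X) (g := g))
    (fun _ _ h => FixPt.ext h) _ _ (fun i hi => h i fun h' => hi ⟨⟨i, h'⟩, rfl⟩) fun _ => rfl).symm

/-- The hypothesis `e` expresses `u' = w u w⁻¹` without inverses. Composing both entries with the
unitary built from `w` turns `u'` into `u` and, by `conjApp_mu`, the conjugated transformation into
`θ`; unitaries and the action preserve inner products. -/
theorem homInner_conjApp {x x' : α.H.ι} {g g' h : G} (hg : h * g * h⁻¹ = g')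
    {w : α.H.e x' ⟶ (α.act h).obj (α.H.e x)} (hw : IsUnitaryMor w)
    (u : α.H.e x ⟶ (α.act g).obj (α.H.e x)) (u' : α.H.e x' ⟶ (α.act g').obj (α.H.e x'))
    (hk : g' * h = h * g)
    (e : u' ≫ (α.act g').map w ≫ α.mu hk _ = w ≫ (α.act h).map u ≫ α.mu rfl _)
    (θ : 𝟭 α.H ⟶ α.act g) :
    homInner u' (α.conjApp h hg θ (α.H.e x')) = homInner u (θ.app (α.H.e x)) := by
  have h1 := ((α.act_star g').map_isUnitaryMor hw).comp (α.mu_unitary hk (α.H.e x))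
  rw [← h1.homInner_comp_right, e, ← Category.assoc (α.conjApp h hg θ _), ← conjApp_naturality,
    Category.assoc, α.conjApp_mu h hg θ hk rfl, hw.homInner_comp_left,
    (α.mu_unitary _ _).homInner_comp_right, α.act_inner]

/-- The two sides are the morphisms underlying the two composites in the relation `u' w = w u` of
the gerbe, with the transports between equal degrees absorbed into the compositors. -/
theorem loopHom_conjBy {x x' : α.H.ι} {g g' : G} (w : Arr α x x')
    (hd : w.deg * g * w.deg⁻¹ = g') (u : α.assocGerbe.Loop x g) (hk : g' * w.deg = w.deg * g) :
    loopHom (Gerbe.conjBy (𝒳 := α.assocGerbe) (x := x) (x' := x') w hd u) ≫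
        (α.act g').map w.hom ≫ α.mu hk _ =
      w.hom ≫ (α.act w.deg).map (loopHom u) ≫ α.mu rfl _ := by
  obtain ⟨u', hu'⟩ : ∃ u', u' = Gerbe.conjBy (𝒳 := α.assocGerbe) (x := x) (x' := x') w hd u :=
    ⟨_, rfl⟩
  have h1 : Arr.comp w (u'.arr : Arr α x' x') = Arr.comp (u.arr : Arr α x x) w := by
    rw [hu']
    exact Gerbe.comp_conjBy (𝒳 := α.assocGerbe) (x := x) (x' := x') w hd u
  rw [← hu']
  obtain ⟨(a : Arr α x x), (ha : a.deg = g)⟩ := u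
  obtain ⟨(b : Arr α x' x'), (hb : b.deg = g')⟩ := u'
  clear hu'
  subst ha hb
  have h2 := Arr.hom_congr h1
  change (b.hom ≫ 𝟙 _) ≫ _ = w.hom ≫ (α.act w.deg).map (a.hom ≫ 𝟙 _) ≫ _
  rw [Category.comp_id, Category.comp_id]
  refine Eq.trans ?_ h2
  change _ = (b.hom ≫ (α.act b.deg).map w.hom ≫ α.mu rfl _) ≫ α.cast _ _
  rw [Category.assoc, Category.assoc, mu_cast]

open Gerbe

/-- The comparison map from the 2-character to the geometric character of the associated gerbe. -/
def gammaLin (g : G) : α.charFibre g →ₗ[ℂ] α.assocGerbe.geomChar.fibre g where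
  -- The factor `k_x^(-1/2)` makes the map isometric: a multiple `c u` of the unitary loop
  -- contributes `k_x² |c|²` to the square norm on either side.
  toFun θ := mkSection (fun x u => ((Real.sqrt (α.assocGerbe.k x) : ℝ) : ℂ)⁻¹ *
      homInner (loopHom u) (NatTrans.app (G := α.act g) θ (α.H.e x))) fun x z u => by
    rw [loopHom_smul (i := x) z u (z • u) (α.assocGerbe_sc z (i := x) (j := x) u.arr),
      homInner_smul_left, Circle.coe_inv_eq_conj]
    exact mul_left_comm _ _ _
  map_add' θ θ' := section_ext fun x u => by
    rw [map_add]
    exact (congrArg _ (homInner_add_right _ _ _)).trans (mul_add _ _ _)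
  map_smul' c θ := section_ext fun x u => by
    rw [map_smul]
    exact (congrArg _ (homInner_smul_right _ _ _)).trans (mul_left_comm _ _ _)

theorem evalLoop_gammaLin {g : G} (θ : 𝟭 α.H ⟶ α.act g) {x : α.H.ι} (u : α.assocGerbe.Loop x g) :
    evalLoop u (gammaLin g θ) =
      ((Real.sqrt (α.H.k x) : ℝ) : ℂ)⁻¹ * homInner (loopHom u) (θ.app (α.H.e x)) := rfl

theorem sqrt_k_ne_zero (x : α.H.ι) : ((Real.sqrt (α.H.k x) : ℝ) : ℂ) ≠ 0 :=
  ofReal_sqrt_k_ne_zero (𝒳 := α.assocGerbe) x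

theorem sqrt_k_mul_self (x : α.H.ι) :
    ((Real.sqrt (α.H.k x) : ℝ) : ℂ) * ((Real.sqrt (α.H.k x) : ℝ) : ℂ) = α.H.k x :=
  ofReal_sqrt_k_mul_self (𝒳 := α.assocGerbe) x

/-- The identity holds term by term over the fixed points, by expanding both components as multiples
of the loop; the other simple objects contribute nothing to the 2-character. -/
theorem gammaLin_inner (g : G) (θ θ' : 𝟭 α.H ⟶ α.act g) :
    (α.assocGerbe.geomChar.fibre g).inner (gammaLin g θ) (gammaLin g θ') =
      (α.charFibre g).inner θ θ' := by
  rw [inner_section]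
  have key : ∀ (i : α.H.ι) (u : α.assocGerbe.Loop i g), (α.H.k i : ℂ) *
      (conj (evalLoop u (gammaLin g θ)) * evalLoop u (gammaLin g θ')) =
        (α.H.k i : ℂ) * homInner (θ.app (α.H.e i)) (θ'.app (α.H.e i)) := by
    intro i u
    refine congrArg _ ?_
    refine Eq.trans (congrArg₂ (fun a b => conj a * b) (evalLoop_gammaLin θ u)
      (evalLoop_gammaLin θ' u)) ?_
    generalize θ.app (α.H.e i) = f
    generalize θ'.app (α.H.e i) = f'
    conv_rhs => rw [eq_smul_loopHom u f, eq_smul_loopHom u f', homInner_smul_left,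
      homInner_smul_right]
    have h0 := MarkedTwoHilb.k_ne_zero i
    have h1 := sqrt_k_ne_zero i
    have h2 := sqrt_k_mul_self i
    have h3 := homInner_loopHom_self u
    simp only [map_mul, map_inv₀, Complex.conj_ofReal]
    rw [← h2] at h3 ⊢
    refine Eq.trans ?_ (congrArg (fun c => conj (homInner (loopHom u) f) *
      homInner (loopHom u) f' * (((Real.sqrt (α.H.k i) : ℝ) : ℂ) * ((Real.sqrt (α.H.k i) : ℝ) : ℂ))⁻¹ *
      (((Real.sqrt (α.H.k i) : ℝ) : ℂ) * ((Real.sqrt (α.H.k i) : ℝ) : ℂ))⁻¹ * c) h3.symm |>.trans ?_)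
    · field_simp
    · simp only [Functor.id_obj]
      ring
  refine (Finset.sum_congr rfl fun x _ => key x.pt (someLoop x)).trans
    (sum_fixPt (g := g) (fun i => (α.H.k i : ℂ) *
      homInner (θ.app (α.H.e i)) (θ'.app (α.H.e i))) fun i hi => ?_).symm
  rw [hom_act_eq_zero hi (θ'.app (α.H.e i)), homInner_zero_right, mul_zero]

/-- Injectivity follows from isometry. For surjectivity the prescribed values are placed on the
loops over fixed points and spread out to a natural transformation. -/
theorem gammaLin_bijective (g : G) : Function.Bijective (gammaLin (α := α) g) := by
  refine ⟨(injective_iff_map_eq_zero _).2 fun θ h => ?_, fun ψ => ?_⟩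
  · refine Hilb.inner_definite _ _ ((gammaLin_inner g θ θ).symm.trans ?_)
    rw [h]
    exact Hilb.inner_zero_left _ _
  -- At `e x` only the summand of `x` survives and spreading divides by `k x`. Pairing with the loop
  -- restores `k x`, so the coefficient must be `k_x^(1/2)` times the value.
  · let c : FixPt α.assocGerbe.X g → ℂ := fun x =>
      ((Real.sqrt (α.assocGerbe.k x.pt) : ℝ) : ℂ) * evalLoop (someLoop x) ψ
    let θ : 𝟭 α.H ⟶ α.act g :=
      { app := fun y => ∑ x : FixPt α.assocGerbe.X g, c x •
          spread (α.act g) y (loopHom (i := x.pt) (someLoop x))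
        naturality := fun y y' f => by
          simp only [Functor.id_map, Preadditive.comp_sum, Preadditive.sum_comp, Linear.comp_smul,
            Linear.smul_comp]
          exact Finset.sum_congr rfl fun x _ =>
            congrArg _ (spread_naturality (α.act_star g) _ f) }
    have key : ∀ (x : α.H.ι) (u : α.assocGerbe.Loop x g),
        evalLoop u (gammaLin g θ) = evalLoop u ψ := ?_
    · exact ⟨θ, section_ext key⟩
    intro x u
    -- The phase between `u` and the chosen loop cancels between the value of `ψ` and the unitary
    -- morphism.
    obtain ⟨z, hz⟩ := exists_smul_loop (𝒳 := α.assocGerbe) (x := x) u (someLoop u.fixPt)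
    have h1 : θ.app (α.H.e x) = (((Real.sqrt (α.H.k x) : ℝ) : ℂ) * evalLoop u ψ) •
        (α.H.k x : ℂ)⁻¹ • loopHom u := by
      change ∑ x' : FixPt α.assocGerbe.X g, c x' •
          spread (α.act g) (α.H.e x) (loopHom (i := x'.pt) (someLoop x')) = _
      rw [Finset.sum_eq_single u.fixPt]
      · refine (congrArg _ (spread_e_self (α.act_star g) (loopHom (i := x) _))).trans ?_
        change (((Real.sqrt (α.H.k x) : ℝ) : ℂ) * evalLoop (x := x) (someLoop u.fixPt) ψ) • _ = _
        refine Eq.trans (congrArg₂ (fun (a : ℂ) (b : α.H.e x ⟶ (α.act g).obj (α.H.e x)) =>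
          (((Real.sqrt (α.H.k x) : ℝ) : ℂ) * a) • (α.H.k x : ℂ)⁻¹ • b)
            ((congrArg (fun u => evalLoop u ψ) hz).trans (evalLoop_smul (x := x) z u ψ))
            (loopHom_smul z u _ ((congrArg Loop.arr hz).trans (α.assocGerbe_sc z u.arr)))) ?_
        rw [smul_comm _ (z : ℂ), smul_smul, smul_smul, smul_smul]
        congr 1
        rw [Circle.coe_inv]
        have := Circle.coe_ne_zero z
        field_simp
      · intro x' _ hx
        have h := spread_e_of_ne (F := α.act g) (i := x'.pt) (j := x)
          (fun h => hx (FixPt.ext h)) (loopHom (i := x'.pt) (someLoop x'))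
        rw [h, smul_zero]
      · intro h
        exact absurd (Finset.mem_univ _) h
    refine (evalLoop_gammaLin θ u).trans ?_
    rw [h1, homInner_smul_right, homInner_smul_right, homInner_loopHom_self,
      inv_mul_cancel₀ (MarkedTwoHilb.k_ne_zero x), mul_one]
    exact inv_mul_cancel_left₀ (sqrt_k_ne_zero x) _

theorem gammaLin_map {a b : LoopBG G} (h : a ⟶ b) (θ : 𝟭 α.H ⟶ α.act a.pt) :
    gammaLin b.pt (α.conjNat h.elt h.conj_eq θ) =
      ((α.assocGerbe.geomChar.functor.map h).lin (gammaLin a.pt θ) :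
        α.assocGerbe.geomChar.fibre b.pt) := by
  refine section_ext fun x' u' => ?_
  obtain ⟨w, hw⟩ := α.assocGerbe.exists_to h.elt x'
  have hd : α.assocGerbe.deg w * a.pt * (α.assocGerbe.deg w)⁻¹ = b.pt := by rw [hw]; exact h.conj_eq
  obtain ⟨u, rfl⟩ := exists_conjBy w hd u'
  refine Eq.trans ?_ (evalLoop_map h w hw hd u _).symm
  -- The degree of `w` equals `h.elt` only by a proof, so it is generalised to a variable `k` for
  -- which the equality can be substituted.
  have key : ∀ (x x' : α.H.ι) (w : Arr α x x') (g g' k : G) (hk : w.deg = k)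
      (hd : w.deg * g * w.deg⁻¹ = g') (hd' : k * g * k⁻¹ = g') (u : α.assocGerbe.Loop x g)
      (θ : 𝟭 α.H ⟶ α.act g),
      homInner (loopHom (conjBy (𝒳 := α.assocGerbe) (x := x) (x' := x') w hd u))
        (α.conjApp k hd' θ (α.H.e x')) = homInner (loopHom u) (θ.app (α.H.e x)) := by
    rintro x x' w g g' _ rfl hd hd' u θ
    have hk : g' * w.deg = w.deg * g := by rw [← hd]; group
    exact homInner_conjApp hd' w.unitary _ _ hk (loopHom_conjBy w hd u hk) θ
  refine (evalLoop_gammaLin _ _).trans (Eq.trans ?_ (evalLoop_gammaLin _ _).symm)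
  exact congrArg₂ (fun (r : ℝ) (c : ℂ) => ((Real.sqrt r : ℝ) : ℂ)⁻¹ * c)
    (k_eq (𝒳 := α.assocGerbe) w).symm (key _ x' w _ _ _ hw hd h.conj_eq u θ)

/-- Write the trace as `∑ (l, w ≫ β_g(l) ≫ σ_g ≫ σ(u*))` over an orthonormal basis of `Hom(e m, σ(e
i))`. Conjugation exchanges the entries, the adjunction rules for the inner product isolate `w`, and
what remains is the contraction over the adjoint basis. This explains the complex conjugate in the
definition of the geometric character. -/
theorem conj_tr_bundle (σ : Mor α β) {i : α.H.ι} {m : β.H.ι} {g : G} (w : β.assocGerbe.Loop m g)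
    (u : α.assocGerbe.Loop i g) : conj (σ.bundle.tr w u) =
      homInner (loopHom w) (spread (β.act g) (β.H.e m)
        (σ.fn.map (loopHom u) ≫ dagger (σ.co g (α.H.e i)))) := by
  obtain ⟨(b : Arr β m m), (hb : b.deg = g)⟩ := w
  obtain ⟨(a : Arr α i i), (ha : a.deg = g)⟩ := u
  subst hb
  have h1 : σ.bundle.tr (𝒳 := α.assocGerbe) (𝒴 := β.assocGerbe) (y := m) (x := i) ⟨b, rfl⟩ ⟨a, ha⟩ =
      ∑ c, homInner (homBasis (β.H.e m) (σ.fn.obj (α.H.e i)) c)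
        (σ.bundleMap b a ha.symm (homBasis (β.H.e m) (σ.fn.obj (α.H.e i)) c)) :=
    Hilb.trace_eq_sum_onb (V := homHilb (β.H.e m) (σ.fn.obj (α.H.e i))) (σ.bundleLin b a ha.symm)
  refine (congrArg _ h1).trans ?_
  change _ = homInner (b.hom ≫ 𝟙 _) (spread _ _ (σ.fn.map (a.hom ≫ α.cast ha _) ≫ _))
  rw [Category.comp_id, ← spread_eq_sum (β.act_star b.deg) _
    (isFrame_dagger_homBasis (σ.fn.obj (α.H.e i)) (β.H.e m)), homInner_sum_right, map_sum]
  refine Finset.sum_congr rfl fun c _ => ?_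
  rw [homInner_conj, Mor.bundleMap, dagger_dagger, (β.act_star b.deg).map_dagger, σ.star.map_dagger]
  generalize homBasis (β.H.e m) (σ.fn.obj (α.H.e i)) c = l
  generalize a.hom ≫ α.cast ha _ = p
  have h2 := homInner_comp_right b.hom ((β.act b.deg).map l ≫ σ.co b.deg (α.H.e i) ≫
    dagger (σ.fn.map p)) l
  rw [h2, dagger_comp, dagger_comp, dagger_dagger, Category.assoc]

/-- Replacing `θ` at `e i` by its multiple of a loop `u` turns the basis formula for the 2-character
into matrix coefficients, which `conj_tr_bundle` identifies with those of the geometric character.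
The powers combine as `k_i · k_i⁻¹ · k_i^(1/2)`. -/
theorem gammaLin_naturality (σ : Mor α β) (g : G) (θ : 𝟭 α.H ⟶ α.act g) :
    gammaLin g (σ.charNat g θ) = σ.bundle.charLin g (gammaLin g θ) := by
  have key : ∀ (m : β.H.ι) (w : β.assocGerbe.Loop m g) (i : α.H.ι) (u : α.assocGerbe.Loop i g),
      homInner (loopHom w) ((α.H.k i : ℂ) • spread (β.act g) (β.H.e m)
        (σ.pushAt g θ (α.H.e i))) = ((Real.sqrt (α.H.k i) : ℝ) : ℂ) *
          (conj (σ.bundle.tr w u) * evalLoop u (gammaLin g θ)) := by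
    intro m w i u
    have h1 : σ.pushAt g θ (α.H.e i) = ((α.H.k i : ℂ)⁻¹ * homInner (loopHom u) (θ.app (α.H.e i))) •
        (σ.fn.map (loopHom u) ≫ dagger (σ.co g (α.H.e i))) := by
      rw [← Linear.smul_comp, ← σ.star.map_smul, ← eq_smul_loopHom u (θ.app (α.H.e i))]
      rfl
    refine Eq.trans ?_ (congrArg₂ (fun a b => ((Real.sqrt (α.H.k i) : ℝ) : ℂ) * (a * b))
      (conj_tr_bundle σ w u) (evalLoop_gammaLin θ u)).symm
    rw [h1, map_smul, homInner_smul_right, homInner_smul_right]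
    have h0 := MarkedTwoHilb.k_ne_zero i
    have h2 := sqrt_k_ne_zero i
    field_simp
  have key' : ∀ (m : β.H.ι) (w : β.assocGerbe.Loop m g),
      homInner (loopHom w) ((σ.charNat g θ).app (β.H.e m)) = ∑ x : FixPt α.assocGerbe.X g,
        ((Real.sqrt (α.assocGerbe.k x.pt) : ℝ) : ℂ) *
          (conj (σ.bundle.tr w (someLoop x)) * evalLoop (someLoop x) (gammaLin g θ)) := by
    intro m w
    rw [Mor.charNat_app, homInner_sum_right, sum_fixPt (g := g)]
    · exact Finset.sum_congr rfl fun x _ => key m w x.pt (someLoop x)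
    · intro i hi
      have h1 : σ.pushAt g θ (α.H.e i) = 0 := by
        rw [Mor.pushAt, hom_act_eq_zero hi (θ.app (α.H.e i))]
        exact (congrArg (· ≫ _) (map_zero (σ.star.mapLin _ _))).trans zero_comp
      rw [h1, map_zero, smul_zero, homInner_zero_right]
  exact section_ext fun m w => (evalLoop_gammaLin _ w).trans
    ((congrArg _ (key' m w)).trans (σ.bundle.evalLoop_charLin w _).symm)

/-- The comparison of the 2-character with the geometric character of the associated gerbe. -/
def gammaHom (α : TwoRep.{u, v} G) : α.twoChar ⟶ HilbG.lift.{u}.obj α.assocGerbe.geomChar :=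
  HilbG.Hom.mk
    { app := fun a => ⟨ULift.moduleEquiv.symm.toLinearMap ∘ₗ gammaLin a.pt⟩
      naturality := fun a b h => Hilb.hom_ext fun θ => ULift.ext _ _ (gammaLin_map h θ) }

theorem gammaHom_isUnitary (α : TwoRep.{u, v} G) (g : G) :
    Hilb.IsUnitary (HilbG.at' (gammaHom α) g) :=
  ⟨ULift.moduleEquiv.symm.bijective.comp (gammaLin_bijective g), gammaLin_inner g⟩

end TwoRep

/-! ### The natural isomorphism and the theorem -/

theorem Hilb.isIso_of_bijective {V W : Hilb.{w}} {f : V ⟶ W} (hf : Function.Bijective f.lin) :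
    IsIso f :=
  ⟨⟨⟨(LinearEquiv.ofBijective f.lin hf).symm.toLinearMap⟩,
    Hilb.hom_ext fun x => (LinearEquiv.ofBijective f.lin hf).symm_apply_apply x,
    Hilb.hom_ext fun x => (LinearEquiv.ofBijective f.lin hf).apply_symm_apply x⟩⟩

theorem HilbG.isIso_of_isUnitary {G : Type v} [Group G] {E F : HilbG.{v, w} G} {f : E ⟶ F}
    (hf : ∀ g, Hilb.IsUnitary (at' f g)) : IsIso f := by
  have h : ∀ a, IsIso (f.nat.app a) := fun a => Hilb.isIso_of_bijective (hf a.pt).1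
  have : IsIso f.nat := NatIso.isIso_of_isIso_app f.nat
  exact ⟨⟨⟨inv f.nat⟩, Hom.ext (IsIso.hom_inv_id f.nat), Hom.ext (IsIso.inv_hom_id f.nat)⟩⟩

/-- The comparison of the 2-character with the geometric character, as a natural isomorphism. -/
def TwoRep.gammaIso {G : Type v} [Group G] :
    (charFunctor.{u, v} (G := G)).toFunctor ≅ (gerbeFunctor.{u, v} (G := G)).toFunctor ⋙
      Gerbe.geomFunctor.toFunctor ⋙ HilbG.lift.{u} :=
  NatIso.ofComponents (fun α => @asIso _ _ _ _ (gammaHom α)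
    (HilbG.isIso_of_isUnitary (gammaHom_isUnitary α))) (by
    rintro α β ⟨σ⟩
    exact HilbG.Hom.ext (NatTrans.ext (funext fun a => Hilb.hom_ext fun θ =>
      ULift.ext _ _ (gammaLin_naturality σ a.pt θ))))

end

/-- Since the formula for `χ` is asserted for every right adjoint that is a *-functor, it contains
the independence of that choice. The functor `HilbG.lift` only adjusts universes: natural
transformations live in `max u v`, sections over the finite set of simple objects in `v`. -/
theorem mainTheorem4 (G : Type v) [Group G] [Finite G] :
    (∀ {α β : TwoRep.{u, v} G} (σ : TwoRep.Mor α β),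
      ∃ R : β.H ⥤ α.H, IsStarFunctor R ∧ Nonempty (σ.fn ⊣ R)) ∧
    ∃ (χ : FunctorOn fun α : TwoRep.{u, v} G => α.twoChar)
      (𝒳 : FunctorOn fun α : TwoRep.{u, v} G => α.assocGerbe)
      (ch : FunctorOn fun 𝒴 : Gerbe.{v} G => 𝒴.geomChar),
      (∀ {α β : TwoRep.{u, v} G} (σ : TwoRep.Mor α β) (R : β.H ⥤ α.H) (hR : IsStarFunctor R)
        (adj : σ.fn ⊣ R) (g : G) (θ : α.twoChar.fibre g) (y : β.H),
        (TwoRep.toNat ((HilbG.at' (χ.map σ.toHom) g).lin θ)).app y =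
          σ.charApp R hR adj g (TwoRep.toNat θ) y) ∧
      (∀ {α β : TwoRep.{u, v} G} (σ : TwoRep.Mor α β), 𝒳.map σ.toHom = σ.bundle.toHom) ∧
      (∀ {𝒴 𝒵 : Gerbe.{v} G} (E : Kernel 𝒴 𝒵) (g : G) (y : 𝒴.X) (z : 𝒵.X) (u : 𝒴.Loop y g)
        (w : 𝒵.Loop z g),
        (𝒵.geomChar.fibre g).inner (Gerbe.localSection w)
            ((HilbG.at' (ch.map E.toHom) g).lin (Gerbe.localSection u)) =
          conj (LinearMap.trace ℂ (E.fib z y)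
            (E.act w.arr u.arr (w.deg_eq.trans u.deg_eq.symm)))) ∧
      ∃ γ : χ.toFunctor ≅ 𝒳.toFunctor ⋙ ch.toFunctor ⋙ HilbG.lift.{u},
        ∀ (α : TwoRep.{u, v} G) (g : G), Hilb.IsUnitary (HilbG.at' (γ.hom.app α) g) :=
  ⟨fun σ => exists_right_adjoint σ.star, TwoRep.charFunctor, TwoRep.gerbeFunctor, Gerbe.geomFunctor,
    fun σ R hR adj g θ y => (σ.charApp_eq R hR adj g θ y).symm, fun σ => rfl,
    fun E g y z u w => E.inner_charLin_localSection u w, TwoRep.gammaIso,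
    fun α g => TwoRep.gammaHom_isUnitary α g⟩
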